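/- Let $E, V, H$ be separable real Banach spaces with continuous embeddings $E\subset V\subset H$; write $|\cdot|_E$, $\|\cdot\|$, $|\cdot|_H$ for the norms. For $T>0$ let $X_T=C([0,T];V)\cap L^2(0,T;E)$ with $|v|_{X_T}^2=\sup_{s\le T}\|v(s)\|^2+\int_0^T|v(s)|_E^2\,ds$. Let $(\Omega,\mathcal F,\mathbb P)$ be a complete probability space with a filtration $(\mathcal F_t)_{t\ge0}$ satisfying the usual conditions, let $W$ be a one-dimensional Wiener process with respect to it, and let $M^2(X_T)$ be the space of $V$-valued progressively measurable processes $u$ with trajectories almost surely in $X_T$ and $|u|_{M^2(X_T)}^2=\mathbb E|u|_{X_T}^2<\infty$; let $M^2(0,T;V)$ be the space of progressively measurable $V$-valued processes $\xi$ with $|\xi|^2_{M^2(0,T;V)}=\mathbb E\int_0^T\|\xi\|^2ds<\infty$. Let $(S(t))_{t\ge0}$ be a $C_0$-semigroup on $H$, with generator $A$, and let $F:E\to H$, $G:E\to V$. Assume: (F) $F(0)=0$ and there are $p\ge1$, $\alpha\in[0,1)$, $C>0$ with $$|F(y)-F(x)|_H\le C\big[\|y-x\|\,\|y\|^{p-\alpha}|y|_E^\alpha+|y-x|_E^\alpha\|y-x\|^{1-\alpha}\|x\|^p\big]\quad\text{for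 all }x,y\in E.$$ (G) $G(0)=0$ and there are $k\ge1$, $\beta\in[0,1)$, $C_G>0$ with $$\|G(y)-G(x)\|\le C_G\big[\|y-x\|\,\|y\|^{k-\beta}|y|_E^\beta+|y-x|_E^\beta\|y-x\|^{1-\beta}\|x\|^k\big]\quad\text{for all }x,y\in E.$$ (S) There are constants $C_1,C_2>0$ such that for every $T>0$: for every $f\in L^2(0,T;H)$ the function $(S*f)(t)=\int_0^tS(t-r)f(r)\,dr$ belongs to $X_T$ and $|S*f|_{X_T}\le C_1|f|_{L^2(0,T;H)}$; for every $\xi\in M^2(0,T;V)$ the process $(S\diamond\xi)(t)=\int_0^tS(t-r)\xi(r)\,dW(r)$ exists and (up to modification) belongs to $M^2(X_T)$, with $|S\diamond\xi|_{M^2(X_T)}\le C_2|\xi|_{M^2(0,T;V)}$. Moreover $S(\cdot)x\in X_T$ for every $T>0$ and $x\in V$, and for every $T_0>0$ there is $C_0>0$ with $|S(\cdot)x|_{X_T}\le C_0\|x\|$ for all $T\in(0,T_0]$ and $x\in V$. Here $H$-valued Itô integrals are limits in probability of the integrals of elementary processes $\varphi_n$ with $\int_0^t|\varphi_n-\Phi|_H^2\,ds\to0$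 in probability. For an $\mathcal F_0$-measurable $V$-valued $u_0$ with $\mathbb E\|u_0\|^2<\infty$, a *local mild solution* of $$du=(Au+F(u))\,dt+G(u)\,dW,\qquad u(0)=u_0,$$ is a pair $(u,\tau)$ where $\tau$ is an accessible stopping time (almost surely the limit of an increasing sequence of stopping times that are $<\tau$), $u:[0,\tau)\times\Omega\to V$ is adapted with almost surely continuous trajectories, and there are finite stopping times $\tau_m$ with $\tau_m<\tau$ and $\tau_m\uparrow\tau$ almost surely such that for all $m$ and $t\ge0$ $$\mathbb E\Big(\sup_{s\le t\wedge\tau_m}\|u(s)\|^2+\int_0^{t\wedge\tau_m}|u(s)|_E^2\,ds\Big)<\infty,$$ $$u(t\wedge\tau_m)=S(t\wedge\tau_m)u_0+\int_0^{t\wedge\tau_m}S(t\wedge\tau_m-s)F(u(s))\,ds+J_m(t\wedge\tau_m)\quad\text{a.s.},$$ where $J_m$ is a continuous $H$-valued process with $J_m(t)=\int_0^t\mathbf 1_{[0,\tau_m)}(s)S(t-s)G(u(s))\,dW(s)$ a.s. for every $t\ge0$. It is *unique* if for every local mild solution $(v,\sigma)$ with the same $u_0$ and every $t>0$, for almost every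 $\omega$ with $t<\tau(\omega)\wedge\sigma(\omega)$, one has $u=v$ on $[0,t]$. Then for every $\mathcal F_0$-measurable $V$-valued $u_0$ with $\mathbb E\|u_0\|^2<\infty$ there is a unique local mild solution $(u,T_1)$, and these solutions can be chosen such that for all $R>0$ and $\varepsilon>0$ there is $\tau(\varepsilon,R)>0$, not depending on $u_0$, with $$\mathbb P\big(T_1\ge\tau(\varepsilon,R)\big)\ge1-\varepsilon\quad\text{for every such }u_0\text{ with }\mathbb E\|u_0\|^2\le R^2 .$$ -/

import Mathlib

open MeasureTheory ProbabilityTheory Filter Topology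
open scoped NNReal ENNReal

/-- Lebesgue measure on the time axis `[0, ∞)`. -/
noncomputable def timeLeb : Measure ℝ≥0 :=
  Measure.comap (fun t : ℝ≥0 => (t : ℝ)) volume

section Paths

variable {E V : Type*} [NormedAddCommGroup E] [NormedSpace ℝ E]
  [NormedAddCommGroup V] [NormedSpace ℝ V]

/-- The `E`-norm of a point `x` of `V`, for an embedding `j` of `E` into `V`:
it is `‖e‖` if `x = j e`, and `∞` if `x` does not lie in `E`. -/
noncomputable def subNorm (j : E →L[ℝ] V) (x : V) : ℝ≥0∞ :=
  ⨅ (e : E) (_ : j e = x), ‖e‖ₑ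

/-- `|v|_{X_T}² = sup_{s ≤ T} ‖v(s)‖_V² + ∫₀ᵀ |v(s)|_E² ds`, with value `∞` where this makes no
sense. For a path `v` that is continuous into `V`, finiteness means that `v(s)` lies in `E` for
almost every `s ≤ T` and that `v` is square integrable into `E`. -/
noncomputable def xNormSq (j : E →L[ℝ] V) (T : ℝ≥0) (v : ℝ≥0 → V) : ℝ≥0∞ :=
  (⨆ s ∈ Set.Iic T, ‖v s‖ₑ ^ 2) + ∫⁻ s in Set.Iic T, subNorm j (v s) ^ 2 ∂timeLeb

/-- The path `v` belongs to `X_T = C([0,T];V) ∩ L²(0,T;E)`. -/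
def MemX (j : E →L[ℝ] V) (T : ℝ≥0) (v : ℝ≥0 → V) : Prop :=
  ContinuousOn v (Set.Iic T) ∧ xNormSq j T v < ∞

/-- Locally Lipschitz maps of polynomial type, defined on `E ⊂ V`, with values in `Y`:
`F 0 = 0` and, with some `p ≥ 1`, `α ∈ [0,1)`, `C > 0`,
`|F y - F x|_Y ≤ C (‖y-x‖ ‖y‖^(p-α) |y|_E^α + |y-x|_E^α ‖y-x‖^(1-α) ‖x‖^p)`. -/
def IsPolyLipschitz {Y : Type*} [NormedAddCommGroup Y] (j : E →L[ℝ] V) (F : E → Y) : Prop :=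
  F 0 = 0 ∧ ∃ p α C : ℝ, 1 ≤ p ∧ 0 ≤ α ∧ α < 1 ∧ 0 < C ∧ ∀ x y : E,
    ‖F y - F x‖ ≤ C * (‖j (y - x)‖ * ‖j y‖ ^ (p - α) * ‖y‖ ^ α
      + ‖y - x‖ ^ α * ‖j (y - x)‖ ^ (1 - α) * ‖j x‖ ^ p)

end Paths

/-- `S` is a strongly continuous semigroup of bounded linear operators on `H`. -/
structure IsC0Semigroup {H : Type*} [NormedAddCommGroup H] [NormedSpace ℝ H]
    (S : ℝ≥0 → H →L[ℝ] H) : Prop where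
  map_zero : S 0 = ContinuousLinearMap.id ℝ H
  map_add : ∀ s t : ℝ≥0, S (s + t) = (S s).comp (S t)
  strong_cont : ∀ x : H, Continuous fun t => S t x

section Stochastic

variable {Ω : Type*} {mΩ : MeasurableSpace Ω}

/-- The usual conditions: the probability space is complete, `𝓕 0` contains all null sets, and the
filtration is right-continuous. -/
structure UsualConditions (μ : Measure Ω) (𝓕 : Filtration ℝ≥0 mΩ) : Prop where
  null_mem : ∀ s : Set Ω, μ s = 0 → MeasurableSet[𝓕 0] s
  right_cont : 𝓕.IsRightContinuous

/-- `W` is a one-dimensional Wiener process with respect to the filtration `𝓕`. -/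
structure IsWiener (μ : Measure Ω) (𝓕 : Filtration ℝ≥0 mΩ) (W : ℝ≥0 → Ω → ℝ) : Prop where
  brownian : IsBrownianReal W μ
  adapted : StronglyAdapted 𝓕 W
  indep : ∀ s t : ℝ≥0, s ≤ t →
    Indep (MeasurableSpace.comap (fun ω => W t ω - W s ω) inferInstance) (𝓕 s) μ

/-- An `H`-valued elementary process `∑_{k < N} 1_{(t_k, t_{k+1}]} η_k` with bounded
`𝓕 (t_k)`-measurable `η_k`. -/
structure ElemProcess (𝓕 : Filtration ℝ≥0 mΩ) (H : Type*) [NormedAddCommGroup H] where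
  N : ℕ
  time : ℕ → ℝ≥0
  time_mono : Monotone time
  coeff : ℕ → Ω → H
  coeff_meas : ∀ k, StronglyMeasurable[𝓕 (time k)] (coeff k)
  coeff_bdd : ∃ C : ℝ, ∀ k ω, ‖coeff k ω‖ ≤ C

variable {H : Type*} [NormedAddCommGroup H] [NormedSpace ℝ H]

/-- The value of an elementary process at time `s`. -/
noncomputable def ElemProcess.eval {𝓕 : Filtration ℝ≥0 mΩ} (φ : ElemProcess 𝓕 H)
    (s : ℝ≥0) (ω : Ω) : H :=
  ∑ k ∈ Finset.range φ.N,
    (Set.Ioc (φ.time k) (φ.time (k + 1))).indicator (fun _ => φ.coeff k ω) s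

/-- `∫₀ᵗ φ dW` for an elementary process `φ`. -/
noncomputable def ElemProcess.integral {𝓕 : Filtration ℝ≥0 mΩ} (φ : ElemProcess 𝓕 H)
    (W : ℝ≥0 → Ω → ℝ) (t : ℝ≥0) (ω : Ω) : H :=
  ∑ k ∈ Finset.range φ.N,
    (W (min (φ.time (k + 1)) t) ω - W (min (φ.time k) t) ω) • φ.coeff k ω

/-- The random variable `J` is (a version of) the Itô integral `∫₀ᵗ Φ(s) dW(s)`: there are
elementary processes `φ_n` with `∫₀ᵗ ‖φ_n - Φ‖² ds → 0` and `∫₀ᵗ φ_n dW → J`, both in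
probability. -/
def IsItoIntegral (μ : Measure Ω) (𝓕 : Filtration ℝ≥0 mΩ) (W : ℝ≥0 → Ω → ℝ) (t : ℝ≥0)
    (Φ : ℝ≥0 → Ω → H) (J : Ω → H) : Prop :=
  (∀ᵐ ω ∂μ, AEStronglyMeasurable (fun s => Φ s ω) (timeLeb.restrict (Set.Iic t))) ∧
  ∃ φ : ℕ → ElemProcess 𝓕 H,
    TendstoInMeasure μ
      (fun n ω => ∫⁻ s in Set.Iic t, ‖(φ n).eval s ω - Φ s ω‖ₑ ^ 2 ∂timeLeb) atTop
      (fun _ => 0) ∧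
    TendstoInMeasure μ (fun n => (φ n).integral W t) atTop J

variable {E V : Type*} [NormedAddCommGroup E] [NormedSpace ℝ E]
  [NormedAddCommGroup V] [NormedSpace ℝ V]

/-- The process `ξ` belongs to `M²(0,T;V)`. -/
def MemM2 (μ : Measure Ω) (𝓕 : Filtration ℝ≥0 mΩ) (T : ℝ≥0) (ξ : ℝ≥0 → Ω → V) : Prop :=
  IsStronglyProgressive 𝓕 ξ ∧
    ∫⁻ ω, ∫⁻ s in Set.Iic T, ‖ξ s ω‖ₑ ^ 2 ∂timeLeb ∂μ < ∞

/-- The process `u` belongs to `M²(X_T)`. -/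
def MemM2X (μ : Measure Ω) (𝓕 : Filtration ℝ≥0 mΩ) (j : E →L[ℝ] V) (T : ℝ≥0)
    (u : ℝ≥0 → Ω → V) : Prop :=
  IsStronglyProgressive 𝓕 u ∧ (∀ᵐ ω ∂μ, MemX j T fun s => u s ω) ∧
    ∫⁻ ω, xNormSq j T (fun s => u s ω) ∂μ < ∞

/-- The maximal regularity estimates for the semigroup `S` on `H`, where `E ⊂ V ⊂ H` through the
embeddings `j : E → V` and `i : V → H`. -/
structure MaximalRegularity (μ : Measure Ω) (𝓕 : Filtration ℝ≥0 mΩ) (W : ℝ≥0 → Ω → ℝ)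
    (j : E →L[ℝ] V) (i : V →L[ℝ] H) (S : ℝ≥0 → H →L[ℝ] H) : Prop where
  /-- `S ∗ f ∈ X_T` and `|S ∗ f|_{X_T} ≤ C₁ |f|_{L²(0,T;H)}`. -/
  det_conv : ∃ C₁ : ℝ, 0 < C₁ ∧ ∀ T : ℝ≥0, 0 < T → ∀ f : ℝ≥0 → H,
    MemLp f 2 (timeLeb.restrict (Set.Iic T)) →
    ∃ v : ℝ≥0 → V, MemX j T v ∧
      (∀ t ≤ T, i (v t) = ∫ r in Set.Iic t, S (t - r) (f r) ∂timeLeb) ∧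
      xNormSq j T v ≤ ENNReal.ofReal (C₁ ^ 2) * ∫⁻ r in Set.Iic T, ‖f r‖ₑ ^ 2 ∂timeLeb
  /-- `S ⋄ ξ ∈ M²(X_T)` and `|S ⋄ ξ|_{M²(X_T)} ≤ C₂ |ξ|_{M²(0,T;V)}`. -/
  stoch_conv : ∃ C₂ : ℝ, 0 < C₂ ∧ ∀ T : ℝ≥0, 0 < T → ∀ ξ : ℝ≥0 → Ω → V,
    MemM2 μ 𝓕 T ξ →
    ∃ v : ℝ≥0 → Ω → V, MemM2X μ 𝓕 j T v ∧
      (∀ t ≤ T, IsItoIntegral μ 𝓕 W t (fun r ω => S (t - r) (i (ξ r ω))) (fun ω => i (v t ω))) ∧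
      ∫⁻ ω, xNormSq j T (fun s => v s ω) ∂μ ≤
        ENNReal.ofReal (C₂ ^ 2) * ∫⁻ ω, ∫⁻ r in Set.Iic T, ‖ξ r ω‖ₑ ^ 2 ∂timeLeb ∂μ
  /-- `S u₀ ∈ X_T` and `|S u₀|_{X_T} ≤ C₀ ‖u₀‖` for `T ≤ T₀`, with `C₀` depending on `T₀`. -/
  orbit : ∀ T₀ : ℝ≥0, 0 < T₀ → ∃ C₀ : ℝ, 0 < C₀ ∧ ∀ T : ℝ≥0, 0 < T → T ≤ T₀ → ∀ x : V,
    ∃ v : ℝ≥0 → V, MemX j T v ∧ (∀ t ≤ T, i (v t) = S t (i x)) ∧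
      xNormSq j T v ≤ ENNReal.ofReal (C₀ ^ 2) * ‖x‖ₑ ^ 2

/-- The finite stopping times `τ_m` satisfy `τ_m < τ` and `τ_m ↑ τ` almost surely. -/
def Announces (μ : Measure Ω) (𝓕 : Filtration ℝ≥0 mΩ) (τm : ℕ → Ω → ℝ≥0) (τ : Ω → ℝ≥0∞) :
    Prop :=
  (∀ m, IsStoppingTime 𝓕 fun ω => ((τm m ω : ℝ≥0) : WithTop ℝ≥0)) ∧
  ∀ᵐ ω ∂μ, Monotone (fun m => τm m ω) ∧ (∀ m, (τm m ω : ℝ≥0∞) < τ ω) ∧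
    Tendsto (fun m => (τm m ω : ℝ≥0∞)) atTop (𝓝 (τ ω))

/-- `τ` is an accessible stopping time: almost surely it is the limit of an increasing sequence of
stopping times `τ_n < τ`. -/
def IsAccessible (μ : Measure Ω) (𝓕 : Filtration ℝ≥0 mΩ) (τ : Ω → ℝ≥0∞) : Prop :=
  IsStoppingTime 𝓕 (ι := ℝ≥0) τ ∧ ∃ σ : ℕ → Ω → ℝ≥0∞,
    (∀ n, IsStoppingTime 𝓕 (ι := ℝ≥0) (σ n)) ∧
    ∀ᵐ ω ∂μ, Monotone (fun n => σ n ω) ∧ (∀ n, σ n ω < τ ω) ∧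
      Tendsto (fun n => σ n ω) atTop (𝓝 (τ ω))

/-- The process `u : [0,τ) × Ω → V` (only the values `u t ω` with `t < τ ω` matter) is admissible:
adapted, with almost surely continuous trajectories on `[0,τ)`. -/
def IsAdmissible (μ : Measure Ω) (𝓕 : Filtration ℝ≥0 mΩ) (u : ℝ≥0 → Ω → V) (τ : Ω → ℝ≥0∞) :
    Prop :=
  (∀ t : ℝ≥0, StronglyMeasurable[𝓕 t] ({ω | (t : ℝ≥0∞) < τ ω}.indicator (u t))) ∧
  ∀ᵐ ω ∂μ, ContinuousOn (fun t => u t ω) {t : ℝ≥0 | (t : ℝ≥0∞) < τ ω}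

/-- Equivalence of the local processes `(u, τ)` and `(v, σ)`. -/
def LocalEquiv (μ : Measure Ω) (u : ℝ≥0 → Ω → V) (τ : Ω → ℝ≥0∞) (v : ℝ≥0 → Ω → V)
    (σ : Ω → ℝ≥0∞) : Prop :=
  τ =ᵐ[μ] σ ∧ ∀ t : ℝ≥0, 0 < t → ∀ᵐ ω ∂μ, (t : ℝ≥0∞) < τ ω → (t : ℝ≥0∞) < σ ω →
    ∀ s ≤ t, u s ω = v s ω

/-- `(u, τ)` is a local mild solution of `du = (A u + F(u)) dt + G(u) dW`, `u(0) = u₀`, where `S` is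
the semigroup generated by `A`.

Since `u` takes values in `V`, the maps `F` and `G`, given on `E`, are evaluated at `u(s)` through
`Function.extend`, which does so where `u(s)` lies in `E` (the moment condition makes this the case
for almost every `s`) and returns `0` elsewhere.

The stochastic term at the random time `t ∧ τ_m` is, as usual, the value at `t ∧ τ_m` of the
continuous process `J(t) = ∫₀ᵗ 1_{[0,τ_m)}(s) S(t-s) G(u(s)) dW(s)`. -/
structure IsLocalMildSolution (μ : Measure Ω) (𝓕 : Filtration ℝ≥0 mΩ) (W : ℝ≥0 → Ω → ℝ)
    (j : E →L[ℝ] V) (i : V →L[ℝ] H) (S : ℝ≥0 → H →L[ℝ] H) (F : E → H) (G : E → V)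
    (u₀ : Ω → V) (u : ℝ≥0 → Ω → V) (τ : Ω → ℝ≥0∞) : Prop where
  accessible : IsAccessible μ 𝓕 τ
  admissible : IsAdmissible μ 𝓕 u τ
  mild : ∃ τm : ℕ → Ω → ℝ≥0, Announces μ 𝓕 τm τ ∧ ∀ m,
    (∀ t : ℝ≥0, ∫⁻ ω, xNormSq j (min t (τm m ω)) (fun s => u s ω) ∂μ < ∞) ∧
    ∃ J : ℝ≥0 → Ω → H, (∀ᵐ ω ∂μ, Continuous fun t => J t ω) ∧
      (∀ t : ℝ≥0, IsItoIntegral μ 𝓕 W t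
        (fun s ω => (Set.Iio (τm m ω)).indicator
          (fun s' => S (t - s') (i (Function.extend j G 0 (u s' ω)))) s) (J t)) ∧
      ∀ t : ℝ≥0, ∀ᵐ ω ∂μ,
        i (u (min t (τm m ω)) ω) = S (min t (τm m ω)) (i (u₀ ω))
          + (∫ s in Set.Iic (min t (τm m ω)),
              S (min t (τm m ω) - s) (Function.extend j F 0 (u s ω)) ∂timeLeb)
          + J (min t (τm m ω)) ω

/-- The local mild solution `(u, τ)` is unique: it agrees with any other local mild solution
`(v, σ)` on `[0, τ ∧ σ)`, up to equivalence. -/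
def IsUniqueLocalMildSolution (μ : Measure Ω) (𝓕 : Filtration ℝ≥0 mΩ) (W : ℝ≥0 → Ω → ℝ)
    (j : E →L[ℝ] V) (i : V →L[ℝ] H) (S : ℝ≥0 → H →L[ℝ] H) (F : E → H) (G : E → V)
    (u₀ : Ω → V) (u : ℝ≥0 → Ω → V) (τ : Ω → ℝ≥0∞) : Prop :=
  IsLocalMildSolution μ 𝓕 W j i S F G u₀ u τ ∧
  ∀ (v : ℝ≥0 → Ω → V) (σ : Ω → ℝ≥0∞), IsLocalMildSolution μ 𝓕 W j i S F G u₀ v σ →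
    LocalEquiv μ u (fun ω => min (τ ω) (σ ω)) v (fun ω => min (τ ω) (σ ω))

end Stochastic

/-! ### Lebesgue measure on the time axis -/

section TimeLeb

/-! The equation is first solved with nonlinearities that are switched off once the norm of the path
in `X_t` exceeds a level `M` or the time exceeds a horizon `Th`. Since `α, β < 1`, Young's
inequality bounds `|F(y) - F(x)|²` on bounded sets of `V` by squared `E`-norms with an arbitrarily
small factor `η`, plus a large constant times `V`-norms; after integration over time this constant
is multiplied by the length of the time interval (`IsPolyLipschitz.lintegral_sub_le`). Over a short
horizon the truncated maps therefore have a small Lipschitz constant from the path space into `L²`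
(`IsPolyLipschitz.lintegral_truncMap_sub_le`). By maximal regularity `u ↦ S u₀ + S * F(u) + S ⋄
G(u)`, with truncated `F` and `G`, is a contraction of `M²(X_1)`, and it has a fixed point
(`UsualConditions.exists_fixedPoint`, `MildSetting.exists_truncSolution`).

Level and horizon depend on `n = ⌊‖u₀(ω)‖⌋`, which is known at time `0`, so unbounded initial values
need no localization. The level `M n` exceeds by one the bound for the orbit `S u₀`. Up to the first
time `T₁` at which the truncation acts, the fixed point is a local mild solution
(`IsTruncSolution.isLocalMildSolution`).

For the life time, write `u = S u₀ + y`. As long as the gauge of `y` is below one and the horizon is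
not reached, the truncation is inactive. The horizons are chosen so that the energy of the truncated
nonlinearities tends to zero with time uniformly in `n`, hence so does `E |y|²_{X_t}`, uniformly in
`u₀`. Markov's inequality for `‖u₀‖` and for `y` gives the bound
(`MildSetting.exists_localMildSolution`).

For uniqueness, two solutions are compared on the random interval where both norms are at most `n +
1`. Cutting off the integrands there, instead of the paths, produces mild convolutions on a fixed
interval to which maximal regularity applies; their difference vanishes by a contraction argument on
successive short intervals (`IsStoppedSolution.ae_eq`). Both existence and uniqueness need that Itô
integrals agree where their integrands do (`IsItoIntegral.ae_eq_of_ae_eq_on`). A Banach space offers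
no isometry for this, so the statement is reduced to scalar integrals by dual functionals. -/

lemma measurableEmbedding_nnrealCoe : MeasurableEmbedding (fun t : ℝ≥0 => (t : ℝ)) :=
  NNReal.isClosedEmbedding_coe.measurableEmbedding

lemma timeLeb_Ioc (a b : ℝ≥0) : timeLeb (Set.Ioc a b) = ((b - a : ℝ≥0) : ℝ≥0∞) := by
  rw [timeLeb, measurableEmbedding_nnrealCoe.comap_apply]
  have : (fun t : ℝ≥0 => (t : ℝ)) '' Set.Ioc a b = Set.Ioc (a : ℝ) b := by
    ext x
    simp only [Set.mem_image, Set.mem_Ioc]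
    constructor
    · rintro ⟨t, ⟨h1, h2⟩, rfl⟩
      exact ⟨by exact_mod_cast h1, by exact_mod_cast h2⟩
    · rintro ⟨h1, h2⟩
      refine ⟨⟨x, a.2.trans h1.le⟩, ⟨?_, ?_⟩, rfl⟩
      · exact_mod_cast h1
      · exact_mod_cast h2
  rw [this, Real.volume_Ioc, ENNReal.ofReal, ← NNReal.sub_def]

lemma timeLeb_Iic (b : ℝ≥0) : timeLeb (Set.Iic b) = (b : ℝ≥0∞) := by
  rw [timeLeb, measurableEmbedding_nnrealCoe.comap_apply]
  have : (fun t : ℝ≥0 => (t : ℝ)) '' Set.Iic b = Set.Icc (0 : ℝ) b := by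
    ext x
    simp only [Set.mem_image, Set.mem_Iic, Set.mem_Icc]
    constructor
    · rintro ⟨t, h2, rfl⟩
      exact ⟨t.2, by exact_mod_cast h2⟩
    · rintro ⟨h1, h2⟩
      exact ⟨⟨x, h1⟩, by exact_mod_cast h2, rfl⟩
  rw [this, Real.volume_Icc]
  simp

instance : NullSingletonClass timeLeb where
  measure_singleton x := by
    rw [timeLeb, measurableEmbedding_nnrealCoe.comap_apply]
    simp

instance : IsLocallyFiniteMeasure timeLeb where
  finiteAtNhds x := ⟨Set.Iic (x + 1), Iic_mem_nhds (by simp), by simp [timeLeb_Iic]⟩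

instance (t : ℝ≥0) : IsFiniteMeasure (timeLeb.restrict (Set.Iic t)) :=
  ⟨by simp [timeLeb_Iic]⟩

end TimeLeb

/-! ### Elementary processes -/

section Elementary

/-- A finite set of points is covered by a monotone sequence. -/
lemma exists_monotone_enumeration {α : Type*} [LinearOrder α] [Inhabited α] (P : Finset α) :
    ∃ (n : ℕ) (p : ℕ → α), Monotone p ∧ ∀ x ∈ P, ∃ k ≤ n, p k = x := by
  suffices h : P.Nonempty → ∃ (n : ℕ) (p : ℕ → α), Monotone p ∧ (∀ k, p k ∈ P) ∧
      ∀ x ∈ P, ∃ k ≤ n, p k = x by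
    rcases P.eq_empty_or_nonempty with rfl | hP
    · exact ⟨0, fun _ => default, monotone_const, by simp⟩
    · obtain ⟨n, p, h1, -, h2⟩ := h hP
      exact ⟨n, p, h1, h2⟩
  induction P using Finset.induction_on_max with
  | empty => simp
  | insert a s ha ih =>
    intro _
    rcases s.eq_empty_or_nonempty with rfl | hs
    · exact ⟨0, fun _ => a, monotone_const, by simp, by simp⟩
    · obtain ⟨n, p, h1, h2, h3⟩ := ih hs
      refine ⟨n + 1, fun k => if k ≤ n then p k else a, ?_, ?_, ?_⟩
      · intro k l hkl
        by_cases hl : l ≤ n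
        · simp [hl, hkl.trans hl, h1 hkl]
        · by_cases hk : k ≤ n
          · simp [hl, hk, (ha _ (h2 k)).le]
          · simp [hl, hk]
      · intro k
        by_cases hk : k ≤ n <;> simp [hk, h2 k]
      · intro x hx
        rcases Finset.mem_insert.1 hx with rfl | hx
        · exact ⟨n + 1, le_rfl, by simp⟩
        · obtain ⟨k, hk, rfl⟩ := h3 x hx
          exact ⟨k, hk.trans n.le_succ, by simp [hk]⟩

/-- Clamping the partition points to the interval from `p a` to `p b` turns the selected increments
into all increments of one function, and the sum telescopes. Repeated points do no harm. -/
lemma sum_indicator_increment {M : Type*} [AddCommGroup M] {p : ℕ → ℝ≥0} (hp : Monotone p)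
    {n a b : ℕ} (hab : a ≤ b) (hb : b ≤ n) (g : ℝ≥0 → M) :
    ∑ i ∈ Finset.range n, (if p (i + 1) ∈ Set.Ioc (p a) (p b) then g (p (i + 1)) - g (p i) else 0)
      = g (p b) - g (p a) := by
  have key : ∀ i, (if p (i + 1) ∈ Set.Ioc (p a) (p b) then g (p (i + 1)) - g (p i) else 0) =
      g (max (p a) (min (p b) (p (i + 1)))) - g (max (p a) (min (p b) (p i))) := by
    intro i
    have hi := hp i.le_succ
    have hpab := hp hab
    by_cases h1 : p a < p (i + 1)
    · have hai : p a ≤ p i := by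
        refine hp ?_
        by_contra hlt
        exact absurd (hp (show i + 1 ≤ a by omega)) (not_le.2 h1)
      by_cases h2 : p (i + 1) ≤ p b
      · have : p i ≤ p b := hi.trans h2
        simp [h1, h2, this, hai, h1.le]
      · have hbi : p b ≤ p i := by
          refine hp ?_
          by_contra hlt
          exact h2 (hp (show i + 1 ≤ b by omega))
        simp [h2, hbi, (not_le.1 h2).le]
    · have h1' := not_lt.1 h1
      have h3 := hi.trans h1'
      simp [h1, h1', h3]
  simp_rw [key]
  rw [Finset.sum_range_sub (fun i => g (max (p a) (min (p b) (p i))))]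
  have h1 : p b ≤ p n := hp hb
  have h2 : p 0 ≤ p a := hp a.zero_le
  have h3 := hp hab
  simp [h1, h2, h3]

variable {Ω : Type*} {mΩ : MeasurableSpace Ω} {𝓕 : Filtration ℝ≥0 mΩ}
  {H : Type*} [NormedAddCommGroup H]

namespace ElemProcess

lemma eval_bdd (φ : ElemProcess 𝓕 H) : ∃ C : ℝ, ∀ s ω, ‖φ.eval s ω‖ ≤ C := by
  obtain ⟨C, hC⟩ := φ.coeff_bdd
  refine ⟨φ.N * C, fun s ω => ?_⟩
  refine (norm_sum_le _ _).trans ?_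
  calc _ ≤ ∑ k ∈ Finset.range φ.N, C := by
        refine Finset.sum_le_sum fun k _ => ?_
        by_cases h : s ∈ Set.Ioc (φ.time k) (φ.time (k + 1))
        · simpa [h] using hC k ω
        · simpa [h] using (norm_nonneg _).trans (hC k ω)
    _ = _ := by simp

/-- `φ` is determined by its values at the points of a finer partition. -/
lemma mem_Ioc_iff_of_refines {p : ℕ → ℝ≥0} (hp : Monotone p) {i : ℕ} {x y s : ℝ≥0}
    (hx : ∃ k, p k = x) (hy : ∃ k, p k = y) (hs : s ∈ Set.Ioc (p i) (p (i + 1))) :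
    s ∈ Set.Ioc x y ↔ p (i + 1) ∈ Set.Ioc x y := by
  obtain ⟨a, rfl⟩ := hx
  obtain ⟨b, rfl⟩ := hy
  have h : ∀ c, p c < p (i + 1) → p c ≤ p i := fun c hc => by
    refine hp ?_
    by_contra hlt
    exact absurd (hp (show i + 1 ≤ c by omega)) (not_le.2 hc)
  constructor
  · rintro ⟨h1, h2⟩
    refine ⟨h1.trans_le hs.2, ?_⟩
    by_contra h3
    exact absurd (h2.trans (h b (not_le.1 h3))) (not_le.2 hs.1)
  · rintro ⟨h1, h2⟩
    exact ⟨(h a h1).trans_lt hs.1, hs.2.trans h2⟩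

lemma eval_eq_of_refines (φ : ElemProcess 𝓕 H) {p : ℕ → ℝ≥0} (hp : Monotone p)
    (hφ : ∀ k, k ≤ φ.N → ∃ l, p l = φ.time k) {i : ℕ} {s : ℝ≥0}
    (hs : s ∈ Set.Ioc (p i) (p (i + 1))) (ω : Ω) : φ.eval s ω = φ.eval (p (i + 1)) ω := by
  refine Finset.sum_congr rfl fun k hk => ?_
  have hk := Finset.mem_range.1 hk
  have := mem_Ioc_iff_of_refines hp (hφ k hk.le) (hφ (k + 1) hk) hs
  by_cases h : s ∈ Set.Ioc (φ.time k) (φ.time (k + 1))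
  · rw [Set.indicator_of_mem h, Set.indicator_of_mem (this.1 h)]
  · rw [Set.indicator_of_notMem h, Set.indicator_of_notMem (mt this.2 h)]

lemma measurable_eval_of_refines (φ : ElemProcess 𝓕 H) {p : ℕ → ℝ≥0} (hp : Monotone p)
    (hφ : ∀ k, k ≤ φ.N → ∃ l, p l = φ.time k) (i : ℕ) :
    StronglyMeasurable[𝓕 (p i)] (φ.eval (p (i + 1))) := by
  have : φ.eval (p (i + 1)) = fun ω => ∑ k ∈ Finset.range φ.N,
    (Set.Ioc (φ.time k) (φ.time (k + 1))).indicator (fun _ => φ.coeff k ω) (p (i + 1)) := rfl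
  rw [this]
  refine Finset.stronglyMeasurable_fun_sum _ fun k hk => ?_
  have hk := Finset.mem_range.1 hk
  by_cases h : p (i + 1) ∈ Set.Ioc (φ.time k) (φ.time (k + 1))
  · simp only [Set.indicator_of_mem h]
    refine (φ.coeff_meas k).mono (𝓕.mono ?_)
    obtain ⟨a, ha⟩ := hφ k hk.le
    rw [← ha] at h ⊢
    refine hp ?_
    by_contra hlt
    exact absurd (hp (show i + 1 ≤ a by omega)) (not_le.2 h.1)
  · simp only [Set.indicator_of_notMem h]
    exact stronglyMeasurable_const

variable [NormedSpace ℝ H]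

lemma integral_eq_of_refines (φ : ElemProcess 𝓕 H) {p : ℕ → ℝ≥0} (hp : Monotone p) {n : ℕ}
    (hφ : ∀ k, k ≤ φ.N → ∃ l ≤ n, p l = φ.time k) (W : ℝ≥0 → Ω → ℝ) (t : ℝ≥0) (ω : Ω) :
    φ.integral W t ω = ∑ i ∈ Finset.range n,
      (W (min (p (i + 1)) t) ω - W (min (p i) t) ω) • φ.eval (p (i + 1)) ω := by
  simp only [eval, Finset.smul_sum]
  rw [Finset.sum_comm]
  refine Finset.sum_congr rfl fun k hk => ?_
  have hk := Finset.mem_range.1 hk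
  obtain ⟨a, ha, ha'⟩ := hφ k hk.le
  obtain ⟨b, hb, hb'⟩ := hφ (k + 1) hk
  -- As `p` is only monotone, indices of equal points may come in the wrong order. Then the two
  -- times coincide and one index serves for both.
  wlog hab : a ≤ b generalizing a b
  · have h1 : p b ≤ p a := hp (not_le.1 hab).le
    have h2 : p a ≤ p b := by rw [ha', hb']; exact φ.time_mono k.le_succ
    exact this a ha ha' a ha ((le_antisymm h2 h1).trans hb') le_rfl
  have := sum_indicator_increment hp hab hb
    (fun s => (W (min s t) ω : ℝ))
  rw [← ha', ← hb', ← this, Finset.sum_smul]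
  refine Finset.sum_congr rfl fun i _ => ?_
  by_cases h : p (i + 1) ∈ Set.Ioc (p a) (p b)
  · rw [if_pos h, Set.indicator_of_mem h]
  · rw [if_neg h, Set.indicator_of_notMem h, zero_smul, smul_zero]

/-- Both processes are rewritten on a common refinement of their partitions. On each of its
intervals they are constant in time, with the value at the right end point, and this value is
measurable at the left end point. -/
lemma exists_sub (φ ψ : ElemProcess 𝓕 H) (W : ℝ≥0 → Ω → ℝ) :
    ∃ χ : ElemProcess 𝓕 H, (∀ s ω, χ.eval s ω = φ.eval s ω - ψ.eval s ω) ∧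
      ∀ t ω, χ.integral W t ω = φ.integral W t ω - ψ.integral W t ω := by
  obtain ⟨n, p, hp, hP⟩ := exists_monotone_enumeration
    ((Finset.range (φ.N + 1)).image φ.time ∪ (Finset.range (ψ.N + 1)).image ψ.time)
  have hφ : ∀ k, k ≤ φ.N → ∃ l ≤ n, p l = φ.time k := fun k hk => hP _ <|
    Finset.mem_union_left _ <| Finset.mem_image_of_mem _ <| Finset.mem_range.2 (by omega)
  have hψ : ∀ k, k ≤ ψ.N → ∃ l ≤ n, p l = ψ.time k := fun k hk => hP _ <|
    Finset.mem_union_right _ <| Finset.mem_image_of_mem _ <| Finset.mem_range.2 (by omega)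
  have hφ' : ∀ k, k ≤ φ.N → ∃ l, p l = φ.time k := fun k hk => (hφ k hk).imp fun _ h => h.2
  have hψ' : ∀ k, k ≤ ψ.N → ∃ l, p l = ψ.time k := fun k hk => (hψ k hk).imp fun _ h => h.2
  obtain ⟨C, hC⟩ := φ.eval_bdd
  obtain ⟨D, hD⟩ := ψ.eval_bdd
  let χ : ElemProcess 𝓕 H :=
    { N := n
      time := p
      time_mono := hp
      coeff := fun i ω => φ.eval (p (i + 1)) ω - ψ.eval (p (i + 1)) ω
      coeff_meas := fun i =>
        (φ.measurable_eval_of_refines hp hφ' i).sub (ψ.measurable_eval_of_refines hp hψ' i)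
      coeff_bdd := ⟨C + D, fun k ω => (norm_sub_le _ _).trans (add_le_add (hC _ _) (hD _ _))⟩ }
  refine ⟨χ, fun s ω => ?_, fun t ω => ?_⟩
  · change ∑ i ∈ Finset.range n, (Set.Ioc (p i) (p (i + 1))).indicator
      (fun _ => φ.eval (p (i + 1)) ω - ψ.eval (p (i + 1)) ω) s = _
    have h1 : ∀ i, (Set.Ioc (p i) (p (i + 1))).indicator
        (fun _ => φ.eval (p (i + 1)) ω - ψ.eval (p (i + 1)) ω) s =
        if s ∈ Set.Ioc (p i) (p (i + 1)) then φ.eval s ω - ψ.eval s ω else 0 := by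
      intro i
      by_cases h : s ∈ Set.Ioc (p i) (p (i + 1))
      · rw [Set.indicator_of_mem h, if_pos h, φ.eval_eq_of_refines hp hφ' h,
          ψ.eval_eq_of_refines hp hψ' h]
      · rw [Set.indicator_of_notMem h, if_neg h]
    simp_rw [h1]
    by_cases hs : s ∈ Set.Ioc (p 0) (p n)
    · have : ∃ i < n, s ∈ Set.Ioc (p i) (p (i + 1)) := by
        clear_value χ
        clear hP hφ hψ h1
        induction n with
        | zero => simp at hs
        | succ n ih =>
          by_cases hn : s ≤ p n
          · obtain ⟨i, hi, h⟩ := ih ⟨hs.1, hn⟩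
            exact ⟨i, by omega, h⟩
          · exact ⟨n, by omega, not_le.1 hn, hs.2⟩
      obtain ⟨i, hi, his⟩ := this
      rw [Finset.sum_eq_single i, if_pos his]
      · intro k _ hki
        rw [if_neg]
        rintro ⟨h2, h3⟩
        rcases lt_or_gt_of_ne hki with h | h
        · exact absurd (h3.trans (hp (show k + 1 ≤ i by omega))) (not_le.2 his.1)
        · exact absurd (his.2.trans (hp (show i + 1 ≤ k by omega))) (not_le.2 h2)
      · intro h
        exact absurd (Finset.mem_range.2 hi) h
    · have hz : ∀ θ : ElemProcess 𝓕 H, (∀ k, k ≤ θ.N → ∃ l ≤ n, p l = θ.time k) →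
          θ.eval s ω = 0 := by
        intro θ hθ
        refine Finset.sum_eq_zero fun k hk => ?_
        have hk := Finset.mem_range.1 hk
        obtain ⟨a, ha, ha'⟩ := hθ k hk.le
        obtain ⟨b, hb, hb'⟩ := hθ (k + 1) hk
        rw [Set.indicator_of_notMem]
        rintro ⟨h2, h3⟩
        refine hs ⟨?_, ?_⟩
        · exact (hp a.zero_le).trans_lt (ha' ▸ h2)
        · exact (hb' ▸ h3).trans (hp hb)
      rw [hz φ hφ, hz ψ hψ, sub_zero]
      simp
  · rw [φ.integral_eq_of_refines hp hφ, ψ.integral_eq_of_refines hp hψ, ← Finset.sum_sub_distrib]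
    refine Finset.sum_congr rfl fun i _ => ?_
    rw [smul_sub]

/-- The image of an elementary process under a bounded operator. -/
def mapCLM {K : Type*} [NormedAddCommGroup K] [NormedSpace ℝ K] (L : H →L[ℝ] K)
    (φ : ElemProcess 𝓕 H) : ElemProcess 𝓕 K where
  N := φ.N
  time := φ.time
  time_mono := φ.time_mono
  coeff := fun k ω => L (φ.coeff k ω)
  coeff_meas := fun k => L.continuous.comp_stronglyMeasurable (φ.coeff_meas k)
  coeff_bdd := by
    obtain ⟨C, hC⟩ := φ.coeff_bdd
    exact ⟨‖L‖ * C, fun k ω => (L.le_opNorm _).trans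
      (mul_le_mul_of_nonneg_left (hC k ω) (norm_nonneg _))⟩

section mapCLM

variable {K : Type*} [NormedAddCommGroup K] [NormedSpace ℝ K] (L : H →L[ℝ] K)
  (φ : ElemProcess 𝓕 H)

lemma mapCLM_eval (s : ℝ≥0) (ω : Ω) : (φ.mapCLM L).eval s ω = L (φ.eval s ω) := by
  simp only [eval, map_sum]
  refine Finset.sum_congr rfl fun k _ => ?_
  by_cases h : s ∈ Set.Ioc (φ.time k) (φ.time (k + 1))
  · rw [Set.indicator_of_mem h]; exact Set.indicator_of_mem h _
  · rw [Set.indicator_of_notMem h, map_zero]; exact Set.indicator_of_notMem h _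

lemma mapCLM_integral (W : ℝ≥0 → Ω → ℝ) (t : ℝ≥0) (ω : Ω) :
    (φ.mapCLM L).integral W t ω = L (φ.integral W t ω) := by
  simp only [integral, map_sum, map_smul]
  rfl

end mapCLM

/-- The elementary process `1_{(0, t₀]} φ`. -/
lemma exists_restrict (φ : ElemProcess 𝓕 H) (W : ℝ≥0 → Ω → ℝ) (t₀ : ℝ≥0) :
    ∃ χ : ElemProcess 𝓕 H, (∀ s ω, χ.eval s ω = if s ≤ t₀ then φ.eval s ω else 0) ∧
      ∀ t ω, t₀ ≤ t → χ.integral W t ω = φ.integral W t₀ ω := by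
  classical
  obtain ⟨C, hC⟩ := φ.coeff_bdd
  let χ : ElemProcess 𝓕 H :=
    { N := φ.N
      time := fun k => min (φ.time k) t₀
      time_mono := φ.time_mono.min monotone_const
      -- Clipping moves times after `t₀` back to `t₀`, where the original coefficient need not be
      -- measurable. It is replaced by zero; the corresponding interval is empty anyway.
      coeff := fun k => if φ.time k ≤ t₀ then φ.coeff k else 0
      coeff_meas := fun k => by
        by_cases h : φ.time k ≤ t₀
        · rw [if_pos h, min_eq_left h]
          exact φ.coeff_meas k
        · rw [if_neg h]
          exact stronglyMeasurable_zero
      coeff_bdd := ⟨C, fun k ω => by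
        by_cases h : φ.time k ≤ t₀
        · simpa [h] using hC k ω
        · simpa [h] using (norm_nonneg _).trans (hC k ω)⟩ }
  refine ⟨χ, fun s ω => ?_, fun t ω ht => ?_⟩
  · simp only [eval, χ]
    by_cases hs : s ≤ t₀
    · rw [if_pos hs]
      refine Finset.sum_congr rfl fun k _ => ?_
      by_cases h : φ.time k < s
      · simp [Set.indicator, h, hs, (h.trans_le hs).le]
      · simp [Set.indicator, h, hs]
    · rw [if_neg hs]
      refine Finset.sum_eq_zero fun k _ => ?_
      simp [hs]
  · simp only [integral, χ]
    refine Finset.sum_congr rfl fun k _ => ?_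
    by_cases h : φ.time k ≤ t₀
    · simp [h, h.trans ht, ht]
    · have h1 := (not_le.1 h).le
      have h2 := h1.trans (φ.time_mono k.le_succ)
      simp [h, h1, h2, ht]

end ElemProcess

end Elementary

/-! ### Brownian increments and the scalar Itô isometry -/

section ScalarIto

variable {Ω : Type*} {mΩ : MeasurableSpace Ω} {𝓕 : Filtration ℝ≥0 mΩ} {μ : Measure Ω}
  {W : ℝ≥0 → Ω → ℝ}

lemma IsWiener.memLp_increment (hW : IsWiener μ 𝓕 W) (s t : ℝ≥0) :
    MemLp (fun ω => W t ω - W s ω) 2 μ := by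
  have h := hW.brownian.toIsPreBrownianReal.hasLaw_sub t s
  have h2 : MemLp id 2 (gaussianReal 0 (nndist t.1 s.1)) := by
    exact_mod_cast memLp_id_gaussianReal (μ := 0) (v := nndist t.1 s.1) 2
  rw [← h.map_eq] at h2
  exact (memLp_map_measure_iff h2.1 h.aemeasurable).1 h2

lemma IsWiener.integral_increment (hW : IsWiener μ 𝓕 W) (s t : ℝ≥0) :
    ∫ ω, (W t ω - W s ω) ∂μ = 0 := by
  have h := hW.brownian.toIsPreBrownianReal.hasLaw_sub t s
  have := h.integral_eq
  simpa using this

lemma IsWiener.integral_increment_sq [IsProbabilityMeasure μ] (hW : IsWiener μ 𝓕 W)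
    {s t : ℝ≥0} (hst : s ≤ t) :
    ∫ ω, (W t ω - W s ω) ^ 2 ∂μ = t - s := by
  have h := hW.brownian.toIsPreBrownianReal.hasLaw_sub t s
  have h1 := h.variance_eq
  rw [variance_of_integral_eq_zero h.aemeasurable (hW.integral_increment s t)] at h1
  simp only [Pi.sub_apply] at h1
  rw [h1]
  have hst' : (s : ℝ) ≤ t := by exact_mod_cast hst
  rw [variance_id_gaussianReal, coe_nndist, Real.dist_eq]
  exact abs_of_nonneg (sub_nonneg.2 hst')

lemma IsWiener.measurable_increment (hW : IsWiener μ 𝓕 W) {s t r : ℝ≥0} (hs : s ≤ r) (ht : t ≤ r) :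
    StronglyMeasurable[𝓕 r] (fun ω => W t ω - W s ω) :=
  ((hW.adapted t).mono (𝓕.mono ht)).sub ((hW.adapted s).mono (𝓕.mono hs))

lemma IsWiener.indep_fun (hW : IsWiener μ 𝓕 W) {s t : ℝ≥0} (hst : s ≤ t) {X : Ω → ℝ}
    (hX : StronglyMeasurable[𝓕 s] X) : IndepFun X (fun ω => W t ω - W s ω) μ := by
  rw [IndepFun_iff_Indep]
  exact (indep_of_indep_of_le_right (hW.indep s t hst) hX.measurable.comap_le).symm

variable [IsProbabilityMeasure μ]

/-- One step of the Itô isometry. -/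
lemma IsWiener.isometry_step (hW : IsWiener μ 𝓕 W) {s t : ℝ≥0} (hst : s ≤ t) {X c : Ω → ℝ}
    (hX : StronglyMeasurable[𝓕 s] X) (hX2 : MemLp X 2 μ) (hc : StronglyMeasurable[𝓕 s] c)
    {C : ℝ} (hC : ∀ ω, ‖c ω‖ ≤ C) :
    MemLp (fun ω => X ω + (W t ω - W s ω) * c ω) 2 μ ∧
    ∫ ω, (X ω + (W t ω - W s ω) * c ω) ^ 2 ∂μ
      = ∫ ω, X ω ^ 2 ∂μ + ∫ ω, c ω ^ 2 * (t - s) ∂μ := by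
  have hW2 := hW.memLp_increment s t
  have hcm : StronglyMeasurable c := hc.mono (𝓕.le s)
  have hXm : StronglyMeasurable X := hX.mono (𝓕.le s)
  have hcb : MemLp c ∞ μ := memLp_top_of_bound hcm.aestronglyMeasurable C (ae_of_all _ hC)
  have hcW : MemLp (fun ω => (W t ω - W s ω) * c ω) 2 μ := hcb.mul hW2
  have hXc : MemLp (fun ω => X ω * c ω) 2 μ := hcb.mul hX2
  refine ⟨hX2.add hcW, ?_⟩
  have e1 : ∀ ω, (X ω + (W t ω - W s ω) * c ω) ^ 2 =
      X ω ^ 2 + (2 * ((X ω * c ω) * (W t ω - W s ω)) + c ω ^ 2 * (W t ω - W s ω) ^ 2) :=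
    fun ω => by ring
  simp_rw [e1]
  have i1 : Integrable (fun ω => X ω ^ 2) μ := hX2.integrable_sq
  have i2 : Integrable (fun ω => 2 * ((X ω * c ω) * (W t ω - W s ω))) μ :=
    (hXc.integrable_mul hW2).const_mul 2
  have i3 : Integrable (fun ω => c ω ^ 2 * (W t ω - W s ω) ^ 2) μ := by
    refine hcW.integrable_sq.congr (ae_of_all _ fun ω => ?_)
    simp only; ring
  have h1 : Integrable (fun ω => 2 * ((X ω * c ω) * (W t ω - W s ω))
      + c ω ^ 2 * (W t ω - W s ω) ^ 2) μ := i2.add i3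
  rw [integral_add i1 h1, integral_add i2 i3, integral_const_mul]
  -- The cross term vanishes: `X * c` is `𝓕 s`-measurable, hence independent of the centred
  -- increment.
  have z1 := (hW.indep_fun hst (hX.mul hc)).integral_mul_eq_mul_integral
    (hXm.mul hcm).aestronglyMeasurable hW2.1
  rw [hW.integral_increment, mul_zero] at z1
  have hsq : IndepFun (fun ω => c ω ^ 2) (fun ω => (W t ω - W s ω) ^ 2) μ :=
    (hW.indep_fun hst hc).comp (φ := fun x : ℝ => x ^ 2) (ψ := fun x : ℝ => x ^ 2)
      (by fun_prop) (by fun_prop)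
  have z2 := hsq.integral_mul_eq_mul_integral (hcm.pow 2).aestronglyMeasurable (hW2.1.pow 2)
  rw [hW.integral_increment_sq hst, ← integral_mul_const] at z2
  have z1' : ∫ ω, X ω * c ω * (W t ω - W s ω) ∂μ = 0 := z1
  have z2' : ∫ ω, c ω ^ 2 * (W t ω - W s ω) ^ 2 ∂μ = ∫ ω, c ω ^ 2 * (t - s) ∂μ := z2
  rw [z1', z2']
  ring

/-- The Itô isometry along a monotone partition. -/
lemma IsWiener.isometry (hW : IsWiener μ 𝓕 W) {p : ℕ → ℝ≥0} (hp : Monotone p) (t : ℝ≥0)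
    {c : ℕ → Ω → ℝ} (hc : ∀ k, StronglyMeasurable[𝓕 (p k)] (c k)) {C : ℝ}
    (hC : ∀ k ω, ‖c k ω‖ ≤ C) (n : ℕ) :
    MemLp (fun ω => ∑ k ∈ Finset.range n,
      (W (min (p (k + 1)) t) ω - W (min (p k) t) ω) * c k ω) 2 μ ∧
    ∫ ω, (∑ k ∈ Finset.range n,
      (W (min (p (k + 1)) t) ω - W (min (p k) t) ω) * c k ω) ^ 2 ∂μ
      = ∫ ω, ∑ k ∈ Finset.range n, c k ω ^ 2 * ((min (p (k + 1)) t : ℝ≥0) - (min (p k) t : ℝ≥0))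
        ∂μ := by
  have hcm : ∀ k, StronglyMeasurable (c k) := fun k => (hc k).mono (𝓕.le _)
  have hcb : ∀ k, MemLp (c k) 2 μ := fun k =>
    (memLp_top_of_bound (hcm k).aestronglyMeasurable C (ae_of_all _ (hC k))).mono_exponent le_top
  induction n with
  | zero => simp
  | succ n ih =>
    simp only [Finset.sum_range_succ]
    rw [integral_add (integrable_finsetSum _ fun k _ => (hcb k).integrable_sq.mul_const _)
      ((hcb n).integrable_sq.mul_const _)]
    -- After time `t` the increment is zero. The case has to be separated because `c n` is then not
    -- known at time `min (p n) t`.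
    by_cases h : p n ≤ t
    · have hX : StronglyMeasurable[𝓕 (min (p n) t)] (fun ω => ∑ k ∈ Finset.range n,
          (W (min (p (k + 1)) t) ω - W (min (p k) t) ω) * c k ω) := by
        rw [min_eq_left h]
        refine Finset.stronglyMeasurable_fun_sum _ fun k hk => ?_
        have hk := Finset.mem_range.1 hk
        refine (hW.measurable_increment ?_ ?_).mul ((hc k).mono (𝓕.mono (hp hk.le)))
        · exact (min_le_left _ _).trans (hp hk.le)
        · exact (min_le_left _ _).trans (hp hk)
      have := hW.isometry_step (min_le_min_right t (hp n.le_succ)) hX ih.1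
        (c := c n) (by rw [min_eq_left h]; exact hc n) (hC n)
      refine ⟨this.1, ?_⟩
      rw [this.2, ih.2]
    · have h1 := (not_le.1 h).le
      have h2 := h1.trans (hp n.le_succ)
      simp only [min_eq_right h1, min_eq_right h2, sub_self, zero_mul, add_zero, mul_zero,
        integral_zero]
      exact ih

/-- This bounds the energy of an integrand that is switched off just before its energy exceeds `b`.
The second entry of the minimum is what makes the induction close. -/
lemma sum_truncated_le {d : ℕ → ℝ} (hd : ∀ k, 0 ≤ d k) {b : ℝ} (hb : 0 ≤ b) (n : ℕ) :
    ∑ k ∈ Finset.range n, (if ∑ l ∈ Finset.range (k + 1), d l ≤ b then d k else 0) ≤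
      min b (∑ k ∈ Finset.range n, d k) := by
  induction n with
  | zero => simp [hb]
  | succ n ih =>
    rw [Finset.sum_range_succ]
    have h2 := ih.trans (min_le_right _ _)
    have h1 := ih.trans (min_le_left _ _)
    split_ifs with h
    · have e := Finset.sum_range_succ d n
      refine le_min (le_trans ?_ h) ?_ <;> rw [e] <;> linarith
    · rw [Finset.sum_range_succ d n]
      refine le_min ?_ ?_ <;> linarith [hd n]

/-- The intervals of the partition are disjoint, so the square of the sum is the sum of the squares.
-/
lemma ElemProcess.lintegral_eval_sq (φ : ElemProcess 𝓕 ℝ) (t : ℝ≥0) (ω : Ω) :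
    ∫⁻ s in Set.Iic t, ‖φ.eval s ω‖ₑ ^ 2 ∂timeLeb =
      ENNReal.ofReal (∑ k ∈ Finset.range φ.N, φ.coeff k ω ^ 2 *
        ((min (φ.time (k + 1)) t : ℝ≥0) - (min (φ.time k) t : ℝ≥0))) := by
  have h1 : ∀ s, ‖φ.eval s ω‖ₑ ^ 2 = ∑ k ∈ Finset.range φ.N,
      (Set.Ioc (φ.time k) (φ.time (k + 1))).indicator (fun _ => ‖φ.coeff k ω‖ₑ ^ 2) s := by
    intro s
    by_cases hs : ∃ k < φ.N, s ∈ Set.Ioc (φ.time k) (φ.time (k + 1))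
    · obtain ⟨k, hk, h⟩ := hs
      have hne : ∀ l, l ≠ k → s ∉ Set.Ioc (φ.time l) (φ.time (l + 1)) := by
        rintro l hlk ⟨h2, h3⟩
        rcases lt_or_gt_of_ne hlk with h' | h'
        · exact absurd (h3.trans (φ.time_mono (show l + 1 ≤ k by omega))) (not_le.2 h.1)
        · exact absurd (h.2.trans (φ.time_mono (show k + 1 ≤ l by omega))) (not_le.2 h2)
      rw [ElemProcess.eval, Finset.sum_eq_single k, Finset.sum_eq_single k,
        Set.indicator_of_mem h, Set.indicator_of_mem h]
      · intro l _ hl; exact Set.indicator_of_notMem (hne l hl) _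
      · intro h'; exact absurd (Finset.mem_range.2 hk) h'
      · intro l _ hl; exact Set.indicator_of_notMem (hne l hl) _
      · intro h'; exact absurd (Finset.mem_range.2 hk) h'
    · push Not at hs
      rw [ElemProcess.eval, Finset.sum_eq_zero, Finset.sum_eq_zero]
      · simp
      · intro l hl; exact Set.indicator_of_notMem (hs l (Finset.mem_range.1 hl)) _
      · intro l hl; exact Set.indicator_of_notMem (hs l (Finset.mem_range.1 hl)) _
  simp_rw [h1]
  have hd : ∀ k, (0 : ℝ) ≤ (min (φ.time (k + 1)) t : ℝ≥0) - (min (φ.time k) t : ℝ≥0) := fun k =>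
    sub_nonneg.2 (by exact_mod_cast min_le_min_right t (φ.time_mono k.le_succ))
  rw [lintegral_finsetSum _ fun k _ => measurable_const.indicator measurableSet_Ioc,
    ENNReal.ofReal_sum_of_nonneg fun k _ => mul_nonneg (sq_nonneg _) (hd k)]
  refine Finset.sum_congr rfl fun k _ => ?_
  rw [lintegral_indicator measurableSet_Ioc, setLIntegral_const,
    Measure.restrict_apply measurableSet_Ioc]
  have : Set.Ioc (φ.time k) (φ.time (k + 1)) ∩ Set.Iic t =
      Set.Ioc (min (φ.time k) t) (min (φ.time (k + 1)) t) := by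
    ext s
    simp only [Set.mem_inter_iff, Set.mem_Ioc, Set.mem_Iic, min_lt_iff, le_min_iff]
    constructor
    · rintro ⟨⟨h1, h2⟩, h3⟩; exact ⟨Or.inl h1, h2, h3⟩
    · rintro ⟨h1 | h1, h2, h3⟩
      · exact ⟨⟨h1, h2⟩, h3⟩
      · exact absurd h3 (not_le.2 h1)
  rw [this, timeLeb_Ioc, ENNReal.ofReal_mul (sq_nonneg _), ← ENNReal.ofReal_coe_nnreal,
    NNReal.coe_sub (min_le_min_right t (φ.time_mono k.le_succ)), ← sq_abs,
    ENNReal.ofReal_pow (abs_nonneg _), ← Real.norm_eq_abs, ofReal_norm]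

/-- Control in probability of the Itô integral of an elementary process by its energy. -/
lemma ElemProcess.measure_integral_le (hW : IsWiener μ 𝓕 W) (φ : ElemProcess 𝓕 ℝ) (t : ℝ≥0)
    {a b : ℝ} (ha : 0 < a) (hb : 0 ≤ b) :
    μ {ω | a ≤ ‖φ.integral W t ω‖ ∧
      ∫⁻ s in Set.Iic t, ‖φ.eval s ω‖ₑ ^ 2 ∂timeLeb ≤ ENNReal.ofReal b}
      ≤ ENNReal.ofReal (b / a ^ 2) := by
  set δ : ℕ → ℝ := fun k => (min (φ.time (k + 1)) t : ℝ≥0) - (min (φ.time k) t : ℝ≥0) with hδ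
  have hd : ∀ k, 0 ≤ δ k := fun k =>
    sub_nonneg.2 (by exact_mod_cast min_le_min_right t (φ.time_mono k.le_succ))
  set S : ℕ → Ω → ℝ := fun n ω => ∑ k ∈ Finset.range n, φ.coeff k ω ^ 2 * δ k with hS
  have hSm : ∀ k, StronglyMeasurable[𝓕 (φ.time k)] (S (k + 1)) := fun k =>
    Finset.stronglyMeasurable_fun_sum _ fun l hl =>
      (((φ.coeff_meas l).mono (𝓕.mono (φ.time_mono
        (Nat.lt_succ_iff.1 (Finset.mem_range.1 hl))))).pow 2).mul_const _
  obtain ⟨C, hC⟩ := φ.coeff_bdd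
  -- The coefficient is kept only while the energy, including the current interval, is at most `b`.
  -- Interval lengths are deterministic, so this energy is known at the left end point and `c` is
  -- again an admissible integrand; no stopping time is needed.
  set c : ℕ → Ω → ℝ := fun k => {ω | S (k + 1) ω ≤ b}.indicator (φ.coeff k) with hc
  have hcm : ∀ k, StronglyMeasurable[𝓕 (φ.time k)] (c k) := fun k =>
    (φ.coeff_meas k).indicator
      (@measurableSet_le _ _ _ _ _ (𝓕 (φ.time k)) _ _ _ _ _ (hSm k).measurable measurable_const)
  have hcC : ∀ k ω, ‖c k ω‖ ≤ C := fun k ω => (norm_indicator_le_norm_self _ _).trans (hC k ω)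
  obtain ⟨hM, hI⟩ := hW.isometry φ.time_mono t hcm hcC φ.N
  set X : Ω → ℝ := fun ω => ∑ k ∈ Finset.range φ.N,
      (W (min (φ.time (k + 1)) t) ω - W (min (φ.time k) t) ω) * c k ω with hX
  have hX2 : ∫ ω, X ω ^ 2 ∂μ ≤ b := by
    rw [hI]
    have : ∀ ω, ∑ k ∈ Finset.range φ.N, c k ω ^ 2 * δ k ≤ b := by
      intro ω
      refine le_trans (le_of_eq ?_) ((sum_truncated_le
        (fun k => mul_nonneg (sq_nonneg (φ.coeff k ω)) (hd k)) hb φ.N).trans (min_le_left _ _))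
      refine Finset.sum_congr rfl fun k _ => ?_
      by_cases h : S (k + 1) ω ≤ b
      · rw [if_pos h, hc]; simp only; rw [Set.indicator_of_mem (by exact h)]
      · rw [if_neg h, hc]; simp only; rw [Set.indicator_of_notMem (by exact h)]; simp
    have hcb : ∀ k, MemLp (c k) 2 μ := fun k =>
      (memLp_top_of_bound ((hcm k).mono (𝓕.le _)).aestronglyMeasurable C
        (ae_of_all _ (hcC k))).mono_exponent le_top
    calc _ ≤ ∫ _, b ∂μ := integral_mono
            (integrable_finsetSum _ fun k _ => (hcb k).integrable_sq.mul_const _)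
            (integrable_const b) this
      _ = b := by simp
  have hsub : {ω | a ≤ ‖φ.integral W t ω‖ ∧
      ∫⁻ s in Set.Iic t, ‖φ.eval s ω‖ₑ ^ 2 ∂timeLeb ≤ ENNReal.ofReal b} ⊆
      {ω | a ^ 2 ≤ X ω ^ 2} := by
    rintro ω ⟨h1, h2⟩
    rw [φ.lintegral_eval_sq, ENNReal.ofReal_le_ofReal_iff hb] at h2
    -- Where the total energy is at most `b`, no coefficient has been switched off.
    have hXφ : X ω = φ.integral W t ω := by
      refine Finset.sum_congr rfl fun k hk => ?_
      have hle : S (k + 1) ω ≤ b := by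
        refine le_trans (Finset.sum_le_sum_of_subset_of_nonneg ?_ fun l _ _ =>
          mul_nonneg (sq_nonneg (φ.coeff l ω)) (hd l)) h2
        exact Finset.range_mono (Finset.mem_range.1 hk)
      rw [smul_eq_mul, hc]; simp only; rw [Set.indicator_of_mem (by exact hle)]
    have : a ^ 2 ≤ ‖φ.integral W t ω‖ ^ 2 := pow_le_pow_left₀ ha.le h1 2
    rw [Set.mem_ofPred_eq, hXφ, ← sq_abs (φ.integral W t ω)]
    exact this
  refine (measure_mono hsub).trans ?_
  have := mul_meas_ge_le_integral_of_nonneg (ae_of_all _ fun ω => sq_nonneg (X ω))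
    hM.integrable_sq (a ^ 2)
  rw [← ofReal_measureReal]
  refine ENNReal.ofReal_le_ofReal ?_
  rw [le_div_iff₀ (by positivity), mul_comm]
  exact this.trans hX2

end ScalarIto

/-! ### Itô integrals in a Banach space: locality and linearity -/

section ItoIntegral

variable {Ω : Type*} {mΩ : MeasurableSpace Ω} {𝓕 : Filtration ℝ≥0 mΩ} {μ : Measure Ω}
  {W : ℝ≥0 → Ω → ℝ} {H : Type*} [NormedAddCommGroup H] [NormedSpace ℝ H]
  {t : ℝ≥0} {Φ Ψ : ℝ≥0 → Ω → H} {J K : Ω → H}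

lemma edist_ennreal_zero (x : ℝ≥0∞) : edist x 0 = x := by
  cases x with
  | top => rfl
  | coe x =>
    change edist x 0 = _
    rw [edist_nndist, NNReal.nndist_zero_eq_val']

/-- `2a² + 2b²`-bound for the square of an extended norm of a sum. -/
lemma enorm_add_sq_le {G : Type*} [NormedAddCommGroup G] (x y : G) :
    ‖x + y‖ₑ ^ 2 ≤ 2 * ‖x‖ₑ ^ 2 + 2 * ‖y‖ₑ ^ 2 := by
  simp only [← ofReal_norm, ← ENNReal.ofReal_pow (norm_nonneg _)]
  rw [show (2 : ℝ≥0∞) = ENNReal.ofReal 2 by simp, ← ENNReal.ofReal_mul (by norm_num),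
    ← ENNReal.ofReal_mul (by norm_num), ← ENNReal.ofReal_add (by positivity) (by positivity)]
  refine ENNReal.ofReal_le_ofReal ?_
  have := norm_add_le x y
  nlinarith [sq_nonneg (‖x‖ - ‖y‖), norm_nonneg (x + y), norm_nonneg x, norm_nonneg y]

lemma enorm_sub_sq_le {G : Type*} [NormedAddCommGroup G] (x y : G) :
    ‖x - y‖ₑ ^ 2 ≤ 2 * ‖x‖ₑ ^ 2 + 2 * ‖y‖ₑ ^ 2 := by
  simpa [sub_eq_add_neg] using enorm_add_sq_le x (-y)

lemma tendstoInMeasure_zero_iff {α ι : Type*} {m : MeasurableSpace α} {ν : Measure α}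
    {l : Filter ι} {f : ι → α → ℝ≥0∞} :
    TendstoInMeasure ν f l (fun _ => 0) ↔
      ∀ ε : ℝ≥0∞, 0 < ε → Tendsto (fun n => ν {x | ε ≤ f n x}) l (𝓝 0) := by
  simp only [TendstoInMeasure, edist_ennreal_zero]

lemma tendstoInMeasure_zero_of_le {α ι : Type*} {m : MeasurableSpace α} {ν : Measure α}
    {l : Filter ι} {f g : ι → α → ℝ≥0∞} (hf : TendstoInMeasure ν f l fun _ => 0)
    (h : ∀ n, ∀ᵐ x ∂ν, g n x ≤ f n x) : TendstoInMeasure ν g l fun _ => 0 := by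
  rw [tendstoInMeasure_zero_iff] at hf ⊢
  intro ε hε
  refine tendsto_of_tendsto_of_tendsto_of_le_of_le tendsto_const_nhds (hf ε hε)
    (fun _ => zero_le) fun n => measure_mono_ae ?_
  filter_upwards [h n] with x hx hx'
  exact le_trans hx' hx

lemma tendstoInMeasure_zero_mul_add {α ι : Type*} {m : MeasurableSpace α} {ν : Measure α}
    {l : Filter ι} {f g : ι → α → ℝ≥0∞} (hf : TendstoInMeasure ν f l fun _ => 0)
    (hg : TendstoInMeasure ν g l fun _ => 0) {c : ℝ≥0∞} (hc : c ≠ ∞) :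
    TendstoInMeasure ν (fun n x => c * f n x + c * g n x) l fun _ => 0 := by
  rw [tendstoInMeasure_zero_iff] at hf hg ⊢
  intro ε hε
  have hc2 : 2 * c ≠ ∞ := ENNReal.mul_ne_top (by simp) hc
  rcases eq_or_ne c 0 with rfl | hc0
  · simpa [hε.ne'] using tendsto_const_nhds
  have hε' : 0 < min ε 1 / (2 * c) :=
    ENNReal.div_pos (lt_min hε one_pos).ne' hc2
  have hf1 : min ε 1 ≠ ∞ := ((min_le_right _ _).trans_lt ENNReal.one_lt_top).ne
  have := (hf _ hε').add (hg _ hε')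
  rw [add_zero] at this
  refine tendsto_of_tendsto_of_tendsto_of_le_of_le tendsto_const_nhds this
    (fun _ => zero_le) fun n => (measure_mono ?_).trans (measure_union_le _ _)
  intro x hx
  by_contra h
  have h : ¬ (min ε 1 / (2 * c) ≤ f n x ∨ min ε 1 / (2 * c) ≤ g n x) := h
  push Not at h
  have hx : ε ≤ c * f n x + c * g n x := hx
  have h1 := (ENNReal.lt_div_iff_mul_lt (Or.inl (mul_ne_zero (by simp) hc0)) (Or.inl hc2)).1 h.1
  have h2 := (ENNReal.lt_div_iff_mul_lt (Or.inl (mul_ne_zero (by simp) hc0)) (Or.inl hc2)).1 h.2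
  have h3 : 2 * (c * f n x + c * g n x) < 2 * min ε 1 := by
    calc _ = f n x * (2 * c) + g n x * (2 * c) := by ring
      _ < min ε 1 + min ε 1 := ENNReal.add_lt_add h1 h2
      _ = 2 * min ε 1 := by ring
  have := (ENNReal.mul_lt_mul_iff_right (by simp) (by simp)).1 h3
  exact absurd hx (not_le.2 (this.trans_le (min_le_left _ _)))

lemma tendstoInMeasure_clm_sub {α ι K' : Type*} [NormedAddCommGroup K'] [NormedSpace ℝ K']
    {m : MeasurableSpace α} {ν : Measure α} {l : Filter ι} {f g : ι → α → H} {J K : α → H}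
    (L : H →L[ℝ] K') (hf : TendstoInMeasure ν f l J) (hg : TendstoInMeasure ν g l K) :
    TendstoInMeasure ν (fun n x => L (f n x - g n x)) l (fun x => L (J x - K x)) := by
  rw [tendstoInMeasure_iff_norm] at hf hg ⊢
  intro ε hε
  set δ := ε / (2 * (‖L‖ + 1)) with hδ
  have hδ0 : 0 < δ := by positivity
  have := (hf δ hδ0).add (hg δ hδ0)
  rw [add_zero] at this
  refine tendsto_of_tendsto_of_tendsto_of_le_of_le tendsto_const_nhds this
    (fun _ => zero_le) fun n => (measure_mono ?_).trans (measure_union_le _ _)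
  intro ω hω
  by_contra h
  have h : ¬ (δ ≤ ‖f n ω - J ω‖ ∨ δ ≤ ‖g n ω - K ω‖) := h
  push Not at h
  have hω : ε ≤ ‖L (f n ω - g n ω) - L (J ω - K ω)‖ := hω
  rw [← map_sub, sub_sub_sub_comm] at hω
  have h1 := hω.trans (L.le_opNorm _)
  have h2 := norm_sub_le (f n ω - J ω) (g n ω - K ω)
  have h3 : ‖L‖ * ‖(f n ω - J ω) - (g n ω - K ω)‖ ≤ ‖L‖ * (2 * δ) := by
    gcongr; linarith
  have h4 : ‖L‖ * (2 * δ) < (‖L‖ + 1) * (2 * δ) := by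
    gcongr; linarith
  have h5 : (‖L‖ + 1) * (2 * δ) = ε := by
    rw [hδ]; field_simp
  linarith

omit [NormedSpace ℝ H] in
lemma ElemProcess.measurable_eval_time (φ : ElemProcess 𝓕 H) (ω : Ω) :
    StronglyMeasurable fun s => φ.eval s ω :=
  Finset.stronglyMeasurable_fun_sum _ fun _ _ =>
    stronglyMeasurable_const.indicator measurableSet_Ioc

omit [NormedSpace ℝ H] in
lemma lintegral_enorm_sub_sq_le {α : Type*} {m : MeasurableSpace α} {ν : Measure α} {f g : α → H}
    (hf : AEStronglyMeasurable f ν) :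
    ∫⁻ s, ‖f s - g s‖ₑ ^ 2 ∂ν ≤ 2 * ∫⁻ s, ‖f s‖ₑ ^ 2 ∂ν + 2 * ∫⁻ s, ‖g s‖ₑ ^ 2 ∂ν := by
  refine (lintegral_mono fun s => enorm_sub_sq_le (f s) (g s)).trans ?_
  rw [lintegral_add_left' ((hf.enorm.pow_const 2).const_mul 2),
    lintegral_const_mul' _ _ (by simp), lintegral_const_mul' _ _ (by simp)]

/-- Locality of the Itô integral: where the integrands agree, so do the integrals. -/
theorem IsItoIntegral.ae_eq_of_ae_eq_on [SecondCountableTopology H] [IsProbabilityMeasure μ]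
    (hW : IsWiener μ 𝓕 W) (hJ : IsItoIntegral μ 𝓕 W t Φ J) (hK : IsItoIntegral μ 𝓕 W t Ψ K)
    {A : Set Ω} (hA : ∀ᵐ ω ∂μ, ω ∈ A →
      ∀ᵐ s ∂(timeLeb.restrict (Set.Iic t)), Φ s ω = Ψ s ω) :
    ∀ᵐ ω ∂μ, ω ∈ A → J ω = K ω := by
  obtain ⟨hΦm, φ, hφ, hφJ⟩ := hJ
  obtain ⟨hΨm, ψ, hψ, hψK⟩ := hK
  choose χ hχe hχi using fun n => (φ n).exists_sub (ψ n) W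
  suffices h : A.indicator (fun ω => J ω - K ω) =ᵐ[μ] 0 by
    filter_upwards [h] with ω hω hωA
    rw [Set.indicator_of_mem hωA] at hω
    exact sub_eq_zero.1 hω
  -- There is no isometry for integrals with values in `H`; as `H` is separable, it suffices to test
  -- with dual functionals, for which the scalar estimate is available.
  refine ae_eq_zero_of_forall_dual ℝ fun x' => ?_
  set D : Ω → ℝ := fun ω => x' (J ω - K ω) with hD
  have hlim : TendstoInMeasure μ (fun n ω => x' ((χ n).integral W t ω)) atTop D :=
    (tendstoInMeasure_clm_sub x' hφJ hψK).congr_left fun n => ae_of_all _ fun ω => by simp [hχi]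
  have hR := tendstoInMeasure_zero_mul_add hφ hψ
    (c := ‖x'‖ₑ ^ 2 * 2) (ENNReal.mul_ne_top (by simp) (by simp))
  rw [tendstoInMeasure_zero_iff] at hR
  rw [tendstoInMeasure_iff_norm] at hlim
  -- On `A` the two integrands cancel, so the energy of `χ n` is controlled by the two approximation
  -- errors.
  have hen : ∀ n, ∀ᵐ ω ∂μ, ω ∈ A →
      ∫⁻ s in Set.Iic t, ‖((χ n).mapCLM x').eval s ω‖ₑ ^ 2 ∂timeLeb ≤
      ‖x'‖ₑ ^ 2 * 2 * ∫⁻ s in Set.Iic t, ‖(φ n).eval s ω - Φ s ω‖ₑ ^ 2 ∂timeLeb +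
      ‖x'‖ₑ ^ 2 * 2 * ∫⁻ s in Set.Iic t, ‖(ψ n).eval s ω - Ψ s ω‖ₑ ^ 2 ∂timeLeb := by
    intro n
    filter_upwards [hA, hΦm] with ω hω hm hωA
    rw [mul_assoc, mul_assoc, ← mul_add]
    refine le_trans ?_ (mul_le_mul_right (lintegral_enorm_sub_sq_le
      (((φ n).measurable_eval_time ω).aestronglyMeasurable.sub hm)) _)
    rw [← lintegral_const_mul' _ _ (by simp)]
    refine lintegral_mono_ae ?_
    filter_upwards [hω hωA] with s hs
    rw [ElemProcess.mapCLM_eval, hχe, ← mul_pow, Pi.sub_apply, hs, sub_sub_sub_cancel_right]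
    exact pow_le_pow_left₀ zero_le (x'.le_opENorm _) 2
  -- If `|D| ≥ 2a` on `A`, then the approximating integral is `a` away from `D`, or the
  -- approximation errors exceed `b`, or an integral of size `a` comes with energy at most `b`. The
  -- first two probabilities vanish as `n → ∞`, the third is at most `b / a²`; finally `b → 0`.
  have key : ∀ a : ℝ, 0 < a → μ (A ∩ {ω | 2 * a ≤ ‖D ω‖}) = 0 := by
    intro a ha
    have hb : ∀ b : ℝ, 0 < b → μ (A ∩ {ω | 2 * a ≤ ‖D ω‖}) ≤ ENNReal.ofReal (b / a ^ 2) := by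
      intro b hb
      have hl := ((hlim a ha).add (hR (ENNReal.ofReal b) (by simpa using hb))).add
        (tendsto_const_nhds (x := ENNReal.ofReal (b / a ^ 2)))
      rw [zero_add, zero_add] at hl
      refine ge_of_tendsto' hl fun n => ?_
      refine le_trans ?_ (add_le_add_right
        (((χ n).mapCLM x').measure_integral_le hW t ha hb.le) _)
      refine le_trans ?_ (add_le_add_left (measure_union_le _ _) _)
      refine le_trans ?_ (measure_union_le _ _)
      refine measure_mono_ae ?_
      filter_upwards [hen n] with ω hω hωA
      obtain ⟨hωA, hωD⟩ := hωA
      have hωD : 2 * a ≤ ‖D ω‖ := hωD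
      by_contra hcon
      have hcon : ¬ ((a ≤ ‖x' ((χ n).integral W t ω) - D ω‖ ∨ ENNReal.ofReal b ≤
        ‖x'‖ₑ ^ 2 * 2 * ∫⁻ s in Set.Iic t, ‖(φ n).eval s ω - Φ s ω‖ₑ ^ 2 ∂timeLeb +
        ‖x'‖ₑ ^ 2 * 2 * ∫⁻ s in Set.Iic t, ‖(ψ n).eval s ω - Ψ s ω‖ₑ ^ 2 ∂timeLeb) ∨
        (a ≤ ‖((χ n).mapCLM x').integral W t ω‖ ∧
      ∫⁻ s in Set.Iic t, ‖((χ n).mapCLM x').eval s ω‖ₑ ^ 2 ∂timeLeb ≤ ENNReal.ofReal b)) := hcon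
      rw [ElemProcess.mapCLM_integral] at hcon
      push Not at hcon
      obtain ⟨⟨h1, h2⟩, h3⟩ := hcon
      have h4 := (hω hωA).trans h2.le
      have h5 : ‖x' ((χ n).integral W t ω)‖ < a := by
        by_contra h6
        exact absurd h4 (not_le.2 (h3 (not_lt.1 h6)))
      have h6 := norm_sub_norm_le (D ω) (x' ((χ n).integral W t ω))
      rw [norm_sub_rev] at h6
      linarith
    have hl : Tendsto (fun b : ℝ => ENNReal.ofReal (b / a ^ 2)) (𝓝[>] 0) (𝓝 0) := by
      have : Tendsto (fun b : ℝ => ENNReal.ofReal (b / a ^ 2)) (𝓝 0)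
          (𝓝 (ENNReal.ofReal (0 / a ^ 2))) :=
        (ENNReal.continuous_ofReal.comp (continuous_id.div_const _)).tendsto 0
      rw [zero_div, ENNReal.ofReal_zero] at this
      exact this.mono_left nhdsWithin_le_nhds
    refine le_antisymm (ge_of_tendsto hl ?_) zero_le
    filter_upwards [self_mem_nhdsWithin] with b hb' using hb b hb'
  have hall : ∀ᵐ ω ∂μ, ∀ n : ℕ, ω ∉ A ∩ {ω | 2 * (1 / ((n : ℝ) + 1)) ≤ ‖D ω‖} :=
    ae_all_iff.2 fun n => measure_eq_zero_iff_ae_notMem.1 (key _ (by positivity))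
  filter_upwards [hall] with ω hω
  by_cases hωA : ω ∈ A
  · rw [Set.indicator_of_mem hωA]
    change D ω = 0
    by_contra hne
    obtain ⟨n, hn⟩ := exists_nat_one_div_lt (half_pos (norm_pos_iff.2 hne))
    refine hω n ⟨hωA, ?_⟩
    change _ ≤ ‖D ω‖
    linarith
  · rw [Set.indicator_of_notMem hωA, map_zero]; rfl

lemma IsItoIntegral.congr (hJ : IsItoIntegral μ 𝓕 W t Φ J)
    (h : ∀ᵐ ω ∂μ, ∀ᵐ s ∂(timeLeb.restrict (Set.Iic t)), Φ s ω = Ψ s ω) (hJK : J =ᵐ[μ] K) :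
    IsItoIntegral μ 𝓕 W t Ψ K := by
  obtain ⟨hΦm, φ, hφ, hφJ⟩ := hJ
  refine ⟨?_, φ, ?_, hφJ.congr_right hJK⟩
  · filter_upwards [hΦm, h] with ω h1 h2 using h1.congr h2
  · refine tendstoInMeasure_zero_of_le hφ fun n => ?_
    filter_upwards [h] with ω hω
    refine le_of_eq (lintegral_congr_ae ?_)
    filter_upwards [hω] with s hs
    rw [hs]

lemma IsItoIntegral.sub (hJ : IsItoIntegral μ 𝓕 W t Φ J) (hK : IsItoIntegral μ 𝓕 W t Ψ K) :
    IsItoIntegral μ 𝓕 W t (fun s ω => Φ s ω - Ψ s ω) (fun ω => J ω - K ω) := by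
  obtain ⟨hΦm, φ, hφ, hφJ⟩ := hJ
  obtain ⟨hΨm, ψ, hψ, hψK⟩ := hK
  choose χ hχe hχi using fun n => (φ n).exists_sub (ψ n) W
  refine ⟨?_, χ, ?_, ?_⟩
  · filter_upwards [hΦm, hΨm] with ω h1 h2 using h1.sub h2
  · refine tendstoInMeasure_zero_of_le
      (tendstoInMeasure_zero_mul_add hφ hψ (c := 2) (by simp)) fun n => ?_
    filter_upwards [hΦm] with ω hm
    simp_rw [hχe, sub_sub_sub_comm _ _ (Φ _ ω) _]
    exact lintegral_enorm_sub_sq_le (((φ n).measurable_eval_time ω).aestronglyMeasurable.sub hm)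
  · refine (tendstoInMeasure_clm_sub (.id ℝ H) hφJ hψK).congr_left fun n => ae_of_all _ fun ω => ?_
    simp [hχi]

/-- Extension of an Itô integral beyond a time after which the integrand vanishes, composed with
a bounded operator. -/
lemma IsItoIntegral.map_extend {K' : Type*} [NormedAddCommGroup K'] [NormedSpace ℝ K']
    (hJ : IsItoIntegral μ 𝓕 W t Φ J) (L : H →L[ℝ] K') {r : ℝ≥0} (hr : t ≤ r) :
    IsItoIntegral μ 𝓕 W r (fun s ω => if s ≤ t then L (Φ s ω) else 0) (fun ω => L (J ω)) := by
  obtain ⟨hΦm, φ, hφ, hφJ⟩ := hJ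
  choose χ hχe hχi using fun n => ((φ n).mapCLM L).exists_restrict W t
  have hind : ∀ f : ℝ≥0 → K', (fun s => if s ≤ t then f s else 0) = (Set.Iic t).indicator f := by
    intro f; ext s; simp [Set.indicator]
  refine ⟨?_, χ, ?_, ?_⟩
  · filter_upwards [hΦm] with ω h1
    rw [hind fun s => L (Φ s ω)]
    have h2 : AEStronglyMeasurable ((Set.Iic t).indicator fun s => L (Φ s ω)) timeLeb :=
      (aestronglyMeasurable_indicator_iff measurableSet_Iic).2
        (L.continuous.comp_aestronglyMeasurable h1)
    exact h2.restrict
  · have h0 : TendstoInMeasure μ (fun (_ : ℕ) (_ : Ω) => (0 : ℝ≥0∞)) atTop (fun _ => 0) := by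
      rw [tendstoInMeasure_zero_iff]
      intro ε hε
      simp [hε.ne']
    refine tendstoInMeasure_zero_of_le
      (tendstoInMeasure_zero_mul_add hφ h0 (c := ‖L‖ₑ ^ 2) (by simp)) fun n => ae_of_all _ fun ω => ?_
    rw [mul_zero, add_zero, ← lintegral_const_mul' _ _ (by simp),
      ← lintegral_indicator measurableSet_Iic, ← lintegral_indicator measurableSet_Iic]
    refine lintegral_mono fun s => ?_
    simp only [hχe, ElemProcess.mapCLM_eval]
    by_cases hs : s ≤ t
    · rw [Set.indicator_of_mem (Set.mem_Iic.2 (hs.trans hr)),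
        Set.indicator_of_mem (Set.mem_Iic.2 hs), if_pos hs, if_pos hs,
        ← map_sub, ← mul_pow]
      exact pow_le_pow_left₀ zero_le (L.le_opENorm _) 2
    · simp [hs, Set.indicator]
  · rw [tendstoInMeasure_iff_norm] at hφJ ⊢
    intro ε hε
    have hδ0 : 0 < ε / (‖L‖ + 1) := by positivity
    refine tendsto_of_tendsto_of_tendsto_of_le_of_le tendsto_const_nhds (hφJ _ hδ0)
      (fun _ => zero_le) fun n => measure_mono ?_
    intro ω hω
    have hω : ε ≤ ‖(χ n).integral W r ω - L (J ω)‖ := hω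
    rw [hχi n r ω hr, ElemProcess.mapCLM_integral, ← map_sub] at hω
    change _ ≤ ‖(φ n).integral W t ω - J ω‖
    rw [div_le_iff₀ (by positivity)]
    have := hω.trans (L.le_opNorm _)
    nlinarith [norm_nonneg ((φ n).integral W t ω - J ω)]

end ItoIntegral

/-! ### The `E`-norm as a function on `V` -/

section SubNorm

variable {E V : Type*} [NormedAddCommGroup E] [NormedSpace ℝ E]
  [NormedAddCommGroup V] [NormedSpace ℝ V] {j : E →L[ℝ] V}

lemma subNorm_apply (hj : Function.Injective j) (e : E) : subNorm j (j e) = ‖e‖ₑ := by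
  refine le_antisymm (iInf₂_le (f := fun (e : E) (_ : j e = _) => ‖e‖ₑ) e rfl) (le_iInf₂ fun e' he' => ?_)
  rw [hj he']

lemma exists_of_subNorm_lt_top (hj : Function.Injective j) {x : V} (hx : subNorm j x < ∞) :
    ∃ e, j e = x ∧ subNorm j x = ‖e‖ₑ := by
  have : ∃ e, j e = x := by
    by_contra h
    push Not at h
    simp [subNorm, h] at hx
  obtain ⟨e, rfl⟩ := this
  exact ⟨e, rfl, subNorm_apply hj e⟩

lemma subNorm_zero : subNorm j 0 = 0 :=
  le_antisymm ((iInf₂_le (f := fun (e : E) (_ : j e = _) => ‖e‖ₑ) 0 (map_zero j)).trans (by simp)) zero_le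

lemma subNorm_add_le (hj : Function.Injective j) (x y : V) :
    subNorm j (x + y) ≤ subNorm j x + subNorm j y := by
  rcases lt_or_ge (subNorm j x) ∞ with hx | hx
  · rcases lt_or_ge (subNorm j y) ∞ with hy | hy
    · obtain ⟨e, rfl, he⟩ := exists_of_subNorm_lt_top hj hx
      obtain ⟨e', rfl, he'⟩ := exists_of_subNorm_lt_top hj hy
      rw [← map_add, he, he', subNorm_apply hj]
      exact enorm_add_le _ _
    · simp [top_le_iff.1 hy]
  · simp [top_le_iff.1 hx]

lemma subNorm_neg (hj : Function.Injective j) (x : V) : subNorm j (-x) = subNorm j x := by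
  have h : ∀ x, subNorm j (-x) ≤ subNorm j x := by
    intro x
    rcases lt_or_ge (subNorm j x) ∞ with hx | hx
    · obtain ⟨e, rfl, he⟩ := exists_of_subNorm_lt_top hj hx
      rw [← map_neg, subNorm_apply hj, subNorm_apply hj, enorm_neg]
    · simp [top_le_iff.1 hx]
  refine le_antisymm (h x) ?_
  simpa using h (-x)

/-- This form yields Borel measurability, since `j` is a measurable embedding. -/
lemma subNorm_eq_extend (hj : Function.Injective j) :
    subNorm j = Function.extend j (fun e => ‖e‖ₑ) (fun _ => ∞) := by
  ext x
  by_cases h : ∃ e, j e = x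
  · obtain ⟨e, rfl⟩ := h
    rw [hj.extend_apply, subNorm_apply hj]
  · rw [Function.extend_apply' _ _ _ h]
    push Not at h
    simp [subNorm, h]

/-- Countable subadditivity of the `E`-norm. -/
lemma subNorm_le_tsum [CompleteSpace E] (hj : Function.Injective j) {w : ℕ → V} {x : V}
    (hx : HasSum w x) : subNorm j x ≤ ∑' k, subNorm j (w k) := by
  rcases lt_or_ge (∑' k, subNorm j (w k)) ∞ with h | h
  · have hk : ∀ k, subNorm j (w k) < ∞ := fun k => (ENNReal.le_tsum k).trans_lt h
    choose e he hen using fun k => exists_of_subNorm_lt_top hj (hk k)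
    simp_rw [hen] at h ⊢
    -- The preimages form an absolutely convergent series in the complete space `E`; continuity of
    -- `j` and uniqueness of limits identify the image of its sum with `x`.
    have hs : Summable e := by
      refine Summable.of_nnnorm (f := e) ?_
      exact ENNReal.tsum_coe_ne_top_iff_summable.1 h.ne
    have h1 : HasSum w (j (∑' k, e k)) := by
      have := j.hasSum hs.hasSum
      simpa only [he] using this
    rw [hx.unique h1, subNorm_apply hj]
    exact enorm_tsum_le_tsum_enorm
  · simp [top_le_iff.1 h]

/-- This is the Lusin–Souslin theorem: injective continuous images of Borel sets of a Polish space
are Borel. -/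
lemma measurableEmbedding_of_injective [CompleteSpace E] [SecondCountableTopology E]
    [MeasurableSpace E] [BorelSpace E] [MeasurableSpace V] [BorelSpace V]
    (hj : Function.Injective j) : MeasurableEmbedding j :=
  j.continuous.measurableEmbedding hj

lemma measurable_subNorm [CompleteSpace E] [SecondCountableTopology E]
    [MeasurableSpace V] [BorelSpace V] (hj : Function.Injective j) : Measurable (subNorm j) := by
  borelize E
  rw [subNorm_eq_extend hj]
  exact (measurableEmbedding_of_injective hj).measurable_extend measurable_enorm measurable_const

end SubNorm

/-! ### Quadratic estimates for the nonlinearities -/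

section PolyLipschitz

/-- Young's inequality in a form that includes `α = 0`. Either `a ≤ l * b` or `b < a / l`, and `l`
is chosen such that `l ^ (-(1 - α)) = η`. -/
lemma exists_young_const {α η : ℝ} (hα0 : 0 ≤ α) (hα : α < 1) (hη : 0 < η) :
    ∃ c : ℝ, 0 ≤ c ∧ ∀ a b : ℝ, 0 ≤ a → 0 ≤ b → a ^ α * b ^ (1 - α) ≤ η * a + c * b := by
  set l : ℝ := η ^ (-(1 / (1 - α))) with hl
  have hl0 : 0 < l := Real.rpow_pos_of_pos hη _
  have h1α : 0 < 1 - α := by linarith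
  refine ⟨l ^ α, (Real.rpow_pos_of_pos hl0 _).le, fun a b ha hb => ?_⟩
  have hc : 0 ≤ l ^ α * b := mul_nonneg (Real.rpow_nonneg hl0.le _) hb
  rcases le_or_gt a (l * b) with h | h
  · calc a ^ α * b ^ (1 - α) ≤ (l * b) ^ α * b ^ (1 - α) := by gcongr
      _ = l ^ α * (b ^ α * b ^ (1 - α)) := by rw [Real.mul_rpow hl0.le hb, mul_assoc]
      _ = l ^ α * b := by
        rw [← Real.rpow_add' hb (by simp), add_sub_cancel, Real.rpow_one]
      _ ≤ _ := by nlinarith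
  · have hb' : b ≤ a / l := by rw [le_div_iff₀ hl0]; linarith
    calc a ^ α * b ^ (1 - α) ≤ a ^ α * (a / l) ^ (1 - α) := by gcongr
      _ = (a ^ α * a ^ (1 - α)) / l ^ (1 - α) := by
        rw [Real.div_rpow ha hl0.le]; ring
      _ = a * η := by
        rw [← Real.rpow_add' ha (by simp), add_sub_cancel, Real.rpow_one, hl,
          ← Real.rpow_mul hη.le, neg_mul, one_div, inv_mul_cancel₀ h1α.ne', Real.rpow_neg hη.le,
          Real.rpow_one, div_inv_eq_mul]
      _ ≤ _ := by linarith

variable {E V Y : Type*} [NormedAddCommGroup E] [NormedSpace ℝ E]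
  [NormedAddCommGroup V] [NormedSpace ℝ V] [NormedAddCommGroup Y] {j : E →L[ℝ] V} {F : E → Y}

/-- Here `α < 1` pays off: on bounded sets of `V` the squared `E`-norms enter with an arbitrarily
small factor. All contraction arguments rest on this. -/
lemma IsPolyLipschitz.norm_sub_sq_le (hF : IsPolyLipschitz j F) (K : ℝ) {η : ℝ} (hη : 0 < η) :
    ∃ c : ℝ, 0 ≤ c ∧ ∀ x y : E, ‖j x‖ ≤ K → ‖j y‖ ≤ K →
      ‖F y - F x‖ ^ 2 ≤ ‖j (y - x)‖ ^ 2 * (η * ‖y‖ ^ 2 + c)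
        + (η * ‖y - x‖ ^ 2 + c * ‖j (y - x)‖ ^ 2) := by
  obtain ⟨-, p, α, C, hp, hα0, hα, hC, h⟩ := hF
  set L : ℝ := max ((max K 0) ^ (p - α)) ((max K 0) ^ p) with hL
  have hL0 : 0 ≤ L := (Real.rpow_nonneg (le_max_right _ _) _).trans (le_max_right _ _)
  -- The total constant in front of both terms; Young's inequality is applied with `η / (A + 1)` so
  -- that it is absorbed.
  set A : ℝ := 2 * C ^ 2 * L ^ 2 with hA
  have hA0 : 0 ≤ A := by positivity
  obtain ⟨c, hc0, hc⟩ := exists_young_const hα0 hα (show 0 < η / (A + 1) by positivity)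
  refine ⟨A * c, by positivity, fun x y hx hy => ?_⟩
  have hAη : A * (η / (A + 1)) ≤ η := by
    rw [mul_div_assoc', div_le_iff₀ (by positivity)]; nlinarith
  have sq_rpow : ∀ {a : ℝ} (r : ℝ), 0 ≤ a → (a ^ r) ^ 2 = (a ^ 2) ^ r := by
    intro a r ha
    rw [← Real.rpow_natCast, ← Real.rpow_natCast, ← Real.rpow_mul ha, ← Real.rpow_mul ha, mul_comm]
  set d := ‖j (y - x)‖ with hd
  have hd0 : 0 ≤ d := norm_nonneg _
  have h1 : (d * ‖j y‖ ^ (p - α) * ‖y‖ ^ α) ^ 2 ≤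
      L ^ 2 * (d ^ 2 * (η / (A + 1) * ‖y‖ ^ 2 + c)) := by
    have e1 : ‖j y‖ ^ (p - α) ≤ L :=
      (Real.rpow_le_rpow (norm_nonneg _) (hy.trans (le_max_left _ _)) (by linarith)).trans
        (le_max_left _ _)
    have e2 : (‖y‖ ^ α) ^ 2 ≤ η / (A + 1) * ‖y‖ ^ 2 + c := by
      have := hc (‖y‖ ^ 2) 1 (by positivity) zero_le_one
      rw [Real.one_rpow, mul_one, mul_one] at this
      rwa [sq_rpow _ (norm_nonneg _)]
    calc _ = (‖j y‖ ^ (p - α)) ^ 2 * (d ^ 2 * (‖y‖ ^ α) ^ 2) := by ring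
      _ ≤ L ^ 2 * (d ^ 2 * (η / (A + 1) * ‖y‖ ^ 2 + c)) := by
        gcongr
  have h2 : (‖y - x‖ ^ α * d ^ (1 - α) * ‖j x‖ ^ p) ^ 2 ≤
      L ^ 2 * (η / (A + 1) * ‖y - x‖ ^ 2 + c * d ^ 2) := by
    have e1 : ‖j x‖ ^ p ≤ L :=
      (Real.rpow_le_rpow (norm_nonneg _) (hx.trans (le_max_left _ _)) (by linarith)).trans
        (le_max_right _ _)
    have e2 : (‖y - x‖ ^ α) ^ 2 * (d ^ (1 - α)) ^ 2 ≤ η / (A + 1) * ‖y - x‖ ^ 2 + c * d ^ 2 := by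
      rw [sq_rpow _ (norm_nonneg _), sq_rpow _ hd0]
      exact hc _ _ (by positivity) (by positivity)
    calc _ = (‖j x‖ ^ p) ^ 2 * ((‖y - x‖ ^ α) ^ 2 * (d ^ (1 - α)) ^ 2) := by ring
      _ ≤ L ^ 2 * (η / (A + 1) * ‖y - x‖ ^ 2 + c * d ^ 2) := by
        gcongr
  have h3 := pow_le_pow_left₀ (norm_nonneg _) (h x y) 2
  set P := d * ‖j y‖ ^ (p - α) * ‖y‖ ^ α
  set Q := ‖y - x‖ ^ α * d ^ (1 - α) * ‖j x‖ ^ p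
  have h4 : (C * (P + Q)) ^ 2 ≤ 2 * C ^ 2 * (P ^ 2 + Q ^ 2) := by
    nlinarith [mul_nonneg (sq_nonneg C) (sq_nonneg (P - Q))]
  have h5 : 2 * C ^ 2 * (P ^ 2 + Q ^ 2) ≤ 2 * C ^ 2 *
      (L ^ 2 * (d ^ 2 * (η / (A + 1) * ‖y‖ ^ 2 + c)) +
      L ^ 2 * (η / (A + 1) * ‖y - x‖ ^ 2 + c * d ^ 2)) := by gcongr
  refine h3.trans (h4.trans (h5.trans ?_))
  calc _ = d ^ 2 * (A * (η / (A + 1)) * ‖y‖ ^ 2 + A * c) +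
        (A * (η / (A + 1)) * ‖y - x‖ ^ 2 + A * c * d ^ 2) := by rw [hA]; ring
    _ ≤ _ := by gcongr

/-- It serves to make the nonlinearities measurable. As `y → x` the bound tends to zero, because `1
- α > 0`. -/
lemma IsPolyLipschitz.continuous (hF : IsPolyLipschitz j F) : Continuous F := by
  obtain ⟨-, p, α, C, hp, hα0, hα, hC, h⟩ := hF
  refine continuous_iff_continuousAt.2 fun x => ?_
  rw [ContinuousAt, tendsto_iff_norm_sub_tendsto_zero]
  have hb : Continuous fun y => C * (‖j (y - x)‖ * ‖j y‖ ^ (p - α) * ‖y‖ ^ α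
      + ‖y - x‖ ^ α * ‖j (y - x)‖ ^ (1 - α) * ‖j x‖ ^ p) := by
    have c1 : Continuous fun y : E => ‖j y‖ := by fun_prop
    have c2 : Continuous fun y : E => ‖j (y - x)‖ := by fun_prop
    have c3 : Continuous fun y : E => ‖y - x‖ := by fun_prop
    exact continuous_const.mul (((c2.mul (c1.rpow_const fun _ => Or.inr (by linarith))).mul
      (continuous_norm.rpow_const fun _ => Or.inr hα0)).add
      (((c3.rpow_const fun _ => Or.inr hα0).mul
        (c2.rpow_const fun _ => Or.inr (by linarith))).mul continuous_const))
  have h0 := hb.tendsto x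
  simp only [sub_self, map_zero, norm_zero, zero_mul, zero_add,
    Real.zero_rpow (show 1 - α ≠ 0 by linarith), mul_zero] at h0
  exact squeeze_zero (fun _ => norm_nonneg _) (h x) h0

/-- Pointwise form of the Lipschitz estimate for the extension of `F` to `V`. -/
lemma IsPolyLipschitz.enorm_extend_sub_sq_le (hF : IsPolyLipschitz j F)
    (hj : Function.Injective j) (K : ℝ≥0) {η : ℝ≥0} (hη : 0 < η) :
    ∃ c : ℝ≥0, ∀ x y : V, ‖x‖ₑ ≤ K → ‖y‖ₑ ≤ K → subNorm j x < ∞ → subNorm j y < ∞ →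
      ‖Function.extend j F 0 x - Function.extend j F 0 y‖ₑ ^ 2 ≤
        ‖x - y‖ₑ ^ 2 * (η * subNorm j x ^ 2 + c)
          + (η * subNorm j (x - y) ^ 2 + c * ‖x - y‖ₑ ^ 2) := by
  obtain ⟨c, hc0, hc⟩ := hF.norm_sub_sq_le (K : ℝ) (show (0 : ℝ) < η from hη)
  lift c to ℝ≥0 using hc0
  refine ⟨c, fun x y hx hy hx' hy' => ?_⟩
  obtain ⟨x, rfl, -⟩ := exists_of_subNorm_lt_top hj hx'
  obtain ⟨y, rfl, -⟩ := exists_of_subNorm_lt_top hj hy'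
  have h := hc y x (by exact_mod_cast enorm_le_coe.1 hy) (by exact_mod_cast enorm_le_coe.1 hx)
  rw [← map_sub, subNorm_apply hj, subNorm_apply hj, hj.extend_apply, hj.extend_apply]
  have h' : (‖F x - F y‖₊ ^ 2 : ℝ≥0) ≤ ‖j (x - y)‖₊ ^ 2 * (η * ‖x‖₊ ^ 2 + c)
        + (η * ‖x - y‖₊ ^ 2 + c * ‖j (x - y)‖₊ ^ 2) := by
    exact_mod_cast h
  simp only [enorm_eq_nnnorm]
  exact_mod_cast h'

/-- Lipschitz estimate in `L²` over a set of times of small measure. -/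
lemma IsPolyLipschitz.lintegral_sub_le (hF : IsPolyLipschitz j F) (hj : Function.Injective j)
    (K : ℝ≥0) {η : ℝ≥0} (hη : 0 < η) :
    ∃ c : ℝ≥0, ∀ (ν : Measure ℝ≥0) (v₁ v₂ : ℝ≥0 → V) (D : ℝ≥0∞),
      AEMeasurable (fun s => subNorm j (v₁ s)) ν →
      (∀ᵐ s ∂ν, ‖v₁ s‖ₑ ≤ K ∧ ‖v₂ s‖ₑ ≤ K ∧ subNorm j (v₁ s) < ∞ ∧ subNorm j (v₂ s) < ∞ ∧
        ‖v₁ s - v₂ s‖ₑ ^ 2 ≤ D) →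
      ∫⁻ s, subNorm j (v₁ s) ^ 2 ∂ν ≤ K → ∫⁻ s, subNorm j (v₁ s - v₂ s) ^ 2 ∂ν ≤ D →
      ∫⁻ s, ‖Function.extend j F 0 (v₁ s) - Function.extend j F 0 (v₂ s)‖ₑ ^ 2 ∂ν
        ≤ (η + c * ν Set.univ) * D := by
  -- The energy of `v₁`, at most `K`, and that of the difference, at most `D`, contribute `K + 1`
  -- parts of size `η / (K + 1)`. The constant `c` occurs once with each, hence `2 * c`.
  obtain ⟨c, hc⟩ := hF.enorm_extend_sub_sq_le hj K (η := η / (K + 1)) (by positivity)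
  refine ⟨2 * c, fun ν v₁ v₂ D hm hb h1 h2 => ?_⟩
  set η' : ℝ≥0 := η / (K + 1) with hη'
  calc _ ≤ ∫⁻ s, ((D * η') * subNorm j (v₁ s) ^ 2 + (D * (2 * c)) +
        η' * subNorm j (v₁ s - v₂ s) ^ 2) ∂ν := by
        refine lintegral_mono_ae ?_
        filter_upwards [hb] with s ⟨a1, a2, a3, a4, a5⟩
        refine (hc _ _ a1 a2 a3 a4).trans ?_
        calc _ ≤ D * (η' * subNorm j (v₁ s) ^ 2 + c) +
              (η' * subNorm j (v₁ s - v₂ s) ^ 2 + c * D) := by gcongr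
          _ = _ := by ring
    _ = D * η' * ∫⁻ s, subNorm j (v₁ s) ^ 2 ∂ν + D * (2 * c) * ν Set.univ +
        η' * ∫⁻ s, subNorm j (v₁ s - v₂ s) ^ 2 ∂ν := by
        rw [lintegral_add_left' (((hm.pow_const 2).const_mul _).add_const _),
          lintegral_add_right _ measurable_const, lintegral_const,
          lintegral_const_mul' _ _ ENNReal.coe_ne_top,
          lintegral_const_mul'' _ (hm.pow_const 2)]
    _ ≤ D * η' * K + D * (2 * c) * ν Set.univ + η' * D := by gcongr
    _ = (((η' * (K + 1) : ℝ≥0) : ℝ≥0∞) + (2 * c) * ν Set.univ) * D := by push_cast; ring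
    _ = _ := by
      rw [hη', div_mul_cancel₀ _ (by positivity)]; push_cast; rfl

end PolyLipschitz

/-! ### Squares of sums -/

section ENNRealAux

lemma ennreal_add_sq_le (a b : ℝ≥0∞) : (a + b) ^ 2 ≤ 2 * a ^ 2 + 2 * b ^ 2 := by
  by_cases ha : a = ∞
  · simp [ha]
  by_cases hb : b = ∞
  · simp [hb]
  lift a to ℝ≥0 using ha
  lift b to ℝ≥0 using hb
  have : (a + b) ^ 2 ≤ 2 * a ^ 2 + 2 * b ^ 2 := by
    rw [← NNReal.coe_le_coe]
    push_cast
    nlinarith [sq_nonneg ((a : ℝ) - b)]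
  exact_mod_cast this

/-- The weights arise from splitting off the first summand again and again with `(a + b)² ≤ 2a² +
2b²`. They let squared norms of series be integrated termwise, and geometric decay of ratio `1 / 4`
beats them. -/
lemma ennreal_sum_sq_le (x : ℕ → ℝ≥0∞) (n : ℕ) :
    (∑ k ∈ Finset.range n, x k) ^ 2 ≤ ∑ k ∈ Finset.range n, 2 ^ (k + 1) * x k ^ 2 := by
  induction n generalizing x with
  | zero => simp
  | succ n ih =>
    rw [Finset.sum_range_succ', Finset.sum_range_succ']
    refine (ennreal_add_sq_le _ _).trans ?_
    refine add_le_add ?_ (by simp)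
    refine (mul_le_mul_right (ih fun k => x (k + 1)) 2).trans ?_
    rw [Finset.mul_sum]
    refine Finset.sum_le_sum fun k _ => ?_
    rw [← mul_assoc, ← pow_succ']

lemma ennreal_tsum_sq_le (x : ℕ → ℝ≥0∞) :
    (∑' k, x k) ^ 2 ≤ ∑' k, 2 ^ (k + 1) * x k ^ 2 := by
  have h : Tendsto (fun n => (∑ k ∈ Finset.range n, x k) ^ 2) atTop (𝓝 ((∑' k, x k) ^ 2)) :=
    ((ENNReal.continuous_pow 2).tendsto _).comp ENNReal.summable.hasSum.tendsto_sum_nat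
  exact le_of_tendsto' h fun n => (ennreal_sum_sq_le x n).trans (ENNReal.sum_le_tsum _)

end ENNRealAux

/-! ### Norms of paths -/

section Paths

variable {E V : Type*} [NormedAddCommGroup E] [NormedSpace ℝ E]
  [NormedAddCommGroup V] [NormedSpace ℝ V] {j : E →L[ℝ] V} {v w : ℝ≥0 → V} {s t T : ℝ≥0}

/-- The supremum of the norm of a path up to time `T`. -/
noncomputable def pathSup (T : ℝ≥0) (v : ℝ≥0 → V) : ℝ≥0∞ := ⨆ s ∈ Set.Iic T, ‖v s‖ₑ

/-- The energy `∫₀ᵀ |v(s)|_E² ds` of a path. -/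
noncomputable def pathEnergy (j : E →L[ℝ] V) (T : ℝ≥0) (v : ℝ≥0 → V) : ℝ≥0∞ :=
  ∫⁻ s in Set.Iic T, subNorm j (v s) ^ 2 ∂timeLeb

/-- A norm of paths up to time `T`, equivalent to the norm of `X_T`. -/
noncomputable def pathGauge (j : E →L[ℝ] V) (T : ℝ≥0) (v : ℝ≥0 → V) : ℝ≥0∞ :=
  pathSup T v + pathEnergy j T v ^ (1 / 2 : ℝ)

omit [NormedSpace ℝ V] in
lemma enorm_le_pathSup (hs : s ≤ T) : ‖v s‖ₑ ≤ pathSup T v :=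
  le_iSup₂ (f := fun s (_ : s ∈ Set.Iic T) => ‖v s‖ₑ) s hs

omit [NormedSpace ℝ V] in
lemma pathSup_le {c : ℝ≥0∞} (h : ∀ s ≤ T, ‖v s‖ₑ ≤ c) : pathSup T v ≤ c := iSup₂_le h

lemma xNormSq_eq : xNormSq j T v = pathSup T v ^ 2 + pathEnergy j T v := by
  unfold xNormSq pathEnergy
  congr 1
  refine le_antisymm (iSup₂_le fun s hs => by gcongr; exact enorm_le_pathSup hs) ?_
  set c := ⨆ s ∈ Set.Iic T, ‖v s‖ₑ ^ 2 with hc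
  have h : pathSup T v ≤ c ^ (1 / 2 : ℝ) := by
    refine pathSup_le fun s hs => ?_
    have h1 : ‖v s‖ₑ ^ 2 ≤ c := le_iSup₂ (f := fun s (_ : s ∈ Set.Iic T) => ‖v s‖ₑ ^ 2) s hs
    have h2 := ENNReal.rpow_le_rpow h1 (show (0 : ℝ) ≤ 1 / 2 by norm_num)
    rwa [← ENNReal.rpow_natCast, ← ENNReal.rpow_mul, Nat.cast_ofNat,
      mul_one_div_cancel (by norm_num), ENNReal.rpow_one] at h2
  calc _ ≤ (c ^ (1 / 2 : ℝ)) ^ 2 := by gcongr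
    _ = c := by
      rw [← ENNReal.rpow_natCast, ← ENNReal.rpow_mul, Nat.cast_ofNat,
        one_div_mul_cancel (by norm_num), ENNReal.rpow_one]

omit [NormedSpace ℝ V] in
lemma pathSup_mono (hst : s ≤ t) : pathSup s v ≤ pathSup t v :=
  pathSup_le fun _ hr => enorm_le_pathSup (hr.trans hst)

lemma pathEnergy_mono (hst : s ≤ t) : pathEnergy j s v ≤ pathEnergy j t v :=
  lintegral_mono_set (Set.Iic_subset_Iic.2 hst)

lemma xNormSq_mono (hst : s ≤ t) : xNormSq j s v ≤ xNormSq j t v := by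
  rw [xNormSq_eq, xNormSq_eq]
  gcongr
  exacts [pathSup_mono hst, pathEnergy_mono hst]

lemma pathGauge_mono (hst : s ≤ t) : pathGauge j s v ≤ pathGauge j t v := by
  unfold pathGauge
  gcongr
  exacts [pathSup_mono hst, pathEnergy_mono hst]

lemma sq_rpow_half (a : ℝ≥0∞) : (a ^ (1 / 2 : ℝ)) ^ 2 = a := by
  rw [← ENNReal.rpow_natCast, ← ENNReal.rpow_mul, Nat.cast_ofNat,
    one_div_mul_cancel (by norm_num), ENNReal.rpow_one]

lemma pathGauge_sq_le : pathGauge j T v ^ 2 ≤ 2 * xNormSq j T v := by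
  refine (ennreal_add_sq_le _ _).trans ?_
  rw [sq_rpow_half, ← mul_add, xNormSq_eq]

lemma xNormSq_le_pathGauge_sq : xNormSq j T v ≤ pathGauge j T v ^ 2 := by
  rw [xNormSq_eq, pathGauge, add_sq, sq_rpow_half]
  gcongr
  exact le_self_add

lemma xNormSq_congr (h : ∀ s ≤ T, v s = w s) : xNormSq j T v = xNormSq j T w := by
  unfold xNormSq
  congr 1
  · exact biSup_congr fun s hs => by rw [h s hs]
  · exact setLIntegral_congr_fun measurableSet_Iic fun s hs => by simp only [h s hs]

lemma pathGauge_congr (h : ∀ s ≤ T, v s = w s) : pathGauge j T v = pathGauge j T w := by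
  unfold pathGauge pathEnergy
  congr 1
  · unfold pathSup
    exact biSup_congr fun s hs => by rw [h s hs]
  · congr 1
    exact setLIntegral_congr_fun measurableSet_Iic fun s hs => by simp only [h s hs]

lemma enorm_sq_le_xNormSq (hs : s ≤ T) : ‖v s‖ₑ ^ 2 ≤ xNormSq j T v :=
  (le_iSup₂ (f := fun s (_ : s ∈ Set.Iic T) => ‖v s‖ₑ ^ 2) s hs).trans le_self_add

lemma pathEnergy_le_xNormSq : pathEnergy j T v ≤ xNormSq j T v := le_add_self

lemma xNormSq_neg (hj : Function.Injective j) : xNormSq j T (fun s => -v s) = xNormSq j T v := by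
  simp [xNormSq, subNorm_neg hj]

lemma eq_zero_of_xNormSq_eq_zero (h : xNormSq j T v = 0) : ∀ s ≤ T, v s = 0 := by
  intro s hs
  have := enorm_sq_le_xNormSq (j := j) (v := v) hs
  rw [h, nonpos_iff_eq_zero] at this
  simpa using this

section Measurability

variable [CompleteSpace E] [SecondCountableTopology E]

lemma aemeasurable_subNorm_comp {α : Type*} {m : MeasurableSpace α} {ν : Measure α}
    (hj : Function.Injective j) {f : α → V} (hf : AEStronglyMeasurable f ν) :
    AEMeasurable (fun s => subNorm j (f s)) ν := by
  borelize V
  exact (measurable_subNorm hj).comp_aemeasurable hf.aemeasurable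

lemma measurable_subNorm_comp {α : Type*} {m : MeasurableSpace α}
    (hj : Function.Injective j) {f : α → V} (hf : StronglyMeasurable f) :
    Measurable (fun s => subNorm j (f s)) := by
  borelize V
  exact (measurable_subNorm hj).comp hf.measurable

lemma pathEnergy_sub_le (hj : Function.Injective j)
    (hv : AEStronglyMeasurable v (timeLeb.restrict (Set.Iic T)))
    (hw : AEStronglyMeasurable w (timeLeb.restrict (Set.Iic T))) :
    pathEnergy j T v ^ (1 / 2 : ℝ) ≤
      pathEnergy j T w ^ (1 / 2 : ℝ) + pathEnergy j T (fun s => v s - w s) ^ (1 / 2 : ℝ) := by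
  have h := ENNReal.lintegral_Lp_add_le (aemeasurable_subNorm_comp hj hw)
    (aemeasurable_subNorm_comp hj (hv.sub hw)) (show (1 : ℝ) ≤ 2 by norm_num)
  simp only [Pi.add_apply, ENNReal.rpow_two, Pi.sub_apply] at h
  refine le_trans ?_ h
  unfold pathEnergy
  gcongr with s
  calc subNorm j (v s) = subNorm j (w s + (v s - w s)) := by rw [add_sub_cancel]
    _ ≤ _ := subNorm_add_le hj _ _

omit [NormedSpace ℝ V] in
lemma pathSup_sub_le : pathSup T v ≤ pathSup T w + pathSup T (fun s => v s - w s) := by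
  refine pathSup_le fun s hs => ?_
  calc ‖v s‖ₑ = ‖w s + (v s - w s)‖ₑ := by rw [add_sub_cancel]
    _ ≤ _ := enorm_add_le _ _
    _ ≤ _ := add_le_add (enorm_le_pathSup hs)
      (enorm_le_pathSup (v := fun s => v s - w s) hs)

/-- Minkowski's inequality gives the triangle inequality with constant one. It makes a cutoff of the
gauge Lipschitz, which is why the gauge is used beside `xNormSq`. -/
lemma pathGauge_le_add_sub (hj : Function.Injective j)
    (hv : AEStronglyMeasurable v (timeLeb.restrict (Set.Iic T)))
    (hw : AEStronglyMeasurable w (timeLeb.restrict (Set.Iic T))) :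
    pathGauge j T v ≤ pathGauge j T w + pathGauge j T (fun s => v s - w s) := by
  refine (add_le_add (pathSup_sub_le (w := w)) (pathEnergy_sub_le hj hv hw)).trans (le_of_eq ?_)
  unfold pathGauge
  ring

lemma xNormSq_add_le (hj : Function.Injective j)
    (hv : AEStronglyMeasurable v (timeLeb.restrict (Set.Iic T))) :
    xNormSq j T (fun s => v s + w s) ≤ 2 * xNormSq j T v + 2 * xNormSq j T w := by
  simp only [xNormSq_eq]
  have h1 : pathSup T (fun s => v s + w s) ^ 2 ≤ 2 * pathSup T v ^ 2 + 2 * pathSup T w ^ 2 := by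
    refine le_trans ?_ (ennreal_add_sq_le _ _)
    gcongr
    exact pathSup_le fun s hs => (enorm_add_le _ _).trans
      (add_le_add (enorm_le_pathSup hs) (enorm_le_pathSup hs))
  have h2 : pathEnergy j T (fun s => v s + w s) ≤
      2 * pathEnergy j T v + 2 * pathEnergy j T w := by
    unfold pathEnergy
    rw [← lintegral_const_mul' _ _ (by simp), ← lintegral_const_mul' _ _ (by simp),
      ← lintegral_add_left' (((aemeasurable_subNorm_comp hj hv).pow_const 2).const_mul _)]
    exact lintegral_mono fun s => (pow_le_pow_left₀ zero_le (subNorm_add_le hj _ _) 2).trans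
      (ennreal_add_sq_le _ _)
  calc _ ≤ _ := add_le_add h1 h2
    _ = _ := by ring

lemma xNormSq_sub_le (hj : Function.Injective j)
    (hv : AEStronglyMeasurable v (timeLeb.restrict (Set.Iic T))) :
    xNormSq j T (fun s => v s - w s) ≤ 2 * xNormSq j T v + 2 * xNormSq j T w := by
  rw [← xNormSq_neg (v := w) hj]
  simp_rw [sub_eq_add_neg]
  exact xNormSq_add_le hj hv

lemma xNormSq_le_tsum (hj : Function.Injective j) {w : ℕ → ℝ≥0 → V}
    (hw : ∀ k, AEStronglyMeasurable (w k) (timeLeb.restrict (Set.Iic T)))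
    (hsum : ∀ s ≤ T, HasSum (fun k => w k s) (v s)) :
    xNormSq j T v ≤ ∑' k, 2 ^ (k + 1) * xNormSq j T (w k) := by
  simp only [xNormSq_eq, mul_add]
  rw [ENNReal.tsum_add]
  refine add_le_add ?_ ?_
  · refine le_trans ?_ (ennreal_tsum_sq_le _)
    gcongr
    refine pathSup_le fun s hs => ?_
    rw [← (hsum s hs).tsum_eq]
    refine enorm_tsum_le_tsum_enorm.trans (ENNReal.tsum_le_tsum fun k => ?_)
    exact enorm_le_pathSup hs
  · unfold pathEnergy
    calc _ ≤ ∫⁻ s in Set.Iic T, ∑' k, 2 ^ (k + 1) * subNorm j (w k s) ^ 2 ∂timeLeb := by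
          refine setLIntegral_mono' measurableSet_Iic fun s hs => ?_
          refine le_trans ?_ (ennreal_tsum_sq_le _)
          gcongr
          exact subNorm_le_tsum hj (hsum s hs)
      _ = _ := by
        rw [lintegral_tsum fun k =>
          (((aemeasurable_subNorm_comp hj (hw k)).pow_const 2).const_mul _)]
        congr 1
        ext k
        rw [lintegral_const_mul' _ _ (by simp)]

end Measurability

section Continuity

omit [NormedSpace ℝ V] in
-- Values at dense times just to the right of `s` approximate the value at `s`, and clipping at `T`
-- supplies the end point. Continuity from the right is enough, so this also covers processes that
-- are killed at a random time.
lemma pathSup_eq_iSup_denseSeq (hv : ∀ s, ContinuousWithinAt v (Set.Ici s) s) :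
    pathSup T v = ⨆ n, ‖v (min (TopologicalSpace.denseSeq ℝ≥0 n) T)‖ₑ := by
  refine le_antisymm (pathSup_le fun s hs => ?_) (iSup_le fun n => enorm_le_pathSup inf_le_right)
  refine le_of_forall_lt fun c hc => ?_
  have hd := TopologicalSpace.denseRange_denseSeq ℝ≥0
  rcases hs.lt_or_eq with hs | rfl
  · have h1 : ∀ᶠ r in 𝓝[≥] s, c < ‖v r‖ₑ := (hv s).enorm.eventually_const_lt hc
    obtain ⟨u, hu, hsub⟩ := mem_nhdsGE_iff_exists_Ico_subset.1 h1
    have hne : (Set.Ioo s (min u T)).Nonempty := Set.nonempty_Ioo.2 (lt_min hu hs)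
    obtain ⟨n, hn⟩ := hd.exists_mem_open isOpen_Ioo hne
    refine lt_of_lt_of_le ?_ (le_iSup _ n)
    have h2 := hn.2.trans_le (min_le_right _ _)
    rw [min_eq_left h2.le]
    exact hsub ⟨hn.1.le, hn.2.trans_le (min_le_left _ _)⟩
  · obtain ⟨n, hn⟩ := hd.exists_mem_open isOpen_Ioi (show (Set.Ioi s).Nonempty from ⟨s + 1, by simp⟩)
    refine lt_of_lt_of_le ?_ (le_iSup _ n)
    rwa [min_eq_right (le_of_lt hn)]

omit [NormedSpace ℝ V] in
lemma continuous_pathSup (hv : Continuous v) : Continuous fun t => pathSup t v := by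
  -- After rescaling time, the supremum runs over the fixed compact interval `[0, 1]`, where
  -- continuity in the parameter `t` is preserved.
  have h := (isCompact_Icc (a := (0 : ℝ≥0)) (b := 1)).continuous_sSup
    (f := fun (t : ℝ≥0) (r : ℝ≥0) => ‖v (r * t)‖ₑ) (by
      change Continuous fun p : ℝ≥0 × ℝ≥0 => ‖v (p.2 * p.1)‖ₑ
      fun_prop)
  refine h.congr fun t => ?_
  rw [sSup_image]
  refine le_antisymm (iSup₂_le fun r hr => enorm_le_pathSup ?_) (pathSup_le fun s hs => ?_)
  · exact mul_le_of_le_one_left zero_le hr.2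
  · rcases eq_or_ne t 0 with rfl | ht
    · have : s = 0 := nonpos_iff_eq_zero.1 hs
      subst this
      exact le_iSup₂_of_le (0 : ℝ≥0) (by simp) (by simp)
    · refine le_iSup₂_of_le (s / t) ⟨zero_le, div_le_one_of_le₀ hs zero_le⟩ ?_
      rw [div_mul_cancel₀ _ ht]

/-- Dominated convergence, with no mass at single times. Freezing at `T` provides the integrable
majorant. -/
lemma continuous_pathEnergy [CompleteSpace E] [SecondCountableTopology E]
    (hj : Function.Injective j) (hv : Continuous v) (hfin : pathEnergy j T v < ∞) :
    Continuous fun t => pathEnergy j (min t T) v := by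
  have h0 : ∀ t, pathEnergy j (min t T) v =
      ∫⁻ s in Set.Iic T, (Set.Iic t).indicator (fun s => subNorm j (v s) ^ 2) s ∂timeLeb := by
    intro t
    rw [lintegral_indicator measurableSet_Iic, Measure.restrict_restrict measurableSet_Iic,
      Set.Iic_inter_Iic]
    rfl
  simp_rw [h0]
  have hm : Measurable fun s => subNorm j (v s) ^ 2 :=
    (measurable_subNorm_comp hj hv.stronglyMeasurable).pow_const 2
  refine continuous_iff_continuousAt.2 fun t => ?_
  refine tendsto_lintegral_filter_of_dominated_convergence (fun s => subNorm j (v s) ^ 2)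
    (Eventually.of_forall fun t => hm.indicator measurableSet_Iic)
    (Eventually.of_forall fun t => ae_of_all _ fun s => Set.indicator_le_self _ _ _) hfin.ne ?_
  have hne : ∀ᵐ s ∂(timeLeb.restrict (Set.Iic T)), s ≠ t :=
    ae_restrict_of_ae (by simp [ae_iff])
  filter_upwards [hne] with s hs
  refine tendsto_const_nhds.congr' ?_
  rcases lt_or_gt_of_ne hs with h | h
  · filter_upwards [lt_mem_nhds h] with r hr
    rw [Set.indicator_of_mem (Set.mem_Iic.2 h.le), Set.indicator_of_mem (Set.mem_Iic.2 hr.le)]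
  · filter_upwards [gt_mem_nhds h] with r hr
    rw [Set.indicator_of_notMem (by simpa using h), Set.indicator_of_notMem (by simpa using hr)]

lemma continuous_pathGauge [CompleteSpace E] [SecondCountableTopology E]
    (hj : Function.Injective j) (hv : Continuous v) (hfin : pathEnergy j T v < ∞) :
    Continuous fun t => pathGauge j (min t T) v :=
  ((continuous_pathSup hv).comp (continuous_id.min continuous_const)).add
    (ENNReal.continuous_rpow_const.comp (continuous_pathEnergy hj hv hfin))

lemma pathGauge_zero : pathGauge j 0 v = ‖v 0‖ₑ := by
  have h1 : pathSup 0 v = ‖v 0‖ₑ := by simp [pathSup]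
  have h2 : pathEnergy j 0 v = 0 := by
    unfold pathEnergy
    rw [Measure.restrict_eq_zero.2 (by simp [timeLeb_Iic]), lintegral_zero_measure]
  rw [pathGauge, h1, h2]
  simp

end Continuity

end Paths

/-! ### Cutoff nonlinearities along a path -/

section Truncation

/-- The supremum of `A` need not belong to `A`, so the bound there is reached by monotone
convergence from the left. It is used for sets of times where a gauge is bounded. -/
lemma setLIntegral_le_of_forall_Iic {f : ℝ≥0 → ℝ≥0∞} {A : Set ℝ≥0} {K : ℝ≥0∞}
    (hA : BddAbove A) (h : ∀ s ∈ A, ∫⁻ r in Set.Iic s, f r ∂timeLeb ≤ K) :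
    ∫⁻ r in A, f r ∂timeLeb ≤ K := by
  rcases A.eq_empty_or_nonempty with rfl | hne
  · simp
  have hlub := isLUB_csSup hne hA
  set b := sSup A
  refine (lintegral_mono_set (show A ⊆ Set.Iic b from fun s hs => hlub.1 hs)).trans ?_
  by_cases hb : b ∈ A
  · exact h b hb
  rw [setLIntegral_congr Iio_ae_eq_Iic.symm]
  have hb0 : 0 < b := by
    obtain ⟨s, hs⟩ := hne
    exact lt_of_le_of_lt zero_le ((hlub.1 hs).lt_of_ne fun h => hb (h ▸ hs))
  obtain ⟨u, hu, hub, hlim⟩ := exists_seq_strictMono_tendsto' hb0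
  have hU : Set.Iio b = ⋃ n, Set.Iic (u n) := by
    ext s
    simp only [Set.mem_Iio, Set.mem_iUnion, Set.mem_Iic]
    constructor
    · intro hs
      obtain ⟨n, hn⟩ := (hlim.eventually (lt_mem_nhds hs)).exists
      exact ⟨n, hn.le⟩
    · rintro ⟨n, hn⟩
      exact hn.trans_lt (hub n).2
  rw [hU, setLIntegral_iUnion_of_directed _ (Monotone.directed_le fun m n hmn =>
    Set.Iic_subset_Iic.2 (hu.monotone hmn))]
  refine iSup_le fun n => ?_
  obtain ⟨s, hs, hus⟩ := (lt_isLUB_iff hlub).1 (hub n).2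
  exact (lintegral_mono_set (Set.Iic_subset_Iic.2 hus.le)).trans (h s hs)

/-- A Lipschitz cutoff: `1` up to the level `M`, and `0` from the level `M + 1` on. -/
noncomputable def cutoff (M : ℝ≥0) (a : ℝ≥0∞) : ℝ := (min 1 (M + 1 - a)).toReal

lemma cutoff_of_le {M : ℝ≥0} {a : ℝ≥0∞} (h : a ≤ M) : cutoff M a = 1 := by
  have h1 : (1 : ℝ≥0∞) ≤ M + 1 - a := by
    refine ENNReal.le_sub_of_add_le_left (h.trans_lt ENNReal.coe_lt_top).ne ?_
    gcongr
  rw [cutoff, min_eq_left h1, ENNReal.toReal_one]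

lemma cutoff_of_ge {M : ℝ≥0} {a : ℝ≥0∞} (h : M + 1 ≤ a) : cutoff M a = 0 := by
  rw [cutoff, tsub_eq_zero_of_le h]; simp

lemma cutoff_nonneg (M : ℝ≥0) (a : ℝ≥0∞) : 0 ≤ cutoff M a := ENNReal.toReal_nonneg

lemma enorm_cutoff_le_one (M : ℝ≥0) (a : ℝ≥0∞) : ‖cutoff M a‖ₑ ≤ 1 := by
  rw [Real.enorm_of_nonneg (cutoff_nonneg M a), cutoff,
    ENNReal.ofReal_toReal ((min_le_left _ _).trans_lt ENNReal.one_lt_top).ne]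
  exact min_le_left _ _

lemma measurable_cutoff (M : ℝ≥0) : Measurable (cutoff M) :=
  (measurable_const.min (measurable_const.sub measurable_id)).ennreal_toReal

/-- The two hypotheses replace a bound for `a - b`, which is meaningless when both values are
infinite. -/
lemma enorm_cutoff_sub_le {M : ℝ≥0} {a b d : ℝ≥0∞} (hab : a ≤ b + d) (hba : b ≤ a + d) :
    ‖cutoff M a - cutoff M b‖ₑ ≤ d := by
  by_cases hd : d = ∞
  · simp [hd]
  have key : ∀ {a b : ℝ≥0∞}, a ≤ b + d → cutoff M b ≤ cutoff M a + d.toReal := by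
    intro a b hab
    have hfin : ∀ c : ℝ≥0∞, min 1 ((M : ℝ≥0∞) + 1 - c) ≠ ∞ := fun c =>
      ((min_le_left _ _).trans_lt ENNReal.one_lt_top).ne
    rw [cutoff, cutoff, ← ENNReal.toReal_add (hfin _) hd]
    refine ENNReal.toReal_mono (ENNReal.add_ne_top.2 ⟨hfin _, hd⟩) ?_
    rw [min_add]
    refine le_min ((min_le_left _ _).trans le_self_add) ((min_le_right _ _).trans ?_)
    rw [tsub_le_iff_right]
    calc (M : ℝ≥0∞) + 1 ≤ (M + 1 - a) + a := le_tsub_add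
      _ ≤ (M + 1 - a) + (b + d) := by gcongr
      _ = _ := by ring
  rw [← ofReal_norm, Real.norm_eq_abs]
  refine ENNReal.ofReal_le_of_le_toReal (abs_le.2 ⟨?_, ?_⟩)
  · linarith [key hab]
  · linarith [key hba]

variable {E V Y : Type*} [NormedAddCommGroup E] [NormedSpace ℝ E]
  [NormedAddCommGroup V] [NormedSpace ℝ V] [NormedAddCommGroup Y] [NormedSpace ℝ Y]
  {j : E →L[ℝ] V} {F : E → Y} {v v₁ v₂ : ℝ≥0 → V} {T : ℝ≥0}

/-- The nonlinearity `F` along the path `v`, cut off when the norm of the path exceeds `M`. -/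
noncomputable def truncMap (j : E →L[ℝ] V) (F : E → Y) (M : ℝ≥0) (v : ℝ≥0 → V) (s : ℝ≥0) : Y :=
  cutoff M (pathGauge j s v) • Function.extend j F 0 (v s)

lemma truncMap_of_ge {M : ℝ≥0} {s : ℝ≥0} (h : M + 1 ≤ pathGauge j s v) :
    truncMap j F M v s = 0 := by
  rw [truncMap, cutoff_of_ge h, zero_smul]

lemma truncMap_of_le {M : ℝ≥0} {s : ℝ≥0} (h : pathGauge j s v ≤ M) :
    truncMap j F M v s = Function.extend j F 0 (v s) := by
  rw [truncMap, cutoff_of_le h, one_smul]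

lemma enorm_le_pathGauge (s : ℝ≥0) : ‖v s‖ₑ ≤ pathGauge j s v :=
  (enorm_le_pathSup le_rfl).trans le_self_add

lemma pathEnergy_le_pathGauge_sq : pathEnergy j T v ≤ pathGauge j T v ^ 2 :=
  pathEnergy_le_xNormSq.trans xNormSq_le_pathGauge_sq

lemma pathGauge_sub_comm (hj : Function.Injective j) :
    pathGauge j T (fun s => v₁ s - v₂ s) = pathGauge j T (fun s => v₂ s - v₁ s) := by
  have h1 : ∀ s, ‖v₁ s - v₂ s‖ₑ = ‖v₂ s - v₁ s‖ₑ := fun s => by rw [← enorm_neg, neg_sub]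
  have h2 : ∀ s, subNorm j (v₁ s - v₂ s) = subNorm j (v₂ s - v₁ s) := fun s => by
    rw [← subNorm_neg hj, neg_sub]
  simp only [pathGauge, pathSup, pathEnergy, h1, h2]

omit [NormedSpace ℝ Y] in
lemma extend_zero (hj : Function.Injective j) (hF : IsPolyLipschitz j F) :
    Function.extend j F 0 0 = 0 := by
  have := hj.extend_apply F 0 0
  rwa [map_zero, hF.1] at this

lemma ae_subNorm_lt_top [CompleteSpace E] [SecondCountableTopology E] (hj : Function.Injective j)
    (hv : AEStronglyMeasurable v (timeLeb.restrict (Set.Iic T))) (h : pathEnergy j T v < ∞) :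
    ∀ᵐ s ∂(timeLeb.restrict (Set.Iic T)), subNorm j (v s) < ∞ := by
  filter_upwards [ae_lt_top' ((aemeasurable_subNorm_comp hj hv).pow_const 2) h.ne] with s hs
  by_contra h1
  rw [not_lt, top_le_iff] at h1
  simp [h1] at hs

omit [NormedSpace ℝ Y] in
/-- The square integral of the nonlinearity over times where the norm of the path is bounded. -/
lemma IsPolyLipschitz.lintegral_extend_le (hF : IsPolyLipschitz j F) (hj : Function.Injective j)
    (K : ℝ≥0) (hK : 1 ≤ K) {η : ℝ≥0} (hη : 0 < η) :
    ∃ c : ℝ≥0, ∀ (v : ℝ≥0 → V) (B : Set ℝ≥0), MeasurableSet B → BddAbove B →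
      AEMeasurable (fun s => subNorm j (v s)) (timeLeb.restrict B) →
      (∀ s ∈ B, pathGauge j s v ≤ K) → (∀ᵐ s ∂(timeLeb.restrict B), subNorm j (v s) < ∞) →
      ∫⁻ s in B, ‖Function.extend j F 0 (v s)‖ₑ ^ 2 ∂timeLeb ≤ η + c * timeLeb B := by
  -- The path is compared with the zero path, where `F` vanishes. The energy and the squared
  -- supremum of the difference are at most `D = K ^ 2`, hence the division of `η`.
  obtain ⟨c, hc⟩ := hF.lintegral_sub_le hj (K ^ 2) (η := η / K ^ 2) (by positivity)
  refine ⟨c * K ^ 2, fun v B hB hBb hm hg hfin => ?_⟩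
  have hen : ∫⁻ s in B, subNorm j (v s) ^ 2 ∂timeLeb ≤ ((K ^ 2 : ℝ≥0) : ℝ≥0∞) := by
    refine setLIntegral_le_of_forall_Iic hBb fun s hs => ?_
    refine (pathEnergy_le_pathGauge_sq (j := j) (v := v)).trans ?_
    push_cast
    gcongr
    exact hg s hs
  have := hc (timeLeb.restrict B) v (fun _ => 0) ((K ^ 2 : ℝ≥0) : ℝ≥0∞) hm ?_ hen (by simpa using hen)
  · rw [Measure.restrict_apply_univ] at this
    simp only [extend_zero hj hF, sub_zero] at this
    refine this.trans (le_of_eq ?_)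
    rw [add_mul, ← ENNReal.coe_mul, div_mul_cancel₀ _ (by positivity)]
    push_cast
    ring
  · filter_upwards [hfin, ae_restrict_mem hB] with s h1 h2
    have h3 := (enorm_le_pathGauge (j := j) (v := v) s).trans (hg s h2)
    have hKK : (K : ℝ≥0∞) ≤ ((K ^ 2 : ℝ≥0) : ℝ≥0∞) := by
      exact_mod_cast le_self_pow₀ hK (by norm_num)
    refine ⟨h3.trans hKK, by simp, h1, by simp [subNorm_zero], ?_⟩
    rw [sub_zero]
    push_cast
    gcongr

variable [CompleteSpace E] [SecondCountableTopology E]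

omit [NormedSpace ℝ Y] in
lemma stronglyMeasurable_extend_comp [SecondCountableTopology Y] (hj : Function.Injective j)
    (hF : IsPolyLipschitz j F) {α : Type*} {m : MeasurableSpace α} {f : α → V}
    (hf : StronglyMeasurable f) : StronglyMeasurable fun a => Function.extend j F 0 (f a) := by
  borelize E V Y
  exact (((measurableEmbedding_of_injective hj).measurable_extend hF.continuous.measurable
    measurable_const).comp hf.measurable).stronglyMeasurable

/-- The truncated nonlinearity is bounded in `L²` over short times. -/
lemma IsPolyLipschitz.lintegral_truncMap_le (hF : IsPolyLipschitz j F) (hj : Function.Injective j)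
    (M : ℝ≥0) {η : ℝ≥0} (hη : 0 < η) :
    ∃ c : ℝ≥0, ∀ (T : ℝ≥0) (v : ℝ≥0 → V) (B : Set ℝ≥0), Continuous v → xNormSq j T v < ∞ →
      MeasurableSet B → B ⊆ Set.Iic T →
      ∫⁻ s in B, ‖truncMap j F M v s‖ₑ ^ 2 ∂timeLeb ≤ η + c * timeLeb B := by
  obtain ⟨c, hc⟩ := hF.lintegral_extend_le hj (M + 1) (by simp) hη
  refine ⟨c, fun T v B hv hfin hB hBT => ?_⟩
  have hmono : Monotone fun s => pathGauge j s v := fun s t hst => pathGauge_mono hst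
  -- Only times with gauge at most `M + 1` contribute; beyond this level the cutoff is zero.
  set A : Set ℝ≥0 := {s | pathGauge j s v ≤ ((M + 1 : ℝ≥0) : ℝ≥0∞)} with hA
  have hAm : MeasurableSet A := measurableSet_le hmono.measurable measurable_const
  have hsub : B ∩ A ⊆ Set.Iic T := Set.inter_subset_left.trans hBT
  have h := hc v (B ∩ A) (hB.inter hAm) (bddAbove_Iic.mono hsub)
    (aemeasurable_subNorm_comp hj hv.aestronglyMeasurable) (fun s hs => hs.2)
    (ae_restrict_of_ae_restrict_of_subset hsub (ae_subNorm_lt_top hj hv.aestronglyMeasurable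
      (pathEnergy_le_xNormSq.trans_lt hfin)))
  refine le_trans ?_ (h.trans (by gcongr; exact Set.inter_subset_left))
  rw [← lintegral_indicator hB, ← lintegral_indicator (hB.inter hAm)]
  refine lintegral_mono fun s => ?_
  by_cases hsB : s ∈ B
  · by_cases hsA : s ∈ A
    · rw [Set.indicator_of_mem hsB, Set.indicator_of_mem (Set.mem_inter hsB hsA), truncMap, enorm_smul]
      refine pow_le_pow_left₀ zero_le ?_ 2
      exact mul_le_of_le_one_left zero_le (enorm_cutoff_le_one _ _)
    · have h1 : ((M + 1 : ℝ≥0) : ℝ≥0∞) ≤ pathGauge j s v := (not_le.1 hsA).le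
      rw [Set.indicator_of_mem hsB, truncMap_of_ge (by exact_mod_cast h1)]
      simp
  · rw [Set.indicator_of_notMem hsB]; exact zero_le

lemma enorm_smul_sub_smul_sq_le (a b : ℝ) (x y : Y) (hb : ‖b‖ₑ ≤ 1) :
    ‖a • x - b • y‖ₑ ^ 2 ≤ 2 * (‖a - b‖ₑ ^ 2 * ‖x‖ₑ ^ 2) + 2 * ‖x - y‖ₑ ^ 2 := by
  have : a • x - b • y = (a - b) • x + b • (x - y) := by
    rw [sub_smul, smul_sub]; abel
  rw [this]
  refine (enorm_add_sq_le _ _).trans ?_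
  rw [enorm_smul, enorm_smul, mul_pow, mul_pow]
  gcongr
  exact mul_le_of_le_one_left zero_le (pow_le_one₀ zero_le hb)

/-- The truncated nonlinearity is a contraction over short times. -/
lemma IsPolyLipschitz.lintegral_truncMap_sub_le [SecondCountableTopology Y] (hF : IsPolyLipschitz j F)
    (hj : Function.Injective j) (M : ℝ≥0) {η : ℝ≥0} (hη : 0 < η) :
    ∃ c : ℝ≥0, ∀ (T : ℝ≥0) (v₁ v₂ : ℝ≥0 → V) (B : Set ℝ≥0), Continuous v₁ → Continuous v₂ →
      xNormSq j T v₁ < ∞ → xNormSq j T v₂ < ∞ → MeasurableSet B → B ⊆ Set.Iic T →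
      ∫⁻ s in B, ‖truncMap j F M v₁ s - truncMap j F M v₂ s‖ₑ ^ 2 ∂timeLeb ≤
        (η + c * timeLeb B) * xNormSq j T (fun s => v₁ s - v₂ s) := by
  -- The final sum has `4 + 4 + 2 = 10` parts: the difference of the cutoffs, with square at most `d
  -- ^ 2 ≤ 2 * X`, against the nonlinearity along each of the two paths, and the difference of the
  -- nonlinearities. The same count gives `8 * c₁ + 2 * c₂`.
  obtain ⟨c₁, hc₁⟩ := hF.lintegral_extend_le hj (M + 1) (by simp) (η := η / 10) (by positivity)
  obtain ⟨c₂, hc₂⟩ := hF.lintegral_sub_le hj ((M + 1) ^ 2) (η := η / 10) (by positivity)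
  refine ⟨8 * c₁ + 2 * c₂, fun T v₁ v₂ B hv₁ hv₂ hfin₁ hfin₂ hB hBT => ?_⟩
  set X := xNormSq j T (fun s => v₁ s - v₂ s) with hX
  set d := pathGauge j T (fun s => v₁ s - v₂ s) with hd
  have hdX : d ^ 2 ≤ 2 * X := pathGauge_sq_le
  set A : (ℝ≥0 → V) → Set ℝ≥0 := fun v => {s | pathGauge j s v ≤ ((M + 1 : ℝ≥0) : ℝ≥0∞)} with hA
  have hAm : ∀ v, MeasurableSet (A v) := fun v =>
    measurableSet_le (Monotone.measurable fun s t hst => pathGauge_mono hst) measurable_const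
  have hsub : ∀ v, B ∩ A v ⊆ Set.Iic T := fun v => Set.inter_subset_left.trans hBT
  have hlt : ∀ v, Continuous v → xNormSq j T v < ∞ →
      ∀ᵐ s ∂(timeLeb.restrict (Set.Iic T)), subNorm j (v s) < ∞ := fun v hv hfin =>
    ae_subNorm_lt_top hj hv.aestronglyMeasurable (pathEnergy_le_xNormSq.trans_lt hfin)
  have hsingle : ∀ v, Continuous v → xNormSq j T v < ∞ →
      ∫⁻ s in B ∩ A v, ‖Function.extend j F 0 (v s)‖ₑ ^ 2 ∂timeLeb ≤
        ((η / 10 : ℝ≥0) : ℝ≥0∞) + c₁ * timeLeb B := fun v hv hfin =>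
    (hc₁ v (B ∩ A v) (hB.inter (hAm v)) (bddAbove_Iic.mono (hsub v))
      (aemeasurable_subNorm_comp hj hv.aestronglyMeasurable) (fun s hs => hs.2)
      (ae_restrict_of_ae_restrict_of_subset (hsub v) (hlt v hv hfin))).trans
      (by gcongr; exact Set.inter_subset_left)
  have hsub12 : B ∩ A v₁ ∩ A v₂ ⊆ Set.Iic T := Set.inter_subset_left.trans (hsub v₁)
  have hm12 : MeasurableSet (B ∩ A v₁ ∩ A v₂) := (hB.inter (hAm v₁)).inter (hAm v₂)
  have hKK : ((M + 1 : ℝ≥0) : ℝ≥0∞) ≤ (((M + 1) ^ 2 : ℝ≥0) : ℝ≥0∞) := by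
    exact_mod_cast le_self_pow₀ (show 1 ≤ M + 1 by simp) two_ne_zero
  have hdiff : ∫⁻ s in B ∩ A v₁ ∩ A v₂,
      ‖Function.extend j F 0 (v₁ s) - Function.extend j F 0 (v₂ s)‖ₑ ^ 2 ∂timeLeb ≤
        (((η / 10 : ℝ≥0) : ℝ≥0∞) + c₂ * timeLeb B) * X := by
    have := hc₂ (timeLeb.restrict (B ∩ A v₁ ∩ A v₂)) v₁ v₂ X
      (aemeasurable_subNorm_comp hj hv₁.aestronglyMeasurable) ?_ ?_ ?_
    · rw [Measure.restrict_apply_univ] at this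
      refine this.trans ?_
      gcongr
      exact Set.inter_subset_left.trans Set.inter_subset_left
    · filter_upwards [ae_restrict_of_ae_restrict_of_subset hsub12 (hlt v₁ hv₁ hfin₁),
        ae_restrict_of_ae_restrict_of_subset hsub12 (hlt v₂ hv₂ hfin₂),
        ae_restrict_mem hm12] with s h1 h2 h3
      exact ⟨((enorm_le_pathGauge s).trans h3.1.2).trans hKK,
        ((enorm_le_pathGauge s).trans h3.2).trans hKK, h1, h2,
        enorm_sq_le_xNormSq (v := fun s => v₁ s - v₂ s) (hsub12 h3)⟩
    · refine setLIntegral_le_of_forall_Iic (bddAbove_Iic.mono hsub12) fun s hs => ?_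
      refine (pathEnergy_le_pathGauge_sq (j := j) (v := v₁)).trans ?_
      push_cast
      gcongr
      have := hs.1.2
      simp only [hA] at this
      exact_mod_cast this
    · exact (lintegral_mono_set hsub12).trans
        (pathEnergy_le_xNormSq (j := j) (v := fun s => v₁ s - v₂ s))
  -- If only one gauge is at most `M + 1`, the other truncated value is zero and the remaining
  -- cutoff equals the difference of the cutoffs, which is at most `d`. Thus the difference of the
  -- nonlinearities is needed only where both gauges are bounded.
  have hpt : ∀ s, B.indicator (fun s => ‖truncMap j F M v₁ s - truncMap j F M v₂ s‖ₑ ^ 2) s ≤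
      2 * d ^ 2 * (B ∩ A v₁).indicator (fun s => ‖Function.extend j F 0 (v₁ s)‖ₑ ^ 2) s +
      2 * d ^ 2 * (B ∩ A v₂).indicator (fun s => ‖Function.extend j F 0 (v₂ s)‖ₑ ^ 2) s +
      2 * (B ∩ A v₁ ∩ A v₂).indicator (fun s =>
        ‖Function.extend j F 0 (v₁ s) - Function.extend j F 0 (v₂ s)‖ₑ ^ 2) s := by
    intro s
    by_cases hsB : s ∈ B
    swap
    · rw [Set.indicator_of_notMem hsB]; exact zero_le
    have hsT : s ≤ T := hBT hsB
    have hg : ∀ v w : ℝ≥0 → V, Continuous v → Continuous w →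
        pathGauge j s v ≤ pathGauge j s w + pathGauge j T (fun s => v s - w s) := fun v w hv hw =>
      (pathGauge_le_add_sub hj hv.aestronglyMeasurable hw.aestronglyMeasurable).trans
        (by gcongr; exact pathGauge_mono hsT)
    have hg' := hg v₂ v₁ hv₂ hv₁
    rw [pathGauge_sub_comm hj] at hg'
    have hcut : ‖cutoff M (pathGauge j s v₁) - cutoff M (pathGauge j s v₂)‖ₑ ^ 2 ≤ d ^ 2 := by
      gcongr
      exact enorm_cutoff_sub_le (hg v₁ v₂ hv₁ hv₂) hg'
    have hmul : ∀ a : ℝ≥0∞, a ≤ 2 * a := fun a => by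
      rw [two_mul]; exact le_self_add
    have hge : ∀ v : ℝ≥0 → V, s ∉ A v → (M : ℝ≥0∞) + 1 ≤ pathGauge j s v := fun v hs => by
      have : ((M + 1 : ℝ≥0) : ℝ≥0∞) ≤ pathGauge j s v := (not_le.1 hs).le
      exact_mod_cast this
    rw [Set.indicator_of_mem hsB]
    by_cases h1 : s ∈ A v₁ <;> by_cases h2 : s ∈ A v₂
    · rw [Set.indicator_of_mem (Set.mem_inter hsB h1),
        Set.indicator_of_mem (Set.mem_inter (Set.mem_inter hsB h1) h2)]
      refine (enorm_smul_sub_smul_sq_le _ _ _ _ (enorm_cutoff_le_one _ _)).trans ?_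
      rw [← mul_assoc, add_right_comm]
      refine le_trans ?_ le_self_add
      gcongr
    · rw [Set.indicator_of_mem (Set.mem_inter hsB h1), truncMap_of_ge (hge v₂ h2), sub_zero, truncMap,
        enorm_smul, mul_pow]
      rw [cutoff_of_ge (hge v₂ h2), sub_zero] at hcut
      refine le_trans ?_ (le_self_add.trans le_self_add)
      rw [mul_assoc]
      exact (mul_le_mul_left hcut _).trans (hmul _)
    · rw [Set.indicator_of_mem (Set.mem_inter hsB h2), truncMap_of_ge (hge v₁ h1), zero_sub, enorm_neg, truncMap,
        enorm_smul, mul_pow]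
      rw [cutoff_of_ge (hge v₁ h1), zero_sub, enorm_neg] at hcut
      refine le_trans ?_ (le_add_self.trans le_self_add)
      rw [mul_assoc]
      exact (mul_le_mul_left hcut _).trans (hmul _)
    · rw [truncMap_of_ge (hge v₁ h1), truncMap_of_ge (hge v₂ h2)]
      simp
  have hmeas : ∀ v, Continuous v → Measurable ((B ∩ A v).indicator
      fun s => ‖Function.extend j F 0 (v s)‖ₑ ^ 2) := fun v hv =>
    ((stronglyMeasurable_extend_comp hj hF hv.stronglyMeasurable).enorm.pow_const 2).indicator
      (hB.inter (hAm v))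
  rw [← lintegral_indicator hB]
  refine (lintegral_mono hpt).trans ?_
  rw [lintegral_add_left (((hmeas v₁ hv₁).const_mul _).fun_add ((hmeas v₂ hv₂).const_mul _)),
    lintegral_add_left ((hmeas v₁ hv₁).const_mul _), lintegral_const_mul _ (hmeas v₁ hv₁),
    lintegral_const_mul _ (hmeas v₂ hv₂), lintegral_const_mul' _ _ (by simp),
    lintegral_indicator (hB.inter (hAm v₁)), lintegral_indicator (hB.inter (hAm v₂)),
    lintegral_indicator hm12]
  calc _ ≤ 2 * (2 * X) * (((η / 10 : ℝ≥0) : ℝ≥0∞) + c₁ * timeLeb B) +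
        2 * (2 * X) * (((η / 10 : ℝ≥0) : ℝ≥0∞) + c₁ * timeLeb B) +
        2 * ((((η / 10 : ℝ≥0) : ℝ≥0∞) + c₂ * timeLeb B) * X) := by
        gcongr
        exacts [hsingle v₁ hv₁ hfin₁, hsingle v₂ hv₂ hfin₂]
    _ = (((η / 10 * 10 : ℝ≥0) : ℝ≥0∞) + (8 * c₁ + 2 * c₂) * timeLeb B) * X := by
        push_cast; ring
    _ = _ := by
        rw [div_mul_cancel₀ _ (by norm_num)]; push_cast; rfl

end Truncation

/-! ### Strongly continuous semigroups -/

section Semigroup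

variable {H : Type*} [NormedAddCommGroup H] [NormedSpace ℝ H] [CompleteSpace H]
  {S : ℝ≥0 → H →L[ℝ] H}

lemma IsC0Semigroup.exists_norm_le (hS : IsC0Semigroup S) (T : ℝ≥0) :
    ∃ C : ℝ, 0 < C ∧ ∀ t ≤ T, ‖S t‖ ≤ C := by
  obtain ⟨C, hC⟩ := banach_steinhaus (g := fun t : Set.Iic T => S t) (fun x => by
    have hK : IsCompact (Set.Iic T) := by
      rw [← Set.Icc_bot]; exact isCompact_Icc
    obtain ⟨C, hC⟩ := hK.exists_bound_of_continuousOn (hS.strong_cont x).continuousOn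
    exact ⟨C, fun t => hC t t.2⟩)
  exact ⟨max C 1, lt_max_of_lt_right one_pos, fun t ht => (hC ⟨t, ht⟩).trans (le_max_left _ _)⟩

/-- Strong continuity becomes joint continuity through local uniform boundedness. Joint continuity
makes the integrands of convolutions measurable. -/
lemma IsC0Semigroup.continuous_uncurry (hS : IsC0Semigroup S) :
    Continuous fun p : ℝ≥0 × H => S p.1 p.2 := by
  refine continuous_iff_continuousAt.2 fun ⟨t, x⟩ => ?_
  obtain ⟨C, hC0, hC⟩ := hS.exists_norm_le (t + 1)
  rw [ContinuousAt, tendsto_iff_norm_sub_tendsto_zero]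
  have h0 : Tendsto (fun p : ℝ≥0 × H => C * ‖p.2 - x‖ + ‖S p.1 x - S t x‖) (𝓝 (t, x)) (𝓝 0) := by
    have : Continuous fun p : ℝ≥0 × H => C * ‖p.2 - x‖ + ‖S p.1 x - S t x‖ := by
      have := hS.strong_cont x
      fun_prop
    have := this.tendsto (t, x)
    simpa using this
  refine squeeze_zero' (Eventually.of_forall fun _ => norm_nonneg _) ?_ h0
  have hev : ∀ᶠ p : ℝ≥0 × H in 𝓝 (t, x), p.1 < t + 1 :=
    continuous_fst.continuousAt.eventually_lt continuousAt_const (by simp)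
  filter_upwards [hev] with p hp
  calc ‖S p.1 p.2 - S t x‖ = ‖S p.1 (p.2 - x) + (S p.1 x - S t x)‖ := by
        rw [map_sub]; abel_nf
    _ ≤ ‖S p.1 (p.2 - x)‖ + ‖S p.1 x - S t x‖ := norm_add_le _ _
    _ ≤ _ := by
      gcongr
      exact ((S p.1).le_opNorm _).trans (by gcongr; exact hC _ hp.le)

lemma IsC0Semigroup.aestronglyMeasurable_comp (hS : IsC0Semigroup S) {f : ℝ≥0 → H} {t : ℝ≥0}
    {ν : Measure ℝ≥0} (hf : AEStronglyMeasurable f ν) :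
    AEStronglyMeasurable (fun r => S (t - r) (f r)) ν :=
  hS.continuous_uncurry.comp_aestronglyMeasurable
    ((continuous_const.sub continuous_id).aestronglyMeasurable.prodMk hf)

lemma memLp_two_of_lintegral_lt_top {α G : Type*} {m : MeasurableSpace α} {ν : Measure α}
    [NormedAddCommGroup G] {f : α → G} (hf : AEStronglyMeasurable f ν)
    (h : ∫⁻ a, ‖f a‖ₑ ^ 2 ∂ν < ∞) : MemLp f 2 ν := by
  refine ⟨hf, ?_⟩
  rw [eLpNorm_lt_top_iff_lintegral_rpow_enorm_lt_top (by simp) (by simp)]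
  simpa using h

lemma lintegral_enorm_sq_lt_top_of_memLp {α G : Type*} {m : MeasurableSpace α} {ν : Measure α}
    [NormedAddCommGroup G] {f : α → G} (hf : MemLp f 2 ν) : ∫⁻ a, ‖f a‖ₑ ^ 2 ∂ν < ∞ := by
  have := (eLpNorm_lt_top_iff_lintegral_rpow_enorm_lt_top (by simp) (by simp)).1 hf.2
  simpa using this

lemma IsC0Semigroup.integrable_conv (hS : IsC0Semigroup S) {f : ℝ≥0 → H} {t : ℝ≥0}
    (hf : MemLp f 2 (timeLeb.restrict (Set.Iic t))) :
    Integrable (fun r => S (t - r) (f r)) (timeLeb.restrict (Set.Iic t)) := by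
  obtain ⟨C, hC0, hC⟩ := hS.exists_norm_le t
  have h1 : Integrable f (timeLeb.restrict (Set.Iic t)) := hf.integrable (by norm_num)
  refine (h1.norm.const_mul C).mono' (hS.aestronglyMeasurable_comp hf.1) (ae_of_all _ fun r => ?_)
  exact ((S (t - r)).le_opNorm _).trans (by gcongr; exact hC _ tsub_le_self)

end Semigroup

/-! ### Progressive measurability -/

section Progressive

variable {Ω : Type*} {mΩ : MeasurableSpace Ω} {𝓕 : Filtration ℝ≥0 mΩ}

/-- Freezing at time `i` extends the restricted process to the whole time axis, so that Fubini
arguments with the σ-algebra `𝓕 i` become possible. -/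
lemma MeasureTheory.IsStronglyProgressive.measurable_min {β : Type*} [TopologicalSpace β]
    {u : ℝ≥0 → Ω → β} (hu : IsStronglyProgressive 𝓕 u) (i : ℝ≥0) :
    StronglyMeasurable[(inferInstance : MeasurableSpace ℝ≥0).prod (𝓕 i)]
      (fun p : ℝ≥0 × Ω => u (min p.1 i) p.2) := by
  have hm : @Measurable (ℝ≥0 × Ω) (Set.Iic i × Ω)
      ((inferInstance : MeasurableSpace ℝ≥0).prod (𝓕 i)) (Subtype.instMeasurableSpace.prod (𝓕 i))
      (fun p => ((⟨min p.1 i, Set.mem_Iic.2 (min_le_right _ _)⟩ : Set.Iic i), p.2)) := by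
    let := 𝓕 i
    exact (Measurable.subtype_mk (measurable_fst.min measurable_const)).prodMk measurable_snd
  exact (hu i).comp_measurable hm

/-- A process is progressive if it is adapted with right-continuous paths. -/
lemma isStronglyProgressive_of_rightContinuous {V : Type*} [TopologicalSpace V]
    [TopologicalSpace.PseudoMetrizableSpace V] [SecondCountableTopology V]
    {u : ℝ≥0 → Ω → V} (hu : ∀ t, StronglyMeasurable[𝓕 t] (u t))
    (hc : ∀ ω s, ContinuousWithinAt (fun t => u t ω) (Set.Ici s) s) :
    IsStronglyProgressive 𝓕 u := by
  intro i
  -- The next point of the grid of mesh `1 / (n + 1)` to the right of `s`, clipped at `i`. It takes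
  -- countably many values and tends to `s` from the right.
  set d : ℕ → ℝ≥0 → ℝ≥0 := fun n s => min ((⌊s * (n + 1)⌋₊ + 1) / (n + 1)) i with hd
  let := 𝓕 i
  refine stronglyMeasurable_of_tendsto atTop
    (f := fun n (p : Set.Iic i × Ω) => u (d n p.1) p.2) (fun n => ?_) ?_
  · borelize V
    have h1 : Measurable (fun p : Ω × ℕ => u (min ((p.2 + 1) / (n + 1)) i) p.1) :=
      measurable_from_prod_countable_left fun k =>
        ((hu (min ((k + 1) / (n + 1)) i)).mono (𝓕.mono (min_le_right _ _))).measurable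
    have h2 : Measurable fun p : Set.Iic i × Ω => (p.2, ⌊(p.1 : ℝ≥0) * (n + 1)⌋₊) :=
      measurable_snd.prodMk (Nat.measurable_floor.comp
        ((measurable_subtype_coe.comp measurable_fst).mul_const _))
    exact (h1.comp h2).stronglyMeasurable
  · rw [tendsto_pi_nhds]
    rintro ⟨⟨s, hs⟩, ω⟩
    refine (hc ω s).tendsto.comp (tendsto_nhdsWithin_iff.2 ⟨?_, Eventually.of_forall fun n => ?_⟩)
    · have hup : ∀ n : ℕ, d n s ≤ s + 1 / (n + 1) := fun n => by
        refine (min_le_left _ _).trans ?_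
        rw [add_div]
        gcongr
        rw [div_le_iff₀ (by positivity)]
        exact Nat.floor_le zero_le
      have hlim : Tendsto (fun n : ℕ => s + 1 / ((n : ℝ≥0) + 1)) atTop (𝓝 s) := by
        have := (tendsto_const_nhds (x := s)).add
          (tendsto_one_div_add_atTop_nhds_zero_nat (𝕜 := ℝ≥0))
        simpa using this
      refine tendsto_of_tendsto_of_tendsto_of_le_of_le tendsto_const_nhds hlim (fun n => ?_) hup
      refine le_min ?_ hs
      rw [le_div_iff₀ (by positivity)]
      exact (Nat.lt_floor_add_one _).le
    · change s ≤ d n s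
      refine le_min ?_ hs
      rw [le_div_iff₀ (by positivity)]
      exact (Nat.lt_floor_add_one _).le

/-- Convolutions are known to be measurable only as elements of `H`; by Lusin–Souslin the
measurability passes to `V`. -/
lemma stronglyMeasurable_of_injective_comp {V H : Type*} [NormedAddCommGroup V] [NormedSpace ℝ V]
    [CompleteSpace V] [SecondCountableTopology V] [NormedAddCommGroup H] [NormedSpace ℝ H]
    {i : V →L[ℝ] H} (hi : Function.Injective i) {α : Type*} {m : MeasurableSpace α} {f : α → V}
    (hf : StronglyMeasurable fun a => i (f a)) : StronglyMeasurable f := by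
  borelize V H
  exact ((measurableEmbedding_of_injective hi).measurable_comp_iff.1 hf.measurable).stronglyMeasurable

lemma stronglyMeasurable_semigroup_conv {H : Type*} [NormedAddCommGroup H] [NormedSpace ℝ H]
    [CompleteSpace H] {S : ℝ≥0 → H →L[ℝ] H} (hS : IsC0Semigroup S) {f : ℝ≥0 → Ω → H}
    (hf : IsStronglyProgressive 𝓕 f) (t : ℝ≥0) :
    StronglyMeasurable[𝓕 t] fun ω => ∫ r in Set.Iic t, S (t - r) (f r ω) ∂timeLeb := by
  have h1 := hf.measurable_min t
  have h2 : ∀ ω, ∫ r in Set.Iic t, S (t - r) (f r ω) ∂timeLeb =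
      ∫ r in Set.Iic t, S (t - r) (f (min r t) ω) ∂timeLeb := fun ω =>
    setIntegral_congr_fun measurableSet_Iic fun r hr => by
      simp only [min_eq_left (Set.mem_Iic.1 hr)]
  simp_rw [h2]
  let := 𝓕 t
  have h3 : StronglyMeasurable fun p : ℝ≥0 × Ω => S (t - p.1) (f (min p.1 t) p.2) :=
    hS.continuous_uncurry.comp_stronglyMeasurable
      ((measurable_const.sub measurable_fst).stronglyMeasurable.prodMk h1)
  exact h3.integral_prod_left

lemma measurable_lintegral_Iic {f : ℝ≥0 → Ω → ℝ≥0∞} (hf : IsStronglyProgressive 𝓕 f) (t : ℝ≥0) :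
    Measurable[𝓕 t] fun ω => ∫⁻ r in Set.Iic t, f r ω ∂timeLeb := by
  have h1 := hf.measurable_min t
  have h2 : ∀ ω, ∫⁻ r in Set.Iic t, f r ω ∂timeLeb = ∫⁻ r in Set.Iic t, f (min r t) ω ∂timeLeb :=
    fun ω => setLIntegral_congr_fun measurableSet_Iic fun r hr => by
      simp only [min_eq_left (Set.mem_Iic.1 hr)]
  simp_rw [h2]
  let := 𝓕 t
  exact h1.measurable.lintegral_prod_left'

lemma isStronglyProgressive_lintegral {f : ℝ≥0 → Ω → ℝ≥0∞} (hf : IsStronglyProgressive 𝓕 f) :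
    IsStronglyProgressive 𝓕 fun t ω => ∫⁻ r in Set.Iic t, f r ω ∂timeLeb := by
  intro t
  have h1 := (hf.measurable_min t).measurable
  have h2 : ∀ p : Set.Iic t × Ω, ∫⁻ r in Set.Iic (p.1 : ℝ≥0), f r p.2 ∂timeLeb =
      ∫⁻ r, (if r ≤ p.1 then f (min r t) p.2 else 0) ∂timeLeb := fun p => by
    rw [← lintegral_indicator measurableSet_Iic]
    refine lintegral_congr fun r => ?_
    by_cases hr : r ≤ p.1
    · rw [Set.indicator_of_mem (Set.mem_Iic.2 hr), if_pos hr,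
        min_eq_left (hr.trans (Set.mem_Iic.1 p.1.2))]
    · rw [Set.indicator_of_notMem (by simpa using hr), if_neg hr]
  simp_rw [h2]
  let := 𝓕 t
  refine Measurable.stronglyMeasurable ?_
  have h3 : Measurable fun q : (Set.Iic t × Ω) × ℝ≥0 =>
      (if q.2 ≤ q.1.1 then f (min q.2 t) q.1.2 else 0) := by
    refine Measurable.ite ?_ ?_ measurable_const
    · exact measurableSet_le measurable_snd
        (measurable_subtype_coe.comp (measurable_fst.comp measurable_fst))
    · exact h1.comp (measurable_snd.prodMk (measurable_snd.comp measurable_fst))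
  exact h3.lintegral_prod_right'

lemma MeasureTheory.IsStronglyProgressive.aestronglyMeasurable_path {V : Type*}
    [TopologicalSpace V] [TopologicalSpace.PseudoMetrizableSpace V]
    {u : ℝ≥0 → Ω → V} (hu : IsStronglyProgressive 𝓕 u) (t : ℝ≥0) (ω : Ω) :
    AEStronglyMeasurable (fun s => u s ω) (timeLeb.restrict (Set.Iic t)) := by
  have h : StronglyMeasurable fun s => u (min s t) ω := by
    have h1 := hu.measurable_min t
    let := 𝓕 t
    exact h1.comp_measurable (measurable_id.prodMk measurable_const)
  refine h.aestronglyMeasurable.congr ?_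
  filter_upwards [ae_restrict_mem measurableSet_Iic] with s hs
  rw [min_eq_left (Set.mem_Iic.1 hs)]

variable {E V : Type*} [NormedAddCommGroup E] [NormedSpace ℝ E] [CompleteSpace E]
  [SecondCountableTopology E] [NormedAddCommGroup V] [NormedSpace ℝ V] {j : E →L[ℝ] V}

lemma isStronglyProgressive_subNorm (hj : Function.Injective j) {u : ℝ≥0 → Ω → V}
    (hu : IsStronglyProgressive 𝓕 u) : IsStronglyProgressive 𝓕 fun t ω => subNorm j (u t ω) :=
  fun i => (measurable_subNorm_comp hj (hu i)).stronglyMeasurable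

lemma isStronglyProgressive_min (s : ℝ≥0) :
    IsStronglyProgressive 𝓕 fun (t : ℝ≥0) (_ : Ω) => min s t := by
  intro i
  let := 𝓕 i
  exact (measurable_const.min
    (measurable_subtype_coe.comp measurable_fst)).stronglyMeasurable

lemma isStronglyProgressive_pathGauge (hj : Function.Injective j) {u : ℝ≥0 → Ω → V}
    (hu : IsStronglyProgressive 𝓕 u)
    (hc : ∀ ω s, ContinuousWithinAt (fun t => u t ω) (Set.Ici s) s) :
    IsStronglyProgressive 𝓕 fun t ω => pathGauge j t fun s => u s ω := by
  have h1 : ∀ n, IsStronglyProgressive 𝓕 fun t ω =>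
      ‖u (min (TopologicalSpace.denseSeq ℝ≥0 n) t) ω‖ₑ := fun n i =>
    ((hu.comp (isStronglyProgressive_min _) (fun _ _ => min_le_right _ _)) i).enorm.stronglyMeasurable
  have h2 := isStronglyProgressive_lintegral
    (f := fun t ω => subNorm j (u t ω) ^ 2) (𝓕 := 𝓕) fun i =>
      (((isStronglyProgressive_subNorm hj hu) i).measurable.pow_const 2).stronglyMeasurable
  intro i
  have h3 : ∀ p : Set.Iic i × Ω, pathGauge j p.1 (fun s => u s p.2) =
      (⨆ n, ‖u (min (TopologicalSpace.denseSeq ℝ≥0 n) p.1) p.2‖ₑ) +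
        (∫⁻ r in Set.Iic (p.1 : ℝ≥0), subNorm j (u r p.2) ^ 2 ∂timeLeb) ^ (1 / 2 : ℝ) := fun p => by
    rw [pathGauge, pathSup_eq_iSup_denseSeq (hc p.2), pathEnergy]
  simp_rw [h3]
  refine Measurable.stronglyMeasurable ?_
  exact (Measurable.iSup fun n => (h1 n i).measurable).add ((h2 i).measurable.pow_const _)

end Progressive

/-! ### Mild convolutions and maximal regularity -/

section MildConv

variable {Ω E V H : Type*} {mΩ : MeasurableSpace Ω}
  [NormedAddCommGroup E] [NormedSpace ℝ E] [NormedAddCommGroup V] [NormedSpace ℝ V]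
  [NormedAddCommGroup H] [NormedSpace ℝ H]

/-- The standing assumptions on the stochastic basis, the embeddings and the semigroup. -/
structure MildSetting (μ : Measure Ω) (𝓕 : Filtration ℝ≥0 mΩ) (W : ℝ≥0 → Ω → ℝ)
    (j : E →L[ℝ] V) (i : V →L[ℝ] H) (S : ℝ≥0 → H →L[ℝ] H) : Prop where
  usual : UsualConditions μ 𝓕
  wiener : IsWiener μ 𝓕 W
  inj_left : Function.Injective j
  inj_right : Function.Injective i
  semigroup : IsC0Semigroup S
  regularity : MaximalRegularity μ 𝓕 W j i S

/-- Processes in `M²(X_T)` all of whose paths are continuous, of finite norm, and constant after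
time `T`. -/
structure IsRegularProcess (μ : Measure Ω) (𝓕 : Filtration ℝ≥0 mΩ) (j : E →L[ℝ] V) (T : ℝ≥0)
    (u : ℝ≥0 → Ω → V) : Prop where
  prog : IsStronglyProgressive 𝓕 u
  cont : ∀ ω, Continuous fun t => u t ω
  eq_min : ∀ t ω, u t ω = u (min t T) ω
  finite : ∀ ω, xNormSq j T (fun t => u t ω) < ∞
  sqInt : ∫⁻ ω, xNormSq j T (fun t => u t ω) ∂μ < ∞

/-- `Y` is a version of `∫₀ᵗ S(t-r) f(r) dr + ∫₀ᵗ S(t-r) ξ(r) dW(r)`. -/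
def IsMildConv (μ : Measure Ω) (𝓕 : Filtration ℝ≥0 mΩ) (W : ℝ≥0 → Ω → ℝ)
    (i : V →L[ℝ] H) (S : ℝ≥0 → H →L[ℝ] H) (t : ℝ≥0) (f : ℝ≥0 → Ω → H) (ξ : ℝ≥0 → Ω → V)
    (Y : Ω → H) : Prop :=
  ∃ J, IsItoIntegral μ 𝓕 W t (fun r ω => S (t - r) (i (ξ r ω))) J ∧
    ∀ᵐ ω ∂μ, Y ω = (∫ r in Set.Iic t, S (t - r) (f r ω) ∂timeLeb) + J ω

/-- The squared norm of `M²(0,T;Y)`. -/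
noncomputable def m2NormSq {Y : Type*} [NormedAddCommGroup Y] (μ : Measure Ω) (T : ℝ≥0)
    (f : ℝ≥0 → Ω → Y) : ℝ≥0∞ := ∫⁻ ω, ∫⁻ s in Set.Iic T, ‖f s ω‖ₑ ^ 2 ∂timeLeb ∂μ

variable {μ : Measure Ω} {𝓕 : Filtration ℝ≥0 mΩ} {W : ℝ≥0 → Ω → ℝ}
  {j : E →L[ℝ] V} {i : V →L[ℝ] H} {S : ℝ≥0 → H →L[ℝ] H} {T t : ℝ≥0}
  {f f' : ℝ≥0 → Ω → H} {ξ ξ' : ℝ≥0 → Ω → V} {u v : ℝ≥0 → Ω → V} {Y Y' : Ω → H}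

/-- The usual conditions permit changing paths on a null set without losing adaptedness. -/
lemma UsualConditions.measurableSet_of_ae (h : UsualConditions μ 𝓕) {G : Set Ω}
    (hG : ∀ᵐ ω ∂μ, ω ∈ G) (t : ℝ≥0) : MeasurableSet[𝓕 t] G :=
  𝓕.mono (zero_le : (0 : ℝ≥0) ≤ t) _ (MeasurableSet.of_compl (h.null_mem _ (by
    rw [ae_iff] at hG; exact hG)))

/-- Equality at every fixed time of continuous paths gives indistinguishability. -/
lemma ae_eq_path_of_forall_ae_eq {G : Type*} [TopologicalSpace G] [T2Space G] {u v : ℝ≥0 → Ω → G}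
    {A : Ω → Set ℝ≥0}
    (hA : ∀ᵐ ω ∂μ, ∀ s ∈ A ω, ∀ r ≤ s, r ∈ A ω)
    (hu : ∀ᵐ ω ∂μ, ∀ s ∈ A ω, ContinuousOn (fun t => u t ω) (Set.Iic s))
    (hv : ∀ᵐ ω ∂μ, ∀ s ∈ A ω, ContinuousOn (fun t => v t ω) (Set.Iic s))
    (h : ∀ t, ∀ᵐ ω ∂μ, t ∈ A ω → u t ω = v t ω) :
    ∀ᵐ ω ∂μ, ∀ t ∈ A ω, u t ω = v t ω := by
  have hD : ∀ᵐ ω ∂μ, ∀ n, TopologicalSpace.denseSeq ℝ≥0 n ∈ A ω →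
      u (TopologicalSpace.denseSeq ℝ≥0 n) ω = v (TopologicalSpace.denseSeq ℝ≥0 n) ω :=
    ae_all_iff.2 fun n => h _
  filter_upwards [hA, hu, hv, hD, h 0] with ω h1 h2 h3 h4 h5 t ht
  -- Every positive time is a limit of dense times before it, which lie in `A ω` as well. Time `0`
  -- has no earlier times and is treated directly.
  rcases eq_or_ne t 0 with rfl | ht0
  · exact h5 ht
  have hd : Dense (Set.range (TopologicalSpace.denseSeq ℝ≥0)) :=
    TopologicalSpace.denseRange_denseSeq ℝ≥0
  have hcl : Set.Iic t ⊆ closure (Set.Iio t ∩ Set.range (TopologicalSpace.denseSeq ℝ≥0)) := by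
    rw [← closure_Iio' (a := t) ⟨0, pos_iff_ne_zero.2 ht0⟩]
    exact closure_minimal (hd.open_subset_closure_inter isOpen_Iio) isClosed_closure
  have heq : Set.EqOn (fun t => u t ω) (fun t => v t ω)
      (Set.Iio t ∩ Set.range (TopologicalSpace.denseSeq ℝ≥0)) := by
    rintro s ⟨hs, n, rfl⟩
    exact h4 n (h1 t ht _ (le_of_lt hs))
  have hsub : Set.Iio t ∩ Set.range (TopologicalSpace.denseSeq ℝ≥0) ⊆ Set.Iic t :=
    Set.inter_subset_left.trans Set.Iio_subset_Iic_self
  exact heq.of_subset_closure (h2 t ht) (h3 t ht) hsub hcl (Set.mem_Iic.2 le_rfl)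

section Linear

variable [CompleteSpace H] [SecondCountableTopology H] [IsProbabilityMeasure μ]

omit [CompleteSpace H] in
lemma IsMildConv.ae_eq_on (hW : IsWiener μ 𝓕 W) (h : IsMildConv μ 𝓕 W i S t f ξ Y)
    (h' : IsMildConv μ 𝓕 W i S t f' ξ' Y') {A : Set Ω}
    (hA : ∀ᵐ ω ∂μ, ω ∈ A → ∀ᵐ s ∂(timeLeb.restrict (Set.Iic t)),
      f s ω = f' s ω ∧ ξ s ω = ξ' s ω) :
    ∀ᵐ ω ∂μ, ω ∈ A → Y ω = Y' ω := by
  obtain ⟨J, hJ, hY⟩ := h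
  obtain ⟨J', hJ', hY'⟩ := h'
  have := hJ.ae_eq_of_ae_eq_on hW hJ' (A := A) (by
    filter_upwards [hA] with ω h1 h2
    filter_upwards [h1 h2] with s hs
    rw [hs.2])
  filter_upwards [this, hY, hY', hA] with ω h1 h2 h3 h4 hω
  rw [h2, h3, h1 hω]
  congr 1
  refine integral_congr_ae ?_
  filter_upwards [h4 hω] with s hs
  rw [hs.1]

omit [CompleteSpace H] in
lemma IsMildConv.ae_eq (hW : IsWiener μ 𝓕 W) (h : IsMildConv μ 𝓕 W i S t f ξ Y)
    (h' : IsMildConv μ 𝓕 W i S t f ξ Y') : Y =ᵐ[μ] Y' := by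
  filter_upwards [h.ae_eq_on hW h' (A := Set.univ) (by simp)] with ω hω using hω trivial

omit [SecondCountableTopology H] [IsProbabilityMeasure μ] in
lemma IsMildConv.sub (hS : IsC0Semigroup S) (h : IsMildConv μ 𝓕 W i S t f ξ Y)
    (h' : IsMildConv μ 𝓕 W i S t f' ξ' Y')
    (hf : ∀ᵐ ω ∂μ, MemLp (fun s => f s ω) 2 (timeLeb.restrict (Set.Iic t)))
    (hf' : ∀ᵐ ω ∂μ, MemLp (fun s => f' s ω) 2 (timeLeb.restrict (Set.Iic t))) :
    IsMildConv μ 𝓕 W i S t (fun s ω => f s ω - f' s ω) (fun s ω => ξ s ω - ξ' s ω)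
      (fun ω => Y ω - Y' ω) := by
  obtain ⟨J, hJ, hY⟩ := h
  obtain ⟨J', hJ', hY'⟩ := h'
  refine ⟨fun ω => J ω - J' ω, ?_, ?_⟩
  · have := hJ.sub hJ'
    simpa only [map_sub] using this
  · filter_upwards [hY, hY', hf, hf'] with ω h1 h2 h3 h4
    simp only [map_sub]
    rw [integral_sub (hS.integrable_conv h3) (hS.integrable_conv h4), h1, h2]
    abel

end Linear

section MemM2

variable {Y : Type*} [NormedAddCommGroup Y] [NormedSpace ℝ Y] {f f' : ℝ≥0 → Ω → Y}

omit [NormedSpace ℝ Y] in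
lemma isStronglyProgressive_enorm_sq (hf : IsStronglyProgressive 𝓕 f) :
    IsStronglyProgressive 𝓕 fun t ω => ‖f t ω‖ₑ ^ 2 := fun t =>
  ((hf t).enorm.pow_const 2).stronglyMeasurable

omit [NormedSpace ℝ Y] in
lemma MemM2.ae_memLp (hf : MemM2 μ 𝓕 T f) :
    ∀ᵐ ω ∂μ, MemLp (fun s => f s ω) 2 (timeLeb.restrict (Set.Iic T)) := by
  have hm := (measurable_lintegral_Iic (isStronglyProgressive_enorm_sq hf.1) T).mono
    (𝓕.le T) le_rfl
  filter_upwards [ae_lt_top hm hf.2.ne] with ω hω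
  exact memLp_two_of_lintegral_lt_top (hf.1.aestronglyMeasurable_path T ω) hω

omit [NormedSpace ℝ Y] in
lemma MemM2.mono (hf : MemM2 μ 𝓕 T f) (ht : t ≤ T) : MemM2 μ 𝓕 t f :=
  ⟨hf.1, lt_of_le_of_lt (lintegral_mono fun _ =>
    lintegral_mono_set (Set.Iic_subset_Iic.2 ht)) hf.2⟩

omit [NormedSpace ℝ Y] in
lemma MemM2.sub (hf : MemM2 μ 𝓕 T f) (hf' : MemM2 μ 𝓕 T f') :
    MemM2 μ 𝓕 T fun s ω => f s ω - f' s ω := by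
  refine ⟨fun t => (hf.1 t).sub (hf'.1 t), ?_⟩
  have hm : ∀ g : ℝ≥0 → Ω → Y, IsStronglyProgressive 𝓕 g →
      Measurable fun ω => ∫⁻ s in Set.Iic T, ‖g s ω‖ₑ ^ 2 ∂timeLeb := fun g hg =>
    (measurable_lintegral_Iic (isStronglyProgressive_enorm_sq hg) T).mono (𝓕.le T) le_rfl
  calc _ ≤ ∫⁻ ω, (2 * ∫⁻ s in Set.Iic T, ‖f s ω‖ₑ ^ 2 ∂timeLeb +
        2 * ∫⁻ s in Set.Iic T, ‖f' s ω‖ₑ ^ 2 ∂timeLeb) ∂μ :=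
        lintegral_mono fun ω => lintegral_enorm_sub_sq_le (hf.1.aestronglyMeasurable_path T ω)
    _ < ∞ := by
      rw [lintegral_add_left ((hm f hf.1).const_mul _), lintegral_const_mul _ (hm f hf.1),
        lintegral_const_mul _ (hm f' hf'.1)]
      exact ENNReal.add_lt_top.2 ⟨ENNReal.mul_lt_top (by simp) hf.2,
        ENNReal.mul_lt_top (by simp) hf'.2⟩

end MemM2

section Regular

variable [CompleteSpace E] [SecondCountableTopology E]

lemma IsRegularProcess.measurable_xNormSq (hj : Function.Injective j) (hu : IsStronglyProgressive 𝓕 u)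
    (hc : ∀ ω, Continuous fun t => u t ω) (T : ℝ≥0) :
    Measurable fun ω => xNormSq j T fun t => u t ω := by
  have h1 : ∀ n, Measurable fun ω => ‖u (min (TopologicalSpace.denseSeq ℝ≥0 n) T) ω‖ₑ := fun n =>
    ((hu.stronglyAdapted _).mono (𝓕.le _)).enorm
  have h2 : IsStronglyProgressive 𝓕 fun t ω => subNorm j (u t ω) ^ 2 := fun t =>
    ((isStronglyProgressive_subNorm hj hu t).measurable.pow_const 2).stronglyMeasurable
  have h3 := (measurable_lintegral_Iic h2 T).mono (𝓕.le T) le_rfl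
  have h4 : (fun ω => xNormSq j T fun t => u t ω) = fun ω =>
      (⨆ n, ‖u (min (TopologicalSpace.denseSeq ℝ≥0 n) T) ω‖ₑ) ^ 2 +
        ∫⁻ r in Set.Iic T, subNorm j (u r ω) ^ 2 ∂timeLeb := by
    ext ω
    rw [xNormSq_eq, pathSup_eq_iSup_denseSeq fun s => (hc ω).continuousWithinAt, pathEnergy]
  rw [h4]
  exact ((Measurable.iSup h1).pow_const 2).add h3

lemma IsRegularProcess.measurable (hj : Function.Injective j) (hu : IsRegularProcess μ 𝓕 j T u) (t : ℝ≥0) :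
    Measurable fun ω => xNormSq j t fun t => u t ω :=
  measurable_xNormSq hj hu.prog hu.cont t

lemma IsRegularProcess.add (hj : Function.Injective j) (hu : IsRegularProcess μ 𝓕 j T u)
    (hv : IsRegularProcess μ 𝓕 j T v) : IsRegularProcess μ 𝓕 j T fun t ω => u t ω + v t ω where
  prog := fun t => (hu.prog t).add (hv.prog t)
  cont := fun ω => (hu.cont ω).add (hv.cont ω)
  eq_min := fun t ω => by rw [hu.eq_min t, hv.eq_min t]
  finite := fun ω => (xNormSq_add_le hj (hu.cont ω).aestronglyMeasurable).trans_lt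
    (ENNReal.add_lt_top.2 ⟨ENNReal.mul_lt_top (by simp) (hu.finite ω),
      ENNReal.mul_lt_top (by simp) (hv.finite ω)⟩)
  sqInt := by
    refine (lintegral_mono fun ω =>
      xNormSq_add_le hj (hu.cont ω).aestronglyMeasurable).trans_lt ?_
    rw [lintegral_add_left ((hu.measurable hj T).const_mul _),
      lintegral_const_mul _ (hu.measurable hj T), lintegral_const_mul _ (hv.measurable hj T)]
    exact ENNReal.add_lt_top.2 ⟨ENNReal.mul_lt_top (by simp) hu.sqInt,
      ENNReal.mul_lt_top (by simp) hv.sqInt⟩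

omit [CompleteSpace E] [SecondCountableTopology E] in
lemma IsRegularProcess.neg (hj : Function.Injective j) (hu : IsRegularProcess μ 𝓕 j T u) :
    IsRegularProcess μ 𝓕 j T fun t ω => - u t ω where
  prog := fun t => (hu.prog t).neg
  cont := fun ω => (hu.cont ω).neg
  eq_min := fun t ω => by rw [hu.eq_min t]
  finite := fun ω => by rw [xNormSq_neg hj]; exact hu.finite ω
  sqInt := by simp_rw [xNormSq_neg hj]; exact hu.sqInt

lemma IsRegularProcess.sub (hj : Function.Injective j) (hu : IsRegularProcess μ 𝓕 j T u)
    (hv : IsRegularProcess μ 𝓕 j T v) : IsRegularProcess μ 𝓕 j T fun t ω => u t ω - v t ω := by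
  simp_rw [sub_eq_add_neg]
  exact hu.add hj (hv.neg hj)

omit [CompleteSpace E] [SecondCountableTopology E] in
/-- An adapted process with almost all paths in `X_T` has a regular version on `[0,T]`. -/
lemma UsualConditions.exists_regular_version (h𝓕 : UsualConditions μ 𝓕)
    (hu : ∀ t ≤ T, StronglyMeasurable[𝓕 t] (u t)) (hX : ∀ᵐ ω ∂μ, MemX j T fun t => u t ω)
    (hint : ∫⁻ ω, xNormSq j T (fun t => u t ω) ∂μ < ∞) :
    ∃ v, IsRegularProcess μ 𝓕 j T v ∧ ∀ᵐ ω ∂μ, ∀ t ≤ T, v t ω = u t ω := by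
  classical
  set G : Set Ω := {ω | MemX j T fun t => u t ω} with hG
  have hGm : ∀ t, MeasurableSet[𝓕 t] G := fun t => h𝓕.measurableSet_of_ae hX t
  set v : ℝ≥0 → Ω → V := fun t => G.indicator (u (min t T)) with hv
  have hvG : ∀ t, ∀ ω ∈ G, v t ω = u (min t T) ω := fun t ω hω => Set.indicator_of_mem hω _
  have hvG' : ∀ t, ∀ ω, ω ∉ G → v t ω = 0 := fun t ω hω => Set.indicator_of_notMem hω _
  have hXv : ∀ ω ∈ G, xNormSq j T (fun t => v t ω) = xNormSq j T fun t => u t ω := fun ω hω =>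
    xNormSq_congr fun t ht => by rw [hvG t ω hω, min_eq_left ht]
  have hcont : ∀ ω, Continuous fun t => v t ω := by
    intro ω
    by_cases hω : ω ∈ G
    · simp_rw [hvG _ ω hω]
      exact ContinuousOn.comp_continuous (s := Set.Iic T) (g := fun t => u t ω) (hω : MemX j T _).1
        (continuous_id.min continuous_const) fun t => Set.mem_Iic.2 (min_le_right _ _)
    · simp_rw [hvG' _ ω hω]
      exact continuous_const
  refine ⟨v, ⟨?_, hcont, ?_, ?_, ?_⟩, ?_⟩
  · refine StronglyAdapted.isStronglyProgressive_of_continuous (fun t => ?_) hcont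
    exact ((hu _ (min_le_right t T)).mono (𝓕.mono (min_le_left _ _))).indicator (hGm t)
  · intro t ω
    simp only [hv, min_assoc, min_self]
  · intro ω
    by_cases hω : ω ∈ G
    · rw [hXv ω hω]; exact (hω : MemX j T _).2
    · simp_rw [hvG' _ ω hω]
      simp [xNormSq, subNorm_zero]
  · refine lt_of_eq_of_lt (lintegral_congr_ae ?_) hint
    filter_upwards [hX] with ω hω using hXv ω hω
  · filter_upwards [hX] with ω hω t ht
    rw [hvG t ω hω, min_eq_left ht]

end Regular

section Existence

variable [CompleteSpace E] [SecondCountableTopology E] [CompleteSpace V]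
  [SecondCountableTopology V] [CompleteSpace H] [SecondCountableTopology H]
  [IsProbabilityMeasure μ]

omit [SecondCountableTopology H] [IsProbabilityMeasure μ] in
/-- Existence and maximal regularity of mild convolutions. -/
theorem MildSetting.exists_mildConv (h : MildSetting μ 𝓕 W j i S) :
    ∃ C : ℝ≥0, ∀ (T : ℝ≥0), 0 < T → ∀ (f : ℝ≥0 → Ω → H) (ξ : ℝ≥0 → Ω → V),
      MemM2 μ 𝓕 T f → MemM2 μ 𝓕 T ξ →
      ∃ y : ℝ≥0 → Ω → V, IsRegularProcess μ 𝓕 j T y ∧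
        (∀ t ≤ T, IsMildConv μ 𝓕 W i S t f ξ fun ω => i (y t ω)) ∧
        ∫⁻ ω, xNormSq j T (fun t => y t ω) ∂μ ≤ C * (m2NormSq μ T f + m2NormSq μ T ξ) := by
  classical
  obtain ⟨C₁, hC₁, hdet⟩ := h.regularity.det_conv
  obtain ⟨C₂, hC₂, hsto⟩ := h.regularity.stoch_conv
  refine ⟨2 * (Real.toNNReal (C₁ ^ 2) + Real.toNNReal (C₂ ^ 2)), fun T hT f ξ hf hξ => ?_⟩
  -- the deterministic convolution
  have hex : ∀ ω, ∃ v : ℝ≥0 → V, MemLp (fun s => f s ω) 2 (timeLeb.restrict (Set.Iic T)) →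
      MemX j T v ∧ (∀ t ≤ T, i (v t) = ∫ r in Set.Iic t, S (t - r) (f r ω) ∂timeLeb) ∧
      xNormSq j T v ≤ ENNReal.ofReal (C₁ ^ 2) * ∫⁻ r in Set.Iic T, ‖f r ω‖ₑ ^ 2 ∂timeLeb := by
    intro ω
    by_cases hω : MemLp (fun s => f s ω) 2 (timeLeb.restrict (Set.Iic T))
    · obtain ⟨v, hv⟩ := hdet T hT _ hω
      exact ⟨v, fun _ => hv⟩
    · exact ⟨0, fun hω' => absurd hω' hω⟩
  -- This choice is made separately for each `ω` and carries no measurability. That is recovered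
  -- afterwards, because `i (v ω t)` is the convolution integral and `i` is injective.
  choose v hv using hex
  set G : Set Ω := {ω | MemLp (fun s => f s ω) 2 (timeLeb.restrict (Set.Iic T))} with hG
  have hGae : ∀ᵐ ω ∂μ, ω ∈ G := hf.ae_memLp
  obtain ⟨a, ha, hav⟩ : ∃ a, IsRegularProcess μ 𝓕 j T a ∧
      ∀ᵐ ω ∂μ, ∀ t ≤ T, a t ω = G.indicator (fun ω => v ω t) ω := by
    refine h.usual.exists_regular_version (u := fun t => G.indicator (fun ω => v ω t)) (fun t ht => ?_) ?_ ?_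
    · refine stronglyMeasurable_of_injective_comp h.inj_right ?_
      have h1 := (stronglyMeasurable_semigroup_conv h.semigroup hf.1 t).indicator
        (h.usual.measurableSet_of_ae hGae t)
      convert h1 using 1
      ext ω
      by_cases hω : ω ∈ G
      · rw [Set.indicator_of_mem hω, Set.indicator_of_mem hω, (hv ω hω).2.1 t ht]
      · rw [Set.indicator_of_notMem hω, Set.indicator_of_notMem hω, map_zero]
    · filter_upwards [hGae] with ω hω
      simp only [Set.indicator_of_mem hω]
      exact (hv ω hω).1
    · refine lt_of_le_of_lt (lintegral_mono_ae (g := fun ω => ENNReal.ofReal (C₁ ^ 2) *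
        ∫⁻ r in Set.Iic T, ‖f r ω‖ₑ ^ 2 ∂timeLeb) ?_) ?_
      · filter_upwards [hGae] with ω hω
        simp only [Set.indicator_of_mem hω]
        exact (hv ω hω).2.2
      · rw [lintegral_const_mul' _ _ (by simp)]
        exact ENNReal.mul_lt_top (by simp) hf.2
  -- the stochastic convolution
  obtain ⟨w, hw, hwI, hwn⟩ := hsto T hT ξ hξ
  obtain ⟨b, hb, hbw⟩ := h.usual.exists_regular_version (fun t _ => hw.1.stronglyAdapted t) hw.2.1 hw.2.2
  refine ⟨fun t ω => a t ω + b t ω, ha.add h.inj_left hb, fun t ht => ?_, ?_⟩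
  · refine ⟨fun ω => i (w t ω), hwI t ht, ?_⟩
    filter_upwards [hav, hbw, hGae] with ω h1 h2 h3
    rw [h1 t ht, h2 t ht, Set.indicator_of_mem h3, map_add, (hv ω h3).2.1 t ht]
  · have hm1 : ∫⁻ ω, xNormSq j T (fun t => a t ω) ∂μ ≤ Real.toNNReal (C₁ ^ 2) * m2NormSq μ T f := by
      rw [m2NormSq, ← lintegral_const_mul' _ _ (by simp)]
      refine lintegral_mono_ae ?_
      filter_upwards [hav, hGae] with ω h1 h3
      refine le_trans (le_of_eq (xNormSq_congr fun t ht => ?_)) (hv ω h3).2.2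
      rw [h1 t ht, Set.indicator_of_mem h3]
    have hm2 : ∫⁻ ω, xNormSq j T (fun t => b t ω) ∂μ ≤ Real.toNNReal (C₂ ^ 2) * m2NormSq μ T ξ := by
      refine le_trans (le_of_eq (lintegral_congr_ae ?_)) hwn
      filter_upwards [hbw] with ω h1
      exact xNormSq_congr fun t ht => h1 t ht
    calc _ ≤ ∫⁻ ω, (2 * xNormSq j T (fun t => a t ω) + 2 * xNormSq j T (fun t => b t ω)) ∂μ :=
          lintegral_mono fun ω => xNormSq_add_le h.inj_left (ha.cont ω).aestronglyMeasurable
      _ = 2 * ∫⁻ ω, xNormSq j T (fun t => a t ω) ∂μ +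
          2 * ∫⁻ ω, xNormSq j T (fun t => b t ω) ∂μ := by
        rw [lintegral_add_left ((ha.measurable h.inj_left T).const_mul _),
          lintegral_const_mul _ (ha.measurable h.inj_left T),
          lintegral_const_mul _ (hb.measurable h.inj_left T)]
      _ ≤ 2 * (Real.toNNReal (C₁ ^ 2) * m2NormSq μ T f) +
          2 * (Real.toNNReal (C₂ ^ 2) * m2NormSq μ T ξ) := by gcongr
      _ ≤ 2 * ((Real.toNNReal (C₁ ^ 2) + Real.toNNReal (C₂ ^ 2)) * m2NormSq μ T f) +
          2 * ((Real.toNNReal (C₁ ^ 2) + Real.toNNReal (C₂ ^ 2)) * m2NormSq μ T ξ) := by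
        gcongr
        · exact le_self_add
        · exact le_add_self
      _ = _ := by push_cast; ring

/-- Mild convolutions with continuous paths in `V` satisfy the maximal regularity estimate on every
time interval. -/
theorem MildSetting.exists_estimate (h : MildSetting μ 𝓕 W j i S) :
    ∃ C : ℝ≥0, ∀ (T : ℝ≥0), 0 < T → ∀ (f : ℝ≥0 → Ω → H) (ξ : ℝ≥0 → Ω → V) (y : ℝ≥0 → Ω → V),
      MemM2 μ 𝓕 T f → MemM2 μ 𝓕 T ξ → (∀ᵐ ω ∂μ, ContinuousOn (fun t => y t ω) (Set.Iic T)) →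
      (∀ t ≤ T, IsMildConv μ 𝓕 W i S t f ξ fun ω => i (y t ω)) →
      ∫⁻ ω, xNormSq j T (fun t => y t ω) ∂μ ≤ C * (m2NormSq μ T f + m2NormSq μ T ξ) := by
  obtain ⟨C, hC⟩ := h.exists_mildConv
  refine ⟨C, fun T hT f ξ y hf hξ hy hconv => ?_⟩
  obtain ⟨z, hz, hzc, hzn⟩ := hC T hT f ξ hf hξ
  refine le_trans (le_of_eq (lintegral_congr_ae ?_)) hzn
  -- At each time the convolution is determined almost surely by its data, so a version with
  -- continuous paths is indistinguishable from the one that satisfies the estimate.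
  have := ae_eq_path_of_forall_ae_eq (μ := μ) (u := y) (v := z) (A := fun _ => Set.Iic T)
    (ae_of_all _ fun ω s hs r hr => hr.trans hs)
    (by filter_upwards [hy] with ω hω s hs using hω.mono (Set.Iic_subset_Iic.2 hs))
    (ae_of_all _ fun ω s _ => (hz.cont ω).continuousOn) (fun t => by
      by_cases ht : t ≤ T
      · filter_upwards [(hconv t ht).ae_eq h.wiener (hzc t ht)] with ω hω _
        exact h.inj_right hω
      · exact ae_of_all _ fun ω ht' => absurd ht' ht)
  filter_upwards [this] with ω hω
  exact xNormSq_congr hω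

end Existence

end MildConv

/-! ### Fixed points in `M²(X_T)` -/

section FixedPoint

variable {Ω E V : Type*} {mΩ : MeasurableSpace Ω}
  [NormedAddCommGroup E] [NormedSpace ℝ E] [NormedAddCommGroup V] [NormedSpace ℝ V]
  {μ : Measure Ω} {𝓕 : Filtration ℝ≥0 mΩ} {j : E →L[ℝ] V} {T : ℝ≥0}

lemma isRegularProcess_zero : IsRegularProcess μ 𝓕 j T fun _ _ => (0 : V) where
  prog := fun _ => stronglyMeasurable_const
  cont := fun _ => continuous_const
  eq_min := fun _ _ => rfl
  finite := fun _ => by simp [xNormSq, subNorm_zero]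
  sqInt := by simp [xNormSq, subNorm_zero]

/-- This is `a ≤ w * a² + 1 / w` with `w = 2 ^ (k + 1)`. It turns summability of weighted squared
norms into a summable majorant for the paths themselves. -/
lemma norm_le_weighted_xNormSq {v : ℝ≥0 → V} (hv : xNormSq j T v < ∞) {s : ℝ≥0} (hs : s ≤ T)
    (k : ℕ) : ‖v s‖ ≤ 2 ^ (k + 1) * (xNormSq j T v).toReal + (1 / 2) ^ (k + 1) := by
  have h1 : ‖v s‖ ^ 2 ≤ (xNormSq j T v).toReal := by
    have := ENNReal.toReal_mono hv.ne (enorm_sq_le_xNormSq (j := j) (v := v) hs)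
    simpa using this
  have h2 : (0 : ℝ) < 2 ^ (k + 1) := by positivity
  have h3 : ((1 : ℝ) / 2) ^ (k + 1) * 2 ^ (k + 1) = 1 := by
    rw [← mul_pow]; norm_num
  have h4 : (0 : ℝ) < (1 / 2) ^ (k + 1) := by positivity
  have h5 : 2 ^ (k + 1) * ‖v s‖ ^ 2 ≤ 2 ^ (k + 1) * (xNormSq j T v).toReal := by gcongr
  rcases le_total (‖v s‖) ((1 / 2) ^ (k + 1)) with h | h
  · have : 0 ≤ 2 ^ (k + 1) * (xNormSq j T v).toReal := by positivity
    linarith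
  · have : ‖v s‖ ≤ 2 ^ (k + 1) * ‖v s‖ ^ 2 := by
      calc ‖v s‖ = ((1 / 2) ^ (k + 1) * 2 ^ (k + 1)) * ‖v s‖ := by rw [h3, one_mul]
        _ ≤ (‖v s‖ * 2 ^ (k + 1)) * ‖v s‖ := by gcongr
        _ = _ := by ring
    linarith

variable [CompleteSpace E] [SecondCountableTopology E] [CompleteSpace V]

/-- Contractions for the norm of `M²(X_T)` have fixed points. -/
theorem UsualConditions.exists_fixedPoint (h𝓕 : UsualConditions μ 𝓕) (hj : Function.Injective j)
    {Ψ : (ℝ≥0 → Ω → V) → ℝ≥0 → Ω → V}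
    (hΨ : ∀ u, IsRegularProcess μ 𝓕 j T u → IsRegularProcess μ 𝓕 j T (Ψ u))
    (hc : ∀ u v, IsRegularProcess μ 𝓕 j T u → IsRegularProcess μ 𝓕 j T v →
      ∫⁻ ω, xNormSq j T (fun t => Ψ u t ω - Ψ v t ω) ∂μ ≤
        (1 / 4) * ∫⁻ ω, xNormSq j T (fun t => u t ω - v t ω) ∂μ) :
    ∃ u, IsRegularProcess μ 𝓕 j T u ∧ ∀ᵐ ω ∂μ, ∀ t ≤ T, Ψ u t ω = u t ω := by
  classical
  -- The limit of the Picard iterates is built path by path, as the sum of their increments. This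
  -- avoids quotients modulo null sets and gives continuous paths and adaptedness directly.
  set U : ℕ → ℝ≥0 → Ω → V := fun n => Ψ^[n] fun _ _ => 0 with hU
  have hU1 : ∀ n, U (n + 1) = Ψ (U n) := fun n => Function.iterate_succ_apply' _ _ _
  have hUr : ∀ n, IsRegularProcess μ 𝓕 j T (U n) := by
    intro n
    induction n with
    | zero => exact isRegularProcess_zero
    | succ n ih => rw [hU1]; exact hΨ _ ih
  set w : ℕ → ℝ≥0 → Ω → V := fun k t ω => U (k + 1) t ω - U k t ω with hw
  have hwr : ∀ k, IsRegularProcess μ 𝓕 j T (w k) := fun k => (hUr (k + 1)).sub hj (hUr k)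
  have hwm : ∀ k, Measurable fun ω => xNormSq j T fun t => w k t ω := fun k =>
    (hwr k).measurable hj T
  have hws : ∀ n t ω, ∑ k ∈ Finset.range n, w k t ω = U n t ω := by
    intro n t ω
    rw [Finset.sum_range_sub (fun k => U k t ω) n]
    simp [hU]
  set D : ℕ → ℝ≥0∞ := fun k => ∫⁻ ω, xNormSq j T (fun t => w k t ω) ∂μ with hD
  have hDk : ∀ k, D k ≤ (1 / 4) ^ k * D 0 := by
    intro k
    induction k with
    | zero => simp
    | succ k ih =>
      calc D (k + 1) ≤ (1 / 4) * D k := by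
            have := hc (U (k + 1)) (U k) (hUr _) (hUr _)
            simpa only [hD, hw, hU1] using this
        _ ≤ (1 / 4) * ((1 / 4) ^ k * D 0) := by gcongr
        _ = _ := by ring
  have hD0 : D 0 < ∞ := (hwr 0).sqInt
  -- The weight `2 ^ (k + 1)` against the decay `4 ^ (-k)` leaves the convergent series of `2 * 2 ^
  -- (-k)`.
  have hwt : ∀ n k, 2 ^ (k + 1) * D (n + k) ≤ (1 / 4) ^ n * (2 * D 0) * (1 / 2) ^ k := by
    intro n k
    have h42 : (1 / 4 : ℝ≥0∞) = (1 / 2) * (1 / 2) := by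
      rw [one_div, one_div, ← ENNReal.mul_inv (by simp) (by simp)]; norm_num
    have h2 : (2 : ℝ≥0∞) ^ k * (1 / 2) ^ k = 1 := by
      rw [← mul_pow, one_div, ENNReal.mul_inv_cancel (by simp) (by simp), one_pow]
    calc 2 ^ (k + 1) * D (n + k) ≤ 2 ^ (k + 1) * ((1 / 4) ^ (n + k) * D 0) := by
          gcongr; exact hDk _
      _ = (2 ^ k * (1 / 2) ^ k) * ((1 / 4) ^ n * (2 * D 0) * (1 / 2) ^ k) := by
          rw [pow_add (1 / 4 : ℝ≥0∞), pow_succ]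
          conv_lhs => rw [show ((1 / 4 : ℝ≥0∞)) ^ k = (1 / 2) ^ k * (1 / 2) ^ k by
            rw [← mul_pow, ← h42]]
          ring
      _ = _ := by rw [h2, one_mul]
  have htail : ∀ n, ∫⁻ ω, ∑' k, 2 ^ (k + 1) * xNormSq j T (fun t => w (n + k) t ω) ∂μ ≤
      (1 / 4) ^ n * (2 * D 0) * 2 := by
    intro n
    rw [lintegral_tsum fun k => ((hwm (n + k)).const_mul _).aemeasurable]
    simp_rw [lintegral_const_mul _ (hwm _)]
    refine (ENNReal.tsum_le_tsum fun k => hwt n k).trans ?_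
    rw [ENNReal.tsum_mul_left]
    gcongr
    rw [ENNReal.tsum_geometric]
    simp
  have htail_fin : ∀ n, ∫⁻ ω, ∑' k, 2 ^ (k + 1) * xNormSq j T (fun t => w (n + k) t ω) ∂μ < ∞ := by
    intro n
    refine (htail n).trans_lt ?_
    refine ENNReal.mul_lt_top (ENNReal.mul_lt_top ?_ (ENNReal.mul_lt_top (by simp) hD0)) (by simp)
    exact ENNReal.pow_lt_top (by simp)
  set A : Ω → ℝ≥0∞ := fun ω => ∑' k, 2 ^ (k + 1) * xNormSq j T (fun t => w k t ω) with hA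
  have hAint : ∫⁻ ω, A ω ∂μ < ∞ := by simpa using htail_fin 0
  set G : Set Ω := {ω | A ω < ∞} with hG
  have hGae : ∀ᵐ ω ∂μ, ω ∈ G :=
    ae_lt_top (Measurable.tsum fun k => (hwm k).const_mul _) hAint.ne
  have hsumm : ∀ ω ∈ G, Summable fun k => 2 ^ (k + 1) * (xNormSq j T (fun t => w k t ω)).toReal
      + ((1 : ℝ) / 2) ^ (k + 1) := by
    intro ω hω
    refine Summable.add ?_ ((summable_nat_add_iff 1).2 summable_geometric_two)
    refine (ENNReal.summable_toReal (hω : A ω < ∞).ne).congr fun k => ?_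
    simp
  have hle : ∀ k t ω, ‖w k t ω‖ ≤ 2 ^ (k + 1) * (xNormSq j T (fun t => w k t ω)).toReal
      + ((1 : ℝ) / 2) ^ (k + 1) := by
    intro k t ω
    rw [(hwr k).eq_min]
    exact norm_le_weighted_xNormSq (v := fun t => w k t ω) ((hwr k).finite ω) (min_le_right _ _) k
  have hsw : ∀ ω ∈ G, ∀ t, Summable fun k => w k t ω := fun ω hω t =>
    Summable.of_norm_bounded (hsumm ω hω) fun k => hle k t ω
  set u : ℝ≥0 → Ω → V := fun t => G.indicator fun ω => ∑' k, w k t ω with hu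
  have huG : ∀ ω ∈ G, ∀ t, u t ω = ∑' k, w k t ω := fun ω hω t => Set.indicator_of_mem hω _
  have huG' : ∀ ω, ω ∉ G → ∀ t, u t ω = 0 := fun ω hω t => Set.indicator_of_notMem hω _
  have hcont : ∀ ω, Continuous fun t => u t ω := by
    intro ω
    by_cases hω : ω ∈ G
    · simp_rw [huG ω hω]
      exact continuous_tsum (fun k => (hwr k).cont ω) (hsumm ω hω) fun k t => hle k t ω
    · simp_rw [huG' ω hω]
      exact continuous_const
  have hxle : ∀ ω ∈ G, ∀ n, xNormSq j T (fun t => u t ω - U n t ω) ≤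
      ∑' k, 2 ^ (k + 1) * xNormSq j T (fun t => w (n + k) t ω) := by
    intro ω hω n
    refine xNormSq_le_tsum hj (fun k => ((hwr _).cont ω).aestronglyMeasurable) fun s _ => ?_
    rw [huG ω hω, ← hws]
    have := (hasSum_nat_add_iff' n).2 (hsw ω hω s).hasSum
    simpa only [add_comm] using this
  have hreg : IsRegularProcess μ 𝓕 j T u := by
    refine ⟨?_, hcont, ?_, ?_, ?_⟩
    · refine StronglyAdapted.isStronglyProgressive_of_continuous (fun t => ?_) hcont
      refine stronglyMeasurable_of_tendsto (u := atTop) (f := fun n => G.indicator (U n t))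
        (fun n => ((hUr n).prog.stronglyAdapted t).indicator (h𝓕.measurableSet_of_ae hGae t)) ?_
      refine tendsto_pi_nhds.2 fun ω => ?_
      by_cases hω : ω ∈ G
      · simp_rw [Set.indicator_of_mem hω, huG ω hω, ← hws]
        exact (hsw ω hω t).hasSum.tendsto_sum_nat
      · simp_rw [Set.indicator_of_notMem hω, huG' ω hω]
        exact tendsto_const_nhds
    · intro t ω
      by_cases hω : ω ∈ G
      · simp_rw [huG ω hω]
        exact tsum_congr fun k => (hwr k).eq_min t ω
      · simp_rw [huG' ω hω]
    · intro ω
      by_cases hω : ω ∈ G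
      · have := hxle ω hω 0
        simp only [hU, Function.iterate_zero, id, sub_zero, zero_add] at this
        exact this.trans_lt hω
      · simp_rw [huG' ω hω]
        simp [xNormSq, subNorm_zero]
    · refine lt_of_le_of_lt (lintegral_mono_ae ?_) hAint
      filter_upwards [hGae] with ω hω
      have := hxle ω hω 0
      simpa only [hU, Function.iterate_zero, id, sub_zero, zero_add] using this
  refine ⟨u, hreg, ?_⟩
  have hdiff : ∀ n, ∫⁻ ω, xNormSq j T (fun t => u t ω - U n t ω) ∂μ ≤
      (1 / 4) ^ n * (2 * D 0) * 2 := fun n =>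
    (lintegral_mono_ae (by filter_upwards [hGae] with ω hω using hxle ω hω n)).trans (htail n)
  -- Both `Ψ u` and `u` are close to the iterate `U (n + 1) = Ψ (U n)`.
  have hbound : ∀ n, ∫⁻ ω, xNormSq j T (fun t => Ψ u t ω - u t ω) ∂μ ≤
      (1 / 4) ^ n * (2 * (2 * ((2 * D 0) * 2))) := by
    intro n
    have hm1 : Measurable fun ω => xNormSq j T fun t => Ψ u t ω - U (n + 1) t ω :=
      ((hΨ u hreg).sub hj (hUr (n + 1))).measurable hj T
    have hm2 : Measurable fun ω => xNormSq j T fun t => u t ω - U (n + 1) t ω :=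
      (hreg.sub hj (hUr (n + 1))).measurable hj T
    calc ∫⁻ ω, xNormSq j T (fun t => Ψ u t ω - u t ω) ∂μ
        ≤ ∫⁻ ω, (2 * xNormSq j T (fun t => Ψ u t ω - U (n + 1) t ω) +
          2 * xNormSq j T (fun t => u t ω - U (n + 1) t ω)) ∂μ := by
          refine lintegral_mono fun ω => ?_
          have := xNormSq_sub_le (T := T) hj (v := fun t => Ψ u t ω - U (n + 1) t ω)
            (w := fun t => u t ω - U (n + 1) t ω)
            (((hΨ u hreg).sub hj (hUr (n + 1))).cont ω).aestronglyMeasurable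
          simpa only [sub_sub_sub_cancel_right] using this
      _ = 2 * ∫⁻ ω, xNormSq j T (fun t => Ψ u t ω - Ψ (U n) t ω) ∂μ +
          2 * ∫⁻ ω, xNormSq j T (fun t => u t ω - U (n + 1) t ω) ∂μ := by
        rw [lintegral_add_left (hm1.const_mul _), lintegral_const_mul _ hm1,
          lintegral_const_mul _ hm2, hU1]
      _ ≤ 2 * ((1 / 4) * ((1 / 4) ^ n * (2 * D 0) * 2)) +
          2 * ((1 / 4) ^ (n + 1) * (2 * D 0) * 2) := by
        gcongr
        · exact (hc u (U n) hreg (hUr n)).trans (by gcongr; exact hdiff n)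
        · exact hdiff (n + 1)
      _ = (1 / 4) * ((1 / 4) ^ n * (2 * (2 * ((2 * D 0) * 2)))) := by ring
      _ ≤ 1 * ((1 / 4) ^ n * (2 * (2 * ((2 * D 0) * 2)))) := by
        gcongr; simp
      _ = _ := one_mul _
  have hzero : ∫⁻ ω, xNormSq j T (fun t => Ψ u t ω - u t ω) ∂μ = 0 := by
    refine le_antisymm (ge_of_tendsto' (x := atTop) ?_ hbound) zero_le
    have h1 : Tendsto (fun n : ℕ => ((1 / 4 : ℝ≥0∞)) ^ n) atTop (𝓝 0) :=
      ENNReal.tendsto_pow_atTop_nhds_zero_of_lt_one (by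
        rw [one_div]; exact ENNReal.inv_lt_one.2 (by norm_num))
    have h2 : 2 * (2 * ((2 * D 0) * 2)) ≠ ∞ := by
      refine ENNReal.mul_ne_top (by simp) (ENNReal.mul_ne_top (by simp)
        (ENNReal.mul_ne_top (ENNReal.mul_ne_top (by simp) hD0.ne) (by simp)))
    simpa using ENNReal.Tendsto.mul_const h1 (Or.inr h2)
  rw [lintegral_eq_zero_iff (((hΨ u hreg).sub hj hreg).measurable hj T)] at hzero
  filter_upwards [hzero] with ω hω t ht
  exact sub_eq_zero.1 (eq_zero_of_xNormSq_eq_zero hω t ht)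

end FixedPoint

/-! ### The time horizon that belongs to a cutoff level -/

section LevelMap

variable {E V Y : Type*} [NormedAddCommGroup E] [NormedSpace ℝ E]
  [NormedAddCommGroup V] [NormedSpace ℝ V] [NormedAddCommGroup Y] [NormedSpace ℝ Y]
  {j : E →L[ℝ] V} {F : E → Y} {M Th : ℕ → ℝ≥0}

/-- The nonlinearity along a path, cut off at the level `M n` and stopped at the time `Th n`. -/
noncomputable def levelMap (j : E →L[ℝ] V) (F : E → Y) (M Th : ℕ → ℝ≥0) (n : ℕ) (v : ℝ≥0 → V)
    (s : ℝ≥0) : Y :=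
  if s < Th n then truncMap j F (M n) v s else 0

lemma setLIntegral_levelMap_le (n : ℕ) (v : ℝ≥0 → V) (T : ℝ≥0) :
    ∫⁻ s in Set.Iic T, ‖levelMap j F M Th n v s‖ₑ ^ 2 ∂timeLeb ≤
      ∫⁻ s in Set.Iic (min T (Th n)), ‖truncMap j F (M n) v s‖ₑ ^ 2 ∂timeLeb := by
  rw [← lintegral_indicator measurableSet_Iic, ← lintegral_indicator measurableSet_Iic]
  refine lintegral_mono fun s => ?_
  by_cases hs : s ∈ Set.Iic T
  · rw [Set.indicator_of_mem hs, levelMap]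
    split_ifs with h
    · rw [Set.indicator_of_mem (Set.mem_Iic.2 (le_min hs h.le))]
    · simp
  · rw [Set.indicator_of_notMem hs]; exact zero_le

lemma setLIntegral_levelMap_sub_le (n : ℕ) (v₁ v₂ : ℝ≥0 → V) (T : ℝ≥0) :
    ∫⁻ s in Set.Iic T, ‖levelMap j F M Th n v₁ s - levelMap j F M Th n v₂ s‖ₑ ^ 2 ∂timeLeb ≤
      ∫⁻ s in Set.Iic (min T (Th n)),
        ‖truncMap j F (M n) v₁ s - truncMap j F (M n) v₂ s‖ₑ ^ 2 ∂timeLeb := by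
  rw [← lintegral_indicator measurableSet_Iic, ← lintegral_indicator measurableSet_Iic]
  refine lintegral_mono fun s => ?_
  by_cases hs : s ∈ Set.Iic T
  · rw [Set.indicator_of_mem hs, levelMap, levelMap]
    split_ifs with h
    · rw [Set.indicator_of_mem (Set.mem_Iic.2 (le_min hs h.le))]
    · simp
  · rw [Set.indicator_of_notMem hs]; exact zero_le

variable [CompleteSpace E] [SecondCountableTopology E]

lemma exists_pos_mul_le (c : ℝ≥0) {η : ℝ≥0} (hη : 0 < η) :
    ∃ t : ℝ≥0, 0 < t ∧ t ≤ 1 ∧ ∀ s ≤ t, (c : ℝ≥0∞) * s ≤ η := by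
  refine ⟨min 1 (η / (c + 1)), lt_min one_pos (by positivity), min_le_left _ _, fun s hs => ?_⟩
  have h1 : s ≤ η / (c + 1) := hs.trans (min_le_right _ _)
  rw [le_div_iff₀ (by positivity)] at h1
  have : c * s ≤ η := le_trans (by rw [mul_comm]; gcongr; exact le_self_add) h1
  exact_mod_cast this

/-- The choice of the time horizon in terms of the cutoff level. -/
lemma IsPolyLipschitz.exists_horizon [SecondCountableTopology Y] (hF : IsPolyLipschitz j F)
    (hj : Function.Injective j) (M : ℕ → ℝ≥0) {η : ℝ≥0} (hη : 0 < η) :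
    ∃ Th₀ : ℕ → ℝ≥0, (∀ n, 0 < Th₀ n ∧ Th₀ n ≤ 1) ∧ ∀ Th : ℕ → ℝ≥0, (∀ n, Th n ≤ Th₀ n) →
      (∀ n v₁ v₂, Continuous v₁ → Continuous v₂ → xNormSq j 1 v₁ < ∞ → xNormSq j 1 v₂ < ∞ →
        ∫⁻ s in Set.Iic 1, ‖levelMap j F M Th n v₁ s - levelMap j F M Th n v₂ s‖ₑ ^ 2 ∂timeLeb ≤
          η * xNormSq j 1 fun s => v₁ s - v₂ s) ∧
      (∀ n v, Continuous v → xNormSq j 1 v < ∞ →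
        ∫⁻ s in Set.Iic 1, ‖levelMap j F M Th n v s‖ₑ ^ 2 ∂timeLeb ≤ 1) ∧
      ∀ δ : ℝ≥0, 0 < δ → ∃ t : ℝ≥0, 0 < t ∧ t ≤ 1 ∧ ∀ n v, Continuous v → xNormSq j 1 v < ∞ →
        ∫⁻ s in Set.Iic t, ‖levelMap j F M Th n v s‖ₑ ^ 2 ∂timeLeb ≤ δ := by
  choose c hc using fun n => hF.lintegral_truncMap_sub_le hj (M n) (half_pos hη)
  -- Besides the Lipschitz bound, the horizon at level `n` is to keep the energy below `1 / (n +
  -- 1)`. Then high levels have small energy outright, which makes the smallness for short times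
  -- uniform in `n`.
  have hκ : ∀ n : ℕ, (0 : ℝ≥0) < 1 / (n + 1) / 2 := fun n => by positivity
  choose b hb using fun n => hF.lintegral_truncMap_le hj (M n) (hκ n)
  choose t₁ ht₁ ht₁' ht₁'' using fun n => exists_pos_mul_le (c n) (half_pos hη)
  choose t₂ ht₂ ht₂' ht₂'' using fun n => exists_pos_mul_le (b n) (hκ n)
  refine ⟨fun n => min (t₁ n) (t₂ n), fun n => ⟨lt_min (ht₁ n) (ht₂ n),
    (min_le_left _ _).trans (ht₁' n)⟩, fun Th hTh => ?_⟩
  have hinv : ∀ (t : ℝ≥0) (n : ℕ) (v : ℝ≥0 → V), t ≤ 1 → Continuous v → xNormSq j 1 v < ∞ →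
      ∫⁻ s in Set.Iic t, ‖levelMap j F M Th n v s‖ₑ ^ 2 ∂timeLeb ≤
        ((1 / (n + 1) : ℝ≥0) : ℝ≥0∞) := by
    intro t n v ht hv hfin
    refine (setLIntegral_levelMap_le n v t).trans ?_
    refine (hb n 1 v _ hv hfin measurableSet_Iic
      (Set.Iic_subset_Iic.2 ((min_le_left _ _).trans ht))).trans ?_
    rw [timeLeb_Iic]
    calc _ ≤ ((1 / (n + 1) / 2 : ℝ≥0) : ℝ≥0∞) + ((1 / (n + 1) / 2 : ℝ≥0) : ℝ≥0∞) := by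
          gcongr
          exact ht₂'' n _ ((min_le_right _ _).trans ((hTh n).trans (min_le_right _ _)))
      _ = _ := by rw [← ENNReal.coe_add, add_halves]
  refine ⟨fun n v₁ v₂ h₁ h₂ hf₁ hf₂ => ?_, fun n v hv hfin => ?_, fun δ hδ => ?_⟩
  · refine (setLIntegral_levelMap_sub_le n v₁ v₂ 1).trans ?_
    refine (hc n 1 v₁ v₂ _ h₁ h₂ hf₁ hf₂ measurableSet_Iic
      (Set.Iic_subset_Iic.2 (min_le_left _ _))).trans ?_
    gcongr
    rw [timeLeb_Iic]
    calc _ ≤ ((η / 2 : ℝ≥0) : ℝ≥0∞) + ((η / 2 : ℝ≥0) : ℝ≥0∞) := by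
          gcongr
          exact ht₁'' n _ ((min_le_right _ _).trans ((hTh n).trans (min_le_left _ _)))
      _ = _ := by rw [← ENNReal.coe_add, add_halves]
  · refine (hinv 1 n v le_rfl hv hfin).trans ?_
    have : (1 / (n + 1) : ℝ≥0) ≤ 1 := by
      rw [div_le_one₀ (by positivity)]; exact le_add_self
    exact_mod_cast this
  -- Only the finitely many levels below `m` restrict the time `t`; from `m` on the horizon itself
  -- ensures the bound.
  · obtain ⟨m, hm⟩ : ∃ m : ℕ, (1 / (m + 1) : ℝ≥0) < δ := by
      obtain ⟨m, hm⟩ := exists_nat_one_div_lt (K := ℝ) (NNReal.coe_pos.2 hδ)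
      exact ⟨m, by exact_mod_cast hm⟩
    choose b' hb' using fun n => hF.lintegral_truncMap_le hj (M n) (half_pos hδ)
    obtain ⟨B, hB⟩ : ∃ B : ℝ≥0, ∀ n < m, b' n ≤ B :=
      ⟨∑ n ∈ Finset.range m, b' n, fun n hn =>
        Finset.single_le_sum (f := b') (fun _ _ => zero_le) (Finset.mem_range.2 hn)⟩
    obtain ⟨t, ht, ht1, htB⟩ := exists_pos_mul_le B (half_pos hδ)
    refine ⟨t, ht, ht1, fun n v hv hfin => ?_⟩
    rcases lt_or_ge n m with hn | hn
    · refine (setLIntegral_levelMap_le n v t).trans ?_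
      refine (hb' n 1 v _ hv hfin measurableSet_Iic
        (Set.Iic_subset_Iic.2 ((min_le_left _ _).trans ht1))).trans ?_
      rw [timeLeb_Iic]
      calc _ ≤ ((δ / 2 : ℝ≥0) : ℝ≥0∞) + ((B : ℝ≥0) : ℝ≥0∞) * ((min t (Th n) : ℝ≥0) : ℝ≥0∞) := by
            gcongr
            exact hB n hn
        _ ≤ ((δ / 2 : ℝ≥0) : ℝ≥0∞) + ((δ / 2 : ℝ≥0) : ℝ≥0∞) := by
            gcongr
            exact htB _ (min_le_left _ _)
        _ = _ := by rw [← ENNReal.coe_add, add_halves]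
    · refine (hinv t n v ht1 hv hfin).trans ?_
      have : (1 / (n + 1) : ℝ≥0) ≤ δ := by
        refine le_trans ?_ hm.le
        gcongr
      exact_mod_cast this

/-- The level takes countably many values and is known at time `0`, so each level can be treated
separately. -/
lemma isStronglyProgressive_levelMap {Ω : Type*} {mΩ : MeasurableSpace Ω} {𝓕 : Filtration ℝ≥0 mΩ}
    [SecondCountableTopology Y] (hj : Function.Injective j) (hF : IsPolyLipschitz j F)
    {u : ℝ≥0 → Ω → V} (hu : IsStronglyProgressive 𝓕 u) (hc : ∀ ω, Continuous fun t => u t ω)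
    {N : Ω → ℕ} (hN : Measurable[𝓕 0] N) :
    IsStronglyProgressive 𝓕 fun t ω => levelMap j F M Th (N ω) (fun s => u s ω) t := by
  intro t
  have hN' : Measurable[𝓕 t] N := hN.mono (𝓕.mono (zero_le : (0 : ℝ≥0) ≤ t)) le_rfl
  have hg := isStronglyProgressive_pathGauge hj hu (fun ω s => (hc ω).continuousWithinAt) t
  have hut := hu t
  let := 𝓕 t
  borelize Y
  have h1 : ∀ n, Measurable fun p : Set.Iic t × Ω =>
      levelMap j F M Th n (fun s => u s p.2) (p.1 : ℝ≥0) := fun n => by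
    refine StronglyMeasurable.measurable ?_
    refine StronglyMeasurable.ite
      (measurableSet_lt (measurable_subtype_coe.comp measurable_fst) measurable_const) ?_
      stronglyMeasurable_const
    exact ((measurable_cutoff (M n)).comp hg.measurable).stronglyMeasurable.smul
      (stronglyMeasurable_extend_comp hj hF hut)
  have h2 : Measurable fun q : (Set.Iic t × Ω) × ℕ =>
      levelMap j F M Th q.2 (fun s => u s q.1.2) (q.1.1 : ℝ≥0) :=
    measurable_from_prod_countable_left h1
  exact (h2.comp (measurable_id.prodMk (hN'.comp measurable_snd))).stronglyMeasurable

end LevelMap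

/-! ### Solving the truncated equation -/

section Truncated

variable {Ω E V H : Type*} {mΩ : MeasurableSpace Ω}
  [NormedAddCommGroup E] [NormedSpace ℝ E] [NormedAddCommGroup V] [NormedSpace ℝ V]
  [NormedAddCommGroup H] [NormedSpace ℝ H]

/-- `u` solves, on `[0,1]`, the equation with nonlinearities cut off at the level and the time that
belong to the size of the initial value, and `y` is its part different from the orbit of the
initial value. -/
structure IsTruncSolution (μ : Measure Ω) (𝓕 : Filtration ℝ≥0 mΩ) (W : ℝ≥0 → Ω → ℝ)
    (j : E →L[ℝ] V) (i : V →L[ℝ] H) (S : ℝ≥0 → H →L[ℝ] H) (F : E → H) (G : E → V)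
    (M Th : ℕ → ℝ≥0) (u₀ : Ω → V) (u y : ℝ≥0 → Ω → V) : Prop where
  regular : IsRegularProcess μ 𝓕 j 1 u
  regular_conv : IsRegularProcess μ 𝓕 j 1 y
  conv : ∀ t ≤ 1, IsMildConv μ 𝓕 W i S t
    (fun s ω => levelMap j F M Th ⌊‖u₀ ω‖⌋₊ (fun r => u r ω) s)
    (fun s ω => levelMap j G M Th ⌊‖u₀ ω‖⌋₊ (fun r => u r ω) s) fun ω => i (y t ω)
  mild : ∀ᵐ ω ∂μ, ∀ t ≤ 1, i (u t ω) = S t (i (u₀ ω)) + i (y t ω)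
  gauge_le : ∀ᵐ ω ∂μ, ∀ t ≤ 1, pathGauge j t (fun s => u s ω) + 1 ≤
    pathGauge j t (fun s => y s ω) + M ⌊‖u₀ ω‖⌋₊

variable {μ : Measure Ω} {𝓕 : Filtration ℝ≥0 mΩ} {W : ℝ≥0 → Ω → ℝ}
  {j : E →L[ℝ] V} {i : V →L[ℝ] H} {S : ℝ≥0 → H →L[ℝ] H} {F : E → H} {G : E → V}
  [CompleteSpace E] [SecondCountableTopology E] [CompleteSpace V]
  [SecondCountableTopology V] [CompleteSpace H] [SecondCountableTopology H]
  [IsProbabilityMeasure μ]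

omit [NormedSpace ℝ V] [CompleteSpace V] [SecondCountableTopology V] in
lemma measurable_floor_norm {m : MeasurableSpace Ω} {u₀ : Ω → V} (h : StronglyMeasurable[m] u₀) :
    Measurable[m] fun ω => ⌊‖u₀ ω‖⌋₊ :=
  Nat.measurable_floor.comp h.norm.measurable

omit [CompleteSpace E] [SecondCountableTopology E] [CompleteSpace H] [SecondCountableTopology H]
  [IsProbabilityMeasure μ] in
/-- The orbit of the initial value as a regular process. -/
lemma MildSetting.exists_orbit (h : MildSetting μ 𝓕 W j i S) :
    ∃ C : ℝ≥0, ∀ u₀ : Ω → V, StronglyMeasurable[𝓕 0] u₀ → MemLp u₀ 2 μ →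
      ∃ o : ℝ≥0 → Ω → V, IsRegularProcess μ 𝓕 j 1 o ∧
        (∀ᵐ ω ∂μ, ∀ t ≤ 1, i (o t ω) = S t (i (u₀ ω))) ∧
        ∀ᵐ ω ∂μ, pathGauge j 1 (fun t => o t ω) ≤ C * ‖u₀ ω‖ₑ := by
  obtain ⟨C, hC, hor⟩ := h.regularity.orbit 1 one_pos
  choose v hvX hvi hvn using fun x => hor 1 one_pos le_rfl x
  -- The squared gauge is at most twice the squared norm of `X_1`, and `2 ≤ 2 ^ 2`.
  refine ⟨2 * Real.toNNReal C, fun u₀ hu₀ hu₀L => ?_⟩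
  have hint : ∫⁻ ω, ‖u₀ ω‖ₑ ^ 2 ∂μ < ∞ := lintegral_enorm_sq_lt_top_of_memLp hu₀L
  obtain ⟨o, ho, hov⟩ := h.usual.exists_regular_version (j := j) (T := 1)
    (u := fun t ω => v (u₀ ω) t)
    (fun t ht => stronglyMeasurable_of_injective_comp h.inj_right (by
      simp_rw [hvi _ t ht]
      exact ((S t).comp i).continuous.comp_stronglyMeasurable
        (hu₀.mono (𝓕.mono (zero_le : (0 : ℝ≥0) ≤ t)))))
    (ae_of_all _ fun ω => hvX _) (by
      refine (lintegral_mono fun ω => hvn (u₀ ω)).trans_lt ?_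
      rw [lintegral_const_mul' _ _ (by simp)]
      exact ENNReal.mul_lt_top (by simp) hint)
  refine ⟨o, ho, ?_, ?_⟩
  · filter_upwards [hov] with ω hω t ht
    rw [hω t ht, hvi _ t ht]
  · filter_upwards [hov] with ω hω
    refine (ENNReal.pow_le_pow_left_iff two_ne_zero).1 ?_
    refine pathGauge_sq_le.trans ?_
    rw [xNormSq_congr hω, mul_pow]
    calc _ ≤ 2 * (ENNReal.ofReal (C ^ 2) * ‖u₀ ω‖ₑ ^ 2) := by gcongr; exact hvn _
      _ = 2 * (Real.toNNReal C : ℝ≥0∞) ^ 2 * ‖u₀ ω‖ₑ ^ 2 := by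
        rw [ENNReal.ofReal_pow hC.le, ENNReal.ofReal, mul_assoc]
      _ ≤ 2 ^ 2 * (Real.toNNReal C : ℝ≥0∞) ^ 2 * ‖u₀ ω‖ₑ ^ 2 := by
        gcongr; norm_num
      _ = _ := by push_cast; ring

/-- Solvability of the truncated equations, with a uniform bound for small times. -/
theorem MildSetting.exists_truncSolution (h : MildSetting μ 𝓕 W j i S) (hF : IsPolyLipschitz j F)
    (hG : IsPolyLipschitz j G) :
    ∃ M Th : ℕ → ℝ≥0, (∀ n, 0 < M n) ∧ (∀ n, 0 < Th n ∧ Th n ≤ 1) ∧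
      (∀ u₀ : Ω → V, StronglyMeasurable[𝓕 0] u₀ → ∀ u, IsRegularProcess μ 𝓕 j 1 u →
        MemM2 μ 𝓕 1 (fun s ω => levelMap j F M Th ⌊‖u₀ ω‖⌋₊ (fun r => u r ω) s) ∧
        MemM2 μ 𝓕 1 (fun s ω => levelMap j G M Th ⌊‖u₀ ω‖⌋₊ (fun r => u r ω) s)) ∧
      (∀ δ : ℝ≥0, 0 < δ → ∃ t : ℝ≥0, 0 < t ∧ t ≤ 1 ∧ ∀ u₀ u y, StronglyMeasurable[𝓕 0] u₀ →
        IsTruncSolution μ 𝓕 W j i S F G M Th u₀ u y →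
        ∫⁻ ω, xNormSq j t (fun s => y s ω) ∂μ ≤ δ) ∧
      ∀ u₀ : Ω → V, StronglyMeasurable[𝓕 0] u₀ → MemLp u₀ 2 μ →
        ∃ u y, IsTruncSolution μ 𝓕 W j i S F G M Th u₀ u y := by
  classical
  obtain ⟨C₀, hC₀⟩ := h.exists_orbit
  obtain ⟨C₁, hC₁⟩ := h.exists_mildConv
  obtain ⟨C₂, hC₂⟩ := h.exists_estimate
  -- Since `‖u₀‖ < n + 1`, the gauge of the orbit is at most `C₀ * (n + 1)`. The extra one is the
  -- room left for the convolution part.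
  set M : ℕ → ℝ≥0 := fun n => C₀ * (n + 1) + 1 with hM
  -- Chosen such that `C₂ * (η + η) ≤ 1 / 4`, the contraction factor for squared norms that the
  -- fixed point theorem demands.
  set η : ℝ≥0 := 1 / (8 * (C₂ + 1)) with hη
  have hη0 : 0 < η := by positivity
  obtain ⟨TF, hTF, hTF'⟩ := hF.exists_horizon h.inj_left M hη0
  obtain ⟨TG, hTG, hTG'⟩ := hG.exists_horizon h.inj_left M hη0
  set Th : ℕ → ℝ≥0 := fun n => min (TF n) (TG n) with hTh
  obtain ⟨hF1, hF2, hF3⟩ := hTF' Th fun n => min_le_left _ _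
  obtain ⟨hG1, hG2, hG3⟩ := hTG' Th fun n => min_le_right _ _
  have hMem : ∀ u₀ : Ω → V, StronglyMeasurable[𝓕 0] u₀ → ∀ u, IsRegularProcess μ 𝓕 j 1 u →
        MemM2 μ 𝓕 1 (fun s ω => levelMap j F M Th ⌊‖u₀ ω‖⌋₊ (fun r => u r ω) s) ∧
        MemM2 μ 𝓕 1 (fun s ω => levelMap j G M Th ⌊‖u₀ ω‖⌋₊ (fun r => u r ω) s) := by
    intro u₀ hu₀ u hu
    refine ⟨⟨isStronglyProgressive_levelMap h.inj_left hF hu.prog hu.cont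
      (measurable_floor_norm hu₀), ?_⟩, ⟨isStronglyProgressive_levelMap h.inj_left hG hu.prog
      hu.cont (measurable_floor_norm hu₀), ?_⟩⟩
    · refine (lintegral_mono fun ω => hF2 _ _ (hu.cont ω) (hu.finite ω)).trans_lt ?_
      simp
    · refine (lintegral_mono fun ω => hG2 _ _ (hu.cont ω) (hu.finite ω)).trans_lt ?_
      simp
  refine ⟨M, Th, fun n => by positivity, fun n => ⟨lt_min (hTF n).1 (hTG n).1,
    (min_le_left _ _).trans (hTF n).2⟩, hMem, fun δ hδ => ?_, fun u₀ hu₀ hu₀L => ?_⟩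
  · set δ' : ℝ≥0 := δ / (2 * (C₂ + 1)) with hδ'
    have hδ0 : 0 < δ' := by positivity
    obtain ⟨tF, htF, htF1, htF'⟩ := hF3 δ' hδ0
    obtain ⟨tG, htG, htG1, htG'⟩ := hG3 δ' hδ0
    set t := min tF tG with ht
    have ht1 : t ≤ 1 := (min_le_left _ _).trans htF1
    refine ⟨t, lt_min htF htG, ht1, fun u₀ u y hu₀ hs => ?_⟩
    obtain ⟨hm1, hm2⟩ := hMem u₀ hu₀ u hs.regular
    refine (hC₂ t (lt_min htF htG) _ _ y (hm1.mono ht1) (hm2.mono ht1)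
      (ae_of_all _ fun ω => (hs.regular_conv.cont ω).continuousOn)
      (fun s hst => hs.conv s (hst.trans ht1))).trans ?_
    have e1 : m2NormSq μ t (fun s ω => levelMap j F M Th ⌊‖u₀ ω‖⌋₊ (fun r => u r ω) s) ≤ δ' := by
      refine (lintegral_mono fun ω => ?_ : _ ≤ ∫⁻ _, (δ' : ℝ≥0∞) ∂μ).trans (by simp)
      exact (lintegral_mono_set (Set.Iic_subset_Iic.2 (min_le_left _ _))).trans
        (htF' _ _ (hs.regular.cont ω) (hs.regular.finite ω))
    have e2 : m2NormSq μ t (fun s ω => levelMap j G M Th ⌊‖u₀ ω‖⌋₊ (fun r => u r ω) s) ≤ δ' := by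
      refine (lintegral_mono fun ω => ?_ : _ ≤ ∫⁻ _, (δ' : ℝ≥0∞) ∂μ).trans (by simp)
      exact (lintegral_mono_set (Set.Iic_subset_Iic.2 (min_le_right _ _))).trans
        (htG' _ _ (hs.regular.cont ω) (hs.regular.finite ω))
    have e3 : C₂ * (δ' + δ') ≤ δ := by
      calc C₂ * (δ' + δ') ≤ (C₂ + 1) * (δ' + δ') := by gcongr; exact le_self_add
        _ = δ := by rw [hδ']; field_simp; norm_num
    calc _ ≤ (C₂ : ℝ≥0∞) * (δ' + δ') := by gcongr
      _ ≤ δ := by exact_mod_cast e3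
  · obtain ⟨o, ho, hoS, hog⟩ := hC₀ u₀ hu₀ hu₀L
    have hex : ∀ u, ∃ y, IsRegularProcess μ 𝓕 j 1 u → IsRegularProcess μ 𝓕 j 1 y ∧
        ∀ t ≤ 1, IsMildConv μ 𝓕 W i S t
          (fun s ω => levelMap j F M Th ⌊‖u₀ ω‖⌋₊ (fun r => u r ω) s)
          (fun s ω => levelMap j G M Th ⌊‖u₀ ω‖⌋₊ (fun r => u r ω) s) fun ω => i (y t ω) := by
      intro u
      by_cases hu : IsRegularProcess μ 𝓕 j 1 u
      · obtain ⟨hm1, hm2⟩ := hMem u₀ hu₀ u hu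
        obtain ⟨y, hy, hyc, -⟩ := hC₁ 1 one_pos _ _ hm1 hm2
        exact ⟨y, fun _ => ⟨hy, hyc⟩⟩
      · exact ⟨0, fun hu' => absurd hu' hu⟩
    choose Y hY using hex
    obtain ⟨u, hu, hfix⟩ := h.usual.exists_fixedPoint (μ := μ) (T := 1) h.inj_left
      (Ψ := fun u t ω => o t ω + Y u t ω) (fun u hu => ho.add h.inj_left (hY u hu).1)
      (fun u v hu hv => by
        obtain ⟨hm1, hm2⟩ := hMem u₀ hu₀ u hu
        obtain ⟨hn1, hn2⟩ := hMem u₀ hu₀ v hv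
        -- The orbit of the initial value cancels; the rest is the convolution of the differences of
        -- the data.
        simp only [add_sub_add_left_eq_sub]
        refine (hC₂ 1 one_pos _ _ (fun t ω => Y u t ω - Y v t ω) (hm1.sub hn1) (hm2.sub hn2)
          (ae_of_all _ fun ω => (((hY u hu).1.cont ω).sub ((hY v hv).1.cont ω)).continuousOn)
          (fun t ht => by
            simp only [map_sub]
            exact ((hY u hu).2 t ht).sub h.semigroup ((hY v hv).2 t ht) (hm1.mono ht).ae_memLp
              (hn1.mono ht).ae_memLp)).trans ?_
        set X := ∫⁻ ω, xNormSq j 1 (fun t => u t ω - v t ω) ∂μ with hX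
        have e1 : m2NormSq μ 1 (fun s ω => levelMap j F M Th ⌊‖u₀ ω‖⌋₊ (fun r => u r ω) s -
            levelMap j F M Th ⌊‖u₀ ω‖⌋₊ (fun r => v r ω) s) ≤ η * X := by
          rw [hX, ← lintegral_const_mul' _ _ (by simp)]
          exact lintegral_mono fun ω => hF1 _ _ _ (hu.cont ω) (hv.cont ω) (hu.finite ω) (hv.finite ω)
        have e2 : m2NormSq μ 1 (fun s ω => levelMap j G M Th ⌊‖u₀ ω‖⌋₊ (fun r => u r ω) s -
            levelMap j G M Th ⌊‖u₀ ω‖⌋₊ (fun r => v r ω) s) ≤ η * X := by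
          rw [hX, ← lintegral_const_mul' _ _ (by simp)]
          exact lintegral_mono fun ω => hG1 _ _ _ (hu.cont ω) (hv.cont ω) (hu.finite ω) (hv.finite ω)
        have e3 : C₂ * (η + η) ≤ 1 / 4 := by
          calc C₂ * (η + η) ≤ (C₂ + 1) * (η + η) := by gcongr; exact le_self_add
            _ = 1 / 4 := by rw [hη]; field_simp; norm_num
        have e4 : (C₂ : ℝ≥0∞) * (η + η) ≤ 1 / 4 := by
          have : ((C₂ * (η + η) : ℝ≥0) : ℝ≥0∞) ≤ ((1 / 4 : ℝ≥0) : ℝ≥0∞) := by exact_mod_cast e3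
          refine (le_of_eq (by push_cast; rfl)).trans (this.trans (le_of_eq ?_))
          rw [ENNReal.coe_div (by norm_num)]; simp
        calc _ ≤ (C₂ : ℝ≥0∞) * (η * X + η * X) := by gcongr
          _ = (C₂ : ℝ≥0∞) * (η + η) * X := by ring
          _ ≤ _ := by gcongr)
    refine ⟨u, Y u, hu, (hY u hu).1, (hY u hu).2, ?_, ?_⟩
    · filter_upwards [hfix, hoS] with ω h1 h2 t ht
      rw [← h1 t ht, map_add, h2 t ht]
    · filter_upwards [hfix, hog] with ω h1 h2 t ht
      have h3 : pathGauge j t (fun s => u s ω) ≤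
          pathGauge j t (fun s => Y u s ω) + pathGauge j t fun s => o s ω := by
        refine (pathGauge_le_add_sub h.inj_left (hu.cont ω).aestronglyMeasurable
          ((hY u hu).1.cont ω).aestronglyMeasurable).trans ?_
        gcongr
        refine le_of_eq (pathGauge_congr fun s hs => ?_)
        rw [← h1 s (hs.trans ht), add_sub_cancel_right]
      have h4 : pathGauge j t (fun s => o s ω) ≤ (C₀ * (⌊‖u₀ ω‖⌋₊ + 1) : ℝ≥0) := by
        refine (pathGauge_mono ht).trans (h2.trans ?_)
        push_cast
        gcongr
        have := (Nat.lt_floor_add_one (‖u₀ ω‖)).le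
        have h5 : ‖u₀ ω‖₊ ≤ (⌊‖u₀ ω‖⌋₊ + 1 : ℝ≥0) := by exact_mod_cast this
        rw [enorm_eq_nnnorm]
        exact_mod_cast h5
      calc _ ≤ pathGauge j t (fun s => Y u s ω) + (C₀ * (⌊‖u₀ ω‖⌋₊ + 1) : ℝ≥0) + 1 := by
            gcongr; exact h3.trans (by gcongr)
        _ = _ := by rw [hM]; push_cast; ring

end Truncated

/-! ### Hitting times of increasing continuous functions -/

section Hitting

variable {g : ℝ≥0 → ℝ≥0∞} {c c' : ℝ≥0∞} {t : ℝ≥0}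

/-- The first time at which `g` reaches the level `c`. -/
noncomputable def hitTime (g : ℝ≥0 → ℝ≥0∞) (c : ℝ≥0∞) : ℝ≥0 := sInf {t | c ≤ g t}

lemma hitTime_le_iff (hm : Monotone g) (hc : Continuous g) (hne : ∃ t, c ≤ g t) :
    hitTime g c ≤ t ↔ c ≤ g t := by
  have hcl : IsClosed {t | c ≤ g t} := isClosed_le continuous_const hc
  have hmem : hitTime g c ∈ {t | c ≤ g t} := hcl.csInf_mem hne (OrderBot.bddBelow _)
  exact ⟨fun h => le_trans hmem (hm h), fun h => csInf_le (OrderBot.bddBelow _) h⟩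

lemma lt_hitTime_iff (hm : Monotone g) (hc : Continuous g) (hne : ∃ t, c ≤ g t) :
    t < hitTime g c ↔ g t < c := by
  rw [← not_le, hitTime_le_iff hm hc hne, not_le]

lemma hitTime_mono (hm : Monotone g) (hc : Continuous g) (hne : ∃ t, c' ≤ g t) (h : c ≤ c') :
    hitTime g c ≤ hitTime g c' :=
  (hitTime_le_iff hm hc (hne.imp fun _ ht => h.trans ht)).2
    (h.trans ((hitTime_le_iff hm hc hne).1 le_rfl))

/-- By continuity from the left, `g` is at most `c < c'` at a positive hitting time of `c`. At time
`0` this argument fails, and `h0` takes its place. -/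
lemma hitTime_lt_hitTime (hm : Monotone g) (hc : Continuous g) (hne : ∃ t, c' ≤ g t)
    (h0 : g 0 < c') (h : c < c') : hitTime g c < hitTime g c' := by
  have hne' : ∃ t, c ≤ g t := hne.imp fun _ ht => h.le.trans ht
  rw [lt_hitTime_iff hm hc hne]
  rcases eq_or_ne (hitTime g c) 0 with h1 | h1
  · rwa [h1]
  refine lt_of_le_of_lt ?_ h
  have hpos : 0 < hitTime g c := pos_iff_ne_zero.2 h1
  have : (𝓝[<] hitTime g c).NeBot := nhdsLT_neBot_of_exists_lt ⟨0, hpos⟩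
  refine le_of_tendsto (x := 𝓝[<] hitTime g c) (hc.tendsto _ |>.mono_left nhdsWithin_le_nhds) ?_
  filter_upwards [self_mem_nhdsWithin] with s hs
  exact ((lt_hitTime_iff hm hc hne').1 hs).le

lemma tendsto_hitTime (hm : Monotone g) (hc : Continuous g) (hne : ∃ t, c ≤ g t) {a : ℕ → ℝ≥0∞}
    (ha : ∀ n, a n ≤ c) (hac : Tendsto a atTop (𝓝 c)) :
    Tendsto (fun n => hitTime g (a n)) atTop (𝓝 (hitTime g c)) := by
  refine tendsto_order.2 ⟨fun t ht => ?_, fun t ht => Eventually.of_forall fun n =>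
    (hitTime_mono hm hc hne (ha n)).trans_lt ht⟩
  filter_upwards [hac.eventually_const_lt ((lt_hitTime_iff hm hc hne).1 ht)] with n hn
  exact (lt_hitTime_iff hm hc (hne.imp fun _ ht => (ha n).trans ht)).2 hn

lemma isStoppingTime_hitTime {Ω : Type*} {mΩ : MeasurableSpace Ω} {𝓕 : Filtration ℝ≥0 mΩ}
    {g : Ω → ℝ≥0 → ℝ≥0∞} (hm : ∀ ω, Monotone (g ω)) (hc : ∀ ω, Continuous (g ω))
    (hne : ∀ ω, ∃ t, c ≤ g ω t) (hg : ∀ t, Measurable[𝓕 t] fun ω => g ω t) :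
    IsStoppingTime 𝓕 fun ω => ((hitTime (g ω) c : ℝ≥0) : WithTop ℝ≥0) := by
  intro t
  have : {ω | ((hitTime (g ω) c : ℝ≥0) : WithTop ℝ≥0) ≤ t} = {ω | c ≤ g ω t} := by
    ext ω
    simp only [Set.mem_ofPred_eq]
    rw [WithTop.coe_le_coe, hitTime_le_iff (hm ω) (hc ω) (hne ω)]
  rw [this]
  exact hg t measurableSet_Ici

end Hitting

/-! ### A gauge for the onset of the cutoff -/

section LevelGauge

variable {E V Y : Type*} [NormedAddCommGroup E] [NormedSpace ℝ E]
  [NormedAddCommGroup V] [NormedSpace ℝ V] [NormedAddCommGroup Y] [NormedSpace ℝ Y]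
  {j : E →L[ℝ] V} {F : E → Y} {M Th : ℕ → ℝ≥0} {n : ℕ} {v : ℝ≥0 → V} {s : ℝ≥0}

/-- It is less than one as long as the cutoff in `levelMap` is not active. -/
noncomputable def levelGauge (j : E →L[ℝ] V) (M Th : ℕ → ℝ≥0) (n : ℕ) (v : ℝ≥0 → V) (t : ℝ≥0) :
    ℝ≥0∞ :=
  max (pathGauge j (min t 1) v / M n) (t / Th n)

lemma monotone_levelGauge : Monotone (levelGauge j M Th n v) := fun s t hst => by
  unfold levelGauge
  have := pathGauge_mono (j := j) (v := v) (min_le_min_right 1 hst)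
  gcongr

/-- The quotient of times forces the level one to be reached no later than the horizon, so the
corresponding hitting time is finite. -/
lemma one_le_levelGauge (hT : 0 < Th n) : 1 ≤ levelGauge j M Th n v (Th n) := by
  refine le_max_of_le_right ?_
  rw [ENNReal.div_self (by simpa using hT.ne') (by simp)]

lemma levelGauge_lt_one_iff (hM : 0 < M n) (hT : 0 < Th n) :
    levelGauge j M Th n v s < 1 ↔ pathGauge j (min s 1) v < M n ∧ s < Th n := by
  rw [levelGauge, max_lt_iff, ENNReal.div_lt_iff (by simp [hM.ne']) (by simp),
    ENNReal.div_lt_iff (by simp [hT.ne']) (by simp), one_mul, one_mul, ENNReal.coe_lt_coe]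

lemma levelMap_eq_extend (hM : 0 < M n) (hT : 0 < Th n) (hT1 : Th n ≤ 1)
    (h : levelGauge j M Th n v s < 1) :
    levelMap j F M Th n v s = Function.extend j F 0 (v s) := by
  obtain ⟨h1, h2⟩ := (levelGauge_lt_one_iff hM hT).1 h
  rw [min_eq_left (h2.le.trans hT1)] at h1
  rw [levelMap, if_pos h2, truncMap_of_le h1.le]

variable [CompleteSpace E] [SecondCountableTopology E]

lemma continuous_levelGauge (hj : Function.Injective j) (hv : Continuous v)
    (hfin : xNormSq j 1 v < ∞) (hM : 0 < M n) (hT : 0 < Th n) :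
    Continuous (levelGauge j M Th n v) := by
  refine Continuous.max ?_ ?_
  · exact (ENNReal.continuous_div_const _ (by simp [hM.ne'])).comp
      (continuous_pathGauge hj hv (pathEnergy_le_xNormSq.trans_lt hfin))
  · exact (ENNReal.continuous_div_const _ (by simp [hT.ne'])).comp ENNReal.continuous_coe

omit [CompleteSpace E] [SecondCountableTopology E] [NormedAddCommGroup E] [NormedSpace ℝ E]
  [NormedAddCommGroup V] [NormedSpace ℝ V] in
lemma measurable_eval_nat {α β : Type*} {m : MeasurableSpace α} {m' : MeasurableSpace β}
    {f : ℕ → α → β} (hf : ∀ n, Measurable (f n)) {N : α → ℕ} (hN : Measurable N) :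
    Measurable fun a => f (N a) a :=
  (measurable_from_prod_countable_left (f := fun q : α × ℕ => f q.2 q.1) hf).comp
    (measurable_id.prodMk hN)

lemma measurable_levelGauge {Ω : Type*} {mΩ : MeasurableSpace Ω} {𝓕 : Filtration ℝ≥0 mΩ}
    (hj : Function.Injective j) {u : ℝ≥0 → Ω → V} (hu : IsStronglyProgressive 𝓕 u)
    (hc : ∀ ω, Continuous fun t => u t ω) {N : Ω → ℕ} (hN : Measurable[𝓕 0] N) (t : ℝ≥0) :
    Measurable[𝓕 t] fun ω => levelGauge j M Th (N ω) (fun s => u s ω) t := by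
  have hN' : Measurable[𝓕 t] N := hN.mono (𝓕.mono (zero_le : (0 : ℝ≥0) ≤ t)) le_rfl
  have hg0 := (isStronglyProgressive_pathGauge hj hu
    (fun ω s => (hc ω).continuousWithinAt)).stronglyAdapted (min t 1)
  have hg : Measurable[𝓕 t] fun ω => pathGauge j (min t 1) fun s => u s ω :=
    (hg0.mono (𝓕.mono (min_le_left _ _))).measurable
  exact measurable_eval_nat (f := fun n ω => levelGauge j M Th n (fun s => u s ω) t)
    (fun n => (Measurable.div_const hg _).max (@measurable_const _ _ _ (𝓕 t) _)) hN'

end LevelGauge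

/-! ### From the truncated equation to a local mild solution -/

section Solution

variable {Ω E V H : Type*} {mΩ : MeasurableSpace Ω}
  [NormedAddCommGroup E] [NormedSpace ℝ E] [NormedAddCommGroup V] [NormedSpace ℝ V]
  [NormedAddCommGroup H] [NormedSpace ℝ H]
  {μ : Measure Ω} {𝓕 : Filtration ℝ≥0 mΩ} {W : ℝ≥0 → Ω → ℝ}
  {j : E →L[ℝ] V} {i : V →L[ℝ] H} {S : ℝ≥0 → H →L[ℝ] H} {F : E → H} {G : E → V}
  [CompleteSpace E] [SecondCountableTopology E] [CompleteSpace V]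
  [SecondCountableTopology V] [CompleteSpace H] [SecondCountableTopology H]
  [IsProbabilityMeasure μ]

omit [CompleteSpace E] [SecondCountableTopology E] [CompleteSpace V] [SecondCountableTopology V]
  [CompleteSpace H] [SecondCountableTopology H] [IsProbabilityMeasure μ] in
-- The convolution is the image under `i` of the continuous path that maximal regularity provides.
lemma MildSetting.continuousOn_conv (h : MildSetting μ 𝓕 W j i S) {T : ℝ≥0} {f : ℝ≥0 → H}
    (hT : 0 < T) (hf : MemLp f 2 (timeLeb.restrict (Set.Iic T))) :
    ContinuousOn (fun t => ∫ r in Set.Iic t, S (t - r) (f r) ∂timeLeb) (Set.Iic T) := by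
  obtain ⟨C, -, hC⟩ := h.regularity.det_conv
  obtain ⟨v, hv, hvi, -⟩ := hC T hT f hf
  exact (i.continuous.comp_continuousOn hv.1).congr fun t ht => (hvi t ht).symm

omit [SecondCountableTopology H] in
lemma MildSetting.exists_itoConv (h : MildSetting μ 𝓕 W j i S) {T : ℝ≥0} (hT : 0 < T)
    {ξ : ℝ≥0 → Ω → V} (hξ : MemM2 μ 𝓕 T ξ) :
    ∃ y : ℝ≥0 → Ω → V, IsRegularProcess μ 𝓕 j T y ∧
      ∀ t ≤ T, IsItoIntegral μ 𝓕 W t (fun r ω => S (t - r) (i (ξ r ω))) fun ω => i (y t ω) := by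
  obtain ⟨C, hC⟩ := h.exists_mildConv
  obtain ⟨y, hy, hyc, -⟩ := hC T hT (fun _ _ => 0) ξ
    ⟨fun _ => stronglyMeasurable_const, by simp⟩ hξ
  refine ⟨y, hy, fun t ht => ?_⟩
  obtain ⟨J, hJ, hJy⟩ := hyc t ht
  refine hJ.congr (ae_of_all _ fun ω => ae_of_all _ fun s => rfl) ?_
  filter_upwards [hJy] with ω hω
  simp [hω]

variable {M Th : ℕ → ℝ≥0} {u₀ : Ω → V} {u y : ℝ≥0 → Ω → V}

/-- Up to the time where the cutoff becomes active, the solution of the truncated equation is a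
local mild solution. -/
theorem IsTruncSolution.isLocalMildSolution (h : MildSetting μ 𝓕 W j i S)
    (hM : ∀ n, 0 < M n) (hT : ∀ n, 0 < Th n ∧ Th n ≤ 1) (hu₀ : StronglyMeasurable[𝓕 0] u₀)
    (hs : IsTruncSolution μ 𝓕 W j i S F G M Th u₀ u y)
    (hF2 : MemM2 μ 𝓕 1 fun s ω => levelMap j F M Th ⌊‖u₀ ω‖⌋₊ (fun r => u r ω) s)
    (hG2 : MemM2 μ 𝓕 1 fun s ω => levelMap j G M Th ⌊‖u₀ ω‖⌋₊ (fun r => u r ω) s)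
    (h0 : ∀ᵐ ω ∂μ, levelGauge j M Th ⌊‖u₀ ω‖⌋₊ (fun r => u r ω) 0 < 1) :
    IsLocalMildSolution μ 𝓕 W j i S F G u₀ u fun ω =>
      (hitTime (levelGauge j M Th ⌊‖u₀ ω‖⌋₊ fun r => u r ω) 1 : ℝ≥0∞) := by
  classical
  set g : Ω → ℝ≥0 → ℝ≥0∞ := fun ω => levelGauge j M Th ⌊‖u₀ ω‖⌋₊ fun r => u r ω with hg
  have hu := hs.regular
  have hgm : ∀ ω, Monotone (g ω) := fun ω => monotone_levelGauge
  have hgc : ∀ ω, Continuous (g ω) := fun ω =>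
    continuous_levelGauge h.inj_left (hu.cont ω) (hu.finite ω) (hM _) (hT _).1
  have hgT : ∀ ω, 1 ≤ g ω (Th ⌊‖u₀ ω‖⌋₊) := fun ω => one_le_levelGauge (hT _).1
  have hne : ∀ ω, ∃ t, 1 ≤ g ω t := fun ω => ⟨_, hgT ω⟩
  have hga : ∀ t, Measurable[𝓕 t] fun ω => g ω t := fun t =>
    measurable_levelGauge h.inj_left hu.prog hu.cont (measurable_floor_norm hu₀) t
  -- The hitting times of levels increasing to one announce the hitting time of one. They are
  -- strictly smaller since the gauge starts below one.
  obtain ⟨a, ham, ha1, hat⟩ := exists_seq_strictMono_tendsto' (show (0 : ℝ≥0∞) < 1 by simp)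
  have ha1' : ∀ n, a n < 1 := fun n => (ha1 n).2
  have hne' : ∀ n ω, ∃ t, a n ≤ g ω t := fun n ω => (hne ω).imp fun _ ht => (ha1' n).le.trans ht
  set τ : Ω → ℝ≥0 := fun ω => hitTime (g ω) 1 with hτ
  set τm : ℕ → Ω → ℝ≥0 := fun n ω => hitTime (g ω) (a n) with hτm
  have hτT : ∀ ω, τ ω ≤ Th ⌊‖u₀ ω‖⌋₊ := fun ω => (hitTime_le_iff (hgm ω) (hgc ω) (hne ω)).2 (hgT ω)
  have hτ1 : ∀ ω, τ ω ≤ 1 := fun ω => (hτT ω).trans (hT _).2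
  have hτmτ : ∀ n ω, τm n ω ≤ τ ω := fun n ω =>
    hitTime_mono (hgm ω) (hgc ω) (hne ω) (ha1' n).le
  have hann : Announces μ 𝓕 τm fun ω => (τ ω : ℝ≥0∞) := by
    refine ⟨fun n => isStoppingTime_hitTime hgm hgc (hne' n) hga, ?_⟩
    filter_upwards [h0] with ω hω
    refine ⟨fun m n hmn => hitTime_mono (hgm ω) (hgc ω) (hne' n ω) (ham.monotone hmn),
      fun m => ?_, ?_⟩
    · exact_mod_cast hitTime_lt_hitTime (hgm ω) (hgc ω) (hne ω) hω (ha1' m)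
    · exact ENNReal.tendsto_coe.2
        (tendsto_hitTime (hgm ω) (hgc ω) (hne ω) (fun n => (ha1' n).le) hat)
  have hlt : ∀ {s ω}, s < τ ω → g ω s < 1 := fun {s ω} hs' =>
    (lt_hitTime_iff (hgm ω) (hgc ω) (hne ω)).1 hs'
  have hextF : ∀ {s ω}, s < τ ω →
      levelMap j F M Th ⌊‖u₀ ω‖⌋₊ (fun r => u r ω) s = Function.extend j F 0 (u s ω) :=
    fun {s ω} hs' => levelMap_eq_extend (hM _) (hT _).1 (hT _).2 (hlt hs')
  have hextG : ∀ {s ω}, s < τ ω →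
      levelMap j G M Th ⌊‖u₀ ω‖⌋₊ (fun r => u r ω) s = Function.extend j G 0 (u s ω) :=
    fun {s ω} hs' => levelMap_eq_extend (hM _) (hT _).1 (hT _).2 (hlt hs')
  refine ⟨⟨isStoppingTime_hitTime hgm hgc hne hga, fun n ω => τm n ω, hann.1, ?_⟩, ⟨?_, ?_⟩,
    τm, hann, fun m => ⟨fun t => ?_, ?_⟩⟩
  · filter_upwards [hann.2] with ω hω
    exact ⟨fun m n hmn => ENNReal.coe_le_coe.2 (hω.1 hmn), hω.2⟩
  · intro t
    refine (hu.prog.stronglyAdapted t).indicator ?_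
    have : {ω | (t : ℝ≥0∞) < (τ ω : ℝ≥0∞)} = {ω | g ω t < 1} := by
      ext ω
      simp only [Set.mem_ofPred_eq]
      rw [ENNReal.coe_lt_coe, lt_hitTime_iff (hgm ω) (hgc ω) (hne ω)]
    rw [this]
    exact hga t measurableSet_Iio
  · exact ae_of_all _ fun ω => (hu.cont ω).continuousOn
  · refine (lintegral_mono fun ω => ?_).trans_lt hu.sqInt
    exact xNormSq_mono ((min_le_right _ _).trans ((hτmτ m ω).trans (hτ1 ω)))
  -- The integrand stopped at `τm m`. It is square integrable on `[0, 1]`, so its stochastic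
  -- convolution `z` has a continuous version in `V`.
  · set ξ : ℝ≥0 → Ω → V := fun s ω => if s < τm m ω then
      levelMap j G M Th ⌊‖u₀ ω‖⌋₊ (fun r => u r ω) s else 0 with hξ
    have hξM : MemM2 μ 𝓕 1 ξ := by
      refine ⟨fun t => ?_, lt_of_le_of_lt (lintegral_mono fun ω => lintegral_mono fun s => ?_) hG2.2⟩
      · have hgp : IsStronglyProgressive 𝓕 fun t ω => g ω t :=
          StronglyAdapted.isStronglyProgressive_of_continuous
            (fun t => (hga t).stronglyMeasurable) hgc
        have h1 := (hgp t).measurable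
        have h2 := hG2.1 t
        let := 𝓕 t
        have h3 : MeasurableSet {p : Set.Iic t × Ω | (p.1 : ℝ≥0) < τm m p.2} := by
          have : {p : Set.Iic t × Ω | (p.1 : ℝ≥0) < τm m p.2} =
              {p : Set.Iic t × Ω | g p.2 p.1 < a m} := by
            ext p
            simp only [Set.mem_ofPred_eq]
            rw [lt_hitTime_iff (hgm _) (hgc _) (hne' m _)]
          rw [this]
          exact measurableSet_lt h1 measurable_const
        exact h2.ite h3 stronglyMeasurable_const
      · simp only [hξ]
        split_ifs
        · exact le_rfl
        · simp
    have hξe : ∀ s ω, ξ s ω = if s < τm m ω then Function.extend j G 0 (u s ω) else 0 := by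
      intro s ω
      simp only [hξ]
      split_ifs with h1
      · exact hextG (h1.trans_le (hτmτ m ω))
      · rfl
    obtain ⟨z, hz, hzI⟩ := h.exists_itoConv one_pos hξM
    have hJ1 : ∀ t ≤ 1, ∀ ω, S (t - 1) (i (z t ω)) = i (z t ω) := fun t ht ω => by
      rw [tsub_eq_zero_of_le ht, h.semigroup.map_zero]; rfl
    -- The definition requires the stochastic term at all times. As the integrand vanishes after `τm
    -- m ≤ 1`, its convolution evolves by the semigroup from time `1` on; for `t ≤ 1` the truncated
    -- subtraction gives `S 0`.
    refine ⟨fun t ω => S (t - 1) (i (z t ω)), ae_of_all _ fun ω => ?_, fun t => ?_, ?_⟩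
    · exact h.semigroup.continuous_uncurry.comp
        ((continuous_id.sub continuous_const).prodMk (i.continuous.comp (hz.cont ω)))
    · have hind : ∀ s ω, (Set.Iio (τm m ω)).indicator
          (fun s' => S (t - s') (i (Function.extend j G 0 (u s' ω)))) s = S (t - s) (i (ξ s ω)) := by
        intro s ω
        rw [hξe]
        by_cases hs' : s < τm m ω
        · rw [Set.indicator_of_mem (Set.mem_Iio.2 hs'), if_pos hs']
        · rw [Set.indicator_of_notMem (by simpa using hs'), if_neg hs', map_zero, map_zero]
      simp_rw [hind]
      rcases le_total t 1 with ht | ht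
      · simp_rw [hJ1 t ht]
        exact hzI t ht
      · have := (hzI 1 le_rfl).map_extend (S (t - 1)) ht
        refine this.congr (ae_of_all _ fun ω => ae_of_all _ fun s => ?_) (ae_of_all _ fun ω => ?_)
        · split_ifs with h1
          · rw [← ContinuousLinearMap.comp_apply, ← h.semigroup.map_add,
              tsub_add_tsub_cancel ht h1]
          · rw [hξe, if_neg (fun h2 => h1 (h2.le.trans ((hτmτ m ω).trans (hτ1 ω)))), map_zero,
              map_zero]
        · dsimp only
          rw [hz.eq_min t, min_eq_right ht]
    -- For a fixed time `t ≤ τm m` the stopped and the unstopped integrands differ at most at `s =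
    -- t`, so locality identifies the integrals. Continuity of all terms then allows the random time
    -- `min t (τm m)` to be inserted.
    · have hconv : ∀ t, ∀ᵐ ω ∂μ, t ∈ Set.Iic (τm m ω) → i (y t ω) =
          (∫ r in Set.Iic t, S (t - r) (levelMap j F M Th ⌊‖u₀ ω‖⌋₊ (fun r => u r ω) r) ∂timeLeb)
            + i (z t ω) := by
        intro t
        rcases le_or_gt t 1 with ht | ht
        · refine (hs.conv t ht).ae_eq_on h.wiener (A := {ω | t ∈ Set.Iic (τm m ω)})
            (f' := fun s ω => levelMap j F M Th ⌊‖u₀ ω‖⌋₊ (fun r => u r ω) s) (ξ' := ξ)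
            ⟨_, hzI t ht, ae_of_all _ fun ω => rfl⟩ (ae_of_all _ fun ω hω => ?_)
          have hω' : t ≤ τm m ω := hω
          filter_upwards [ae_restrict_mem measurableSet_Iic,
            ae_restrict_of_ae (compl_mem_ae_iff.2 (measure_singleton (μ := timeLeb) t))] with s h1 h2
          refine ⟨rfl, ?_⟩
          simp only [hξ]
          rw [if_pos]
          exact (lt_of_le_of_ne h1 h2).trans_le hω'
        · refine ae_of_all _ fun ω hω => ?_
          exact absurd (((Set.mem_Iic.1 hω).trans (hτmτ m ω)).trans (hτ1 ω)) (not_le.2 ht)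
      have hpath := ae_eq_path_of_forall_ae_eq (μ := μ) (u := fun t ω => i (y t ω))
        (A := fun ω => Set.Iic (τm m ω))
        (ae_of_all _ fun ω s hs' r hr => Set.mem_Iic.2 (hr.trans hs'))
        (ae_of_all _ fun ω s _ => (i.continuous.comp (hs.regular_conv.cont ω)).continuousOn)
        (by
          filter_upwards [hF2.ae_memLp] with ω hω s hs'
          refine ContinuousOn.add ((h.continuousOn_conv one_pos hω).mono
            (Set.Iic_subset_Iic.2 ((Set.mem_Iic.1 hs').trans ((hτmτ m ω).trans (hτ1 ω)))))
            (i.continuous.comp (hz.cont ω)).continuousOn) hconv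
      intro t
      filter_upwards [hpath, hs.mild] with ω h1 h2
      have hle : min t (τm m ω) ≤ 1 := (min_le_right _ _).trans ((hτmτ m ω).trans (hτ1 ω))
      rw [h2 _ hle, h1 _ (Set.mem_Iic.2 (min_le_right _ _)), hJ1 _ hle, add_assoc]
      congr 2
      refine integral_congr_ae ?_
      filter_upwards [ae_restrict_mem measurableSet_Iic,
        ae_restrict_of_ae (compl_mem_ae_iff.2
          (measure_singleton (μ := timeLeb) (min t (τm m ω))))] with s h3 h4
      rw [hextF]
      exact ((lt_of_le_of_ne h3 h4).trans_le (min_le_right _ _)).trans_le (hτmτ m ω)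

end Solution

/-! ### The uniform lower bound for the life time -/

section Lifetime

variable {Ω E V H : Type*} {mΩ : MeasurableSpace Ω}
  [NormedAddCommGroup E] [NormedSpace ℝ E] [NormedAddCommGroup V] [NormedSpace ℝ V]
  [NormedAddCommGroup H] [NormedSpace ℝ H]
  {μ : Measure Ω} {𝓕 : Filtration ℝ≥0 mΩ} {W : ℝ≥0 → Ω → ℝ}
  {j : E →L[ℝ] V} {i : V →L[ℝ] H} {S : ℝ≥0 → H →L[ℝ] H} {F : E → H} {G : E → V}
  [CompleteSpace E] [SecondCountableTopology E] [CompleteSpace V]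
  [SecondCountableTopology V] [CompleteSpace H] [SecondCountableTopology H]
  [IsProbabilityMeasure μ]

omit [NormedSpace ℝ V] [CompleteSpace V] [SecondCountableTopology V] in
/-- Markov's inequality for the size of the initial value. -/
lemma measure_le_norm_le {u₀ : Ω → V} (hu₀ : MemLp u₀ 2 μ) {R : ℝ} (hR : ∫ ω, ‖u₀ ω‖ ^ 2 ∂μ ≤ R ^ 2)
    {n : ℝ} (hn : 0 < n) : μ {ω | n ≤ ‖u₀ ω‖} ≤ ENNReal.ofReal (R ^ 2 / n ^ 2) := by
  have hint : Integrable (fun ω => ‖u₀ ω‖ ^ 2) μ := hu₀.integrable_norm_pow two_ne_zero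
  have h1 := mul_meas_ge_le_integral_of_nonneg (ae_of_all μ fun ω => sq_nonneg ‖u₀ ω‖) hint (n ^ 2)
  have h2 : {ω | n ≤ ‖u₀ ω‖} = {ω | n ^ 2 ≤ ‖u₀ ω‖ ^ 2} := by
    ext ω
    simp only [Set.mem_ofPred_eq]
    rw [pow_le_pow_iff_left₀ hn.le (norm_nonneg _) two_ne_zero]
  rw [h2, ← ofReal_measureReal]
  refine ENNReal.ofReal_le_ofReal ?_
  rw [le_div_iff₀ (by positivity), mul_comm]
  exact h1.trans hR

/-- Existence of local mild solutions with a uniform lower bound for the life time. -/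
theorem MildSetting.exists_localMildSolution (h : MildSetting μ 𝓕 W j i S)
    (hF : IsPolyLipschitz j F) (hG : IsPolyLipschitz j G) :
    ∃ tau : ℝ → ℝ → ℝ, (∀ ε R : ℝ, 0 < ε → 0 < R → 0 < tau ε R) ∧
      ∀ u₀ : Ω → V, StronglyMeasurable[𝓕 0] u₀ → MemLp u₀ 2 μ →
        ∃ (u : ℝ≥0 → Ω → V) (T₁ : Ω → ℝ≥0∞), IsLocalMildSolution μ 𝓕 W j i S F G u₀ u T₁ ∧
          ∀ ε R : ℝ, 0 < ε → 0 < R → ∫ ω, ‖u₀ ω‖ ^ 2 ∂μ ≤ R ^ 2 →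
            ENNReal.ofReal (1 - ε) ≤ μ {ω | ENNReal.ofReal (tau ε R) ≤ T₁ ω} := by
  obtain ⟨M, Th, hM, hT, hMem, hsmall, hex⟩ := h.exists_truncSolution hF hG
  have key : ∀ ε R : ℝ, ∃ t : ℝ≥0, 0 < t ∧ (0 < ε → 0 < R → t ≤ 1 ∧
      ∃ n₀ : ℕ, 0 < n₀ ∧ R ^ 2 / n₀ ^ 2 ≤ ε / 2 ∧ (∀ n ≤ n₀, t < Th n) ∧
      ∀ u₀ u y, StronglyMeasurable[𝓕 0] u₀ → IsTruncSolution μ 𝓕 W j i S F G M Th u₀ u y →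
        ∫⁻ ω, xNormSq j t (fun s => y s ω) ∂μ ≤ ENNReal.ofReal (ε / 4)) := by
    intro ε R
    by_cases hεR : 0 < ε ∧ 0 < R
    · obtain ⟨hε, hR⟩ := hεR
      obtain ⟨t, ht, ht1, hty⟩ := hsmall (Real.toNNReal (ε / 4)) (by simpa using hε)
      obtain ⟨n₀, hn₀⟩ : ∃ n₀ : ℕ, 2 * R ^ 2 / ε + 1 < n₀ := exists_nat_gt _
      have hpos : 0 ≤ 2 * R ^ 2 / ε := by positivity
      have hn₁ : (1 : ℝ) ≤ n₀ := by linarith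
      obtain ⟨b, hb, hbT⟩ : ∃ b : ℝ≥0, 0 < b ∧ ∀ n ≤ n₀, b ≤ Th n := by
        obtain ⟨m, -, hm⟩ := Finset.exists_min_image (Finset.range (n₀ + 1)) Th
          (Finset.nonempty_range_iff.2 (Nat.succ_ne_zero _))
        exact ⟨Th m, (hT m).1, fun n hn => hm n (Finset.mem_range.2 (Nat.lt_succ_of_le hn))⟩
      -- Half of the smallest horizon, since the time has to lie strictly before every `Th n` with
      -- `n ≤ n₀`.
      refine ⟨min t (b / 2), lt_min ht (by positivity), fun _ _ => ⟨(min_le_left _ _).trans ht1, n₀,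
        by exact_mod_cast hn₁, ?_, fun n hn => ?_, fun u₀ u y hu₀ hs => ?_⟩⟩
      · rw [div_le_iff₀ (by positivity)]
        have h1 : 2 * R ^ 2 / ε ≤ (n₀ : ℝ) ^ 2 := by nlinarith
        rw [div_le_iff₀ hε] at h1
        linarith
      · exact ((min_le_right _ _).trans_lt (half_lt_self hb)).trans_le (hbT n hn)
      · exact (lintegral_mono fun ω => xNormSq_mono (min_le_left _ _)).trans (hty u₀ u y hu₀ hs)
    · exact ⟨1, one_pos, fun h1 h2 => absurd ⟨h1, h2⟩ hεR⟩
  choose tau htau htau' using key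
  refine ⟨fun ε R => tau ε R, fun ε R _ _ => NNReal.coe_pos.2 (htau ε R), fun u₀ hu₀ hu₀L => ?_⟩
  obtain ⟨u, y, hs⟩ := hex u₀ hu₀ hu₀L
  have hu := hs.regular
  have hy := hs.regular_conv
  -- The second moment of `y 0` is bounded by that of the norm of `y` on arbitrarily short
  -- intervals, which is below any `δ`.
  have hy0 : ∀ᵐ ω ∂μ, y 0 ω = 0 := by
    have h1 : ∫⁻ ω, ‖y 0 ω‖ₑ ^ 2 ∂μ = 0 := by
      refine le_antisymm (ENNReal.le_of_forall_pos_le_add fun δ hδ _ => ?_) zero_le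
      obtain ⟨t, ht, ht1, hty⟩ := hsmall δ hδ
      rw [zero_add]
      exact (lintegral_mono fun ω => enorm_sq_le_xNormSq (v := fun s => y s ω) zero_le).trans
        (hty u₀ u y hu₀ hs)
    rw [lintegral_eq_zero_iff
      ((((hy.prog.stronglyAdapted 0).mono (𝓕.le 0)).enorm.pow_const 2))] at h1
    filter_upwards [h1] with ω hω
    simpa using hω
  have h0 : ∀ᵐ ω ∂μ, levelGauge j M Th ⌊‖u₀ ω‖⌋₊ (fun r => u r ω) 0 < 1 := by
    filter_upwards [hy0, hs.gauge_le] with ω h1 h2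
    rw [levelGauge_lt_one_iff (hM _) (hT _).1]
    refine ⟨?_, (hT _).1⟩
    have h3 := h2 0 zero_le
    rw [pathGauge_zero (v := fun s => y s ω), h1, enorm_zero, zero_add] at h3
    rw [min_eq_left zero_le]
    exact (ENNReal.lt_add_right (ne_top_of_le_ne_top ENNReal.coe_ne_top
      (le_self_add.trans h3)) one_ne_zero).trans_le h3
  obtain ⟨hm1, hm2⟩ := hMem u₀ hu₀ u hu
  refine ⟨u, _, hs.isLocalMildSolution h hM hT hu₀ hm1 hm2 h0, fun ε R hε hR hle => ?_⟩
  obtain ⟨ht1, n₀, hn₀, hRn, hTn, hy⟩ := htau' ε R hε hR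
  -- The threshold `1 / 2` is the one that gives a gauge below one, as the squared gauge is at most
  -- twice the squared norm. Markov's inequality doubles `ε / 4`.
  have hbad2 : μ {ω | (1 / 2 : ℝ≥0∞) ≤ xNormSq j (tau ε R) fun s => y s ω} ≤
      ENNReal.ofReal (ε / 2) := by
    have h1 := mul_meas_ge_le_lintegral (μ := μ)
      (hs.regular_conv.measurable h.inj_left (tau ε R)) (1 / 2)
    have h2 := h1.trans (hy u₀ u y hu₀ hs)
    have h3 : (2 : ℝ≥0∞) * (1 / 2) = 1 := by
      rw [one_div, ENNReal.mul_inv_cancel (by simp) (by simp)]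
    calc _ = 2 * ((1 / 2) * μ {ω | (1 / 2 : ℝ≥0∞) ≤ xNormSq j (tau ε R) fun s => y s ω}) := by
          rw [← mul_assoc, h3, one_mul]
      _ ≤ 2 * ENNReal.ofReal (ε / 4) := by gcongr
      _ = ENNReal.ofReal (ε / 2) := by
        rw [← ENNReal.ofReal_ofNat 2, ← ENNReal.ofReal_mul (by norm_num)]
        congr 1; ring
  set D : Set Ω := {ω | ENNReal.ofReal (tau ε R) ≤
    ((hitTime (levelGauge j M Th ⌊‖u₀ ω‖⌋₊ fun r => u r ω) 1 : ℝ≥0) : ℝ≥0∞)} with hD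
  -- A short life is possible only if the initial value is large or the convolution part is large;
  -- each event costs `ε / 2`. Otherwise the gauge of `u` stays below `M`, because `M` leaves room
  -- for one.
  have hDc : μ Dᶜ ≤ ENNReal.ofReal ε := by
    calc μ Dᶜ ≤ μ ({ω | (n₀ : ℝ) ≤ ‖u₀ ω‖} ∪
          {ω | (1 / 2 : ℝ≥0∞) ≤ xNormSq j (tau ε R) fun s => y s ω}) := by
          refine measure_mono_ae ?_
          filter_upwards [hs.gauge_le] with ω h1 h2
          by_contra h3
          have h4 : ω ∉ {ω | (n₀ : ℝ) ≤ ‖u₀ ω‖} := fun h5 => h3 (Or.inl h5)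
          have h5 : ω ∉ {ω | (1 / 2 : ℝ≥0∞) ≤ xNormSq j (tau ε R) fun s => y s ω} :=
            fun h5 => h3 (Or.inr h5)
          simp only [Set.mem_ofPred_eq, not_le] at h4 h5
          refine h2 ?_
          simp only [hD, Set.mem_ofPred_eq]
          rw [ENNReal.ofReal_coe_nnreal, ENNReal.coe_le_coe]
          refine le_of_lt ((lt_hitTime_iff monotone_levelGauge (continuous_levelGauge h.inj_left
            (hu.cont ω) (hu.finite ω) (hM _) (hT _).1) ⟨_, one_le_levelGauge (hT _).1⟩).2 ?_)
          rw [levelGauge_lt_one_iff (hM _) (hT _).1, min_eq_left ht1]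
          refine ⟨?_, hTn _ (Nat.floor_le_of_le h4.le)⟩
          have h6 : pathGauge j (tau ε R) (fun s => y s ω) < 1 := by
            rw [← ENNReal.pow_lt_pow_left_iff two_ne_zero, one_pow]
            refine pathGauge_sq_le.trans_lt ?_
            calc _ < 2 * (1 / 2 : ℝ≥0∞) := by
                  rw [ENNReal.mul_lt_mul_iff_right (by simp) (by simp)]; exact h5
              _ = 1 := by rw [one_div, ENNReal.mul_inv_cancel (by simp) (by simp)]
          have h7 := h1 (tau ε R) ht1
          have h8 : pathGauge j (tau ε R) (fun s => y s ω) + (M ⌊‖u₀ ω‖⌋₊ : ℝ≥0∞) <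
              1 + M ⌊‖u₀ ω‖⌋₊ := by
            exact ENNReal.add_lt_add_of_lt_of_le ENNReal.coe_ne_top h6 le_rfl
          have h9 := h7.trans_lt h8
          rw [add_comm 1 (M ⌊‖u₀ ω‖⌋₊ : ℝ≥0∞)] at h9
          exact lt_of_add_lt_add_right h9
      _ ≤ ENNReal.ofReal (ε / 2) + ENNReal.ofReal (ε / 2) := by
          refine (measure_union_le _ _).trans (add_le_add ?_ hbad2)
          refine (measure_le_norm_le hu₀L hle (by exact_mod_cast hn₀)).trans ?_
          exact ENNReal.ofReal_le_ofReal hRn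
      _ = ENNReal.ofReal ε := by
          rw [← ENNReal.ofReal_add (by positivity) (by positivity), add_halves]
  rw [ENNReal.ofReal_sub 1 hε.le, ENNReal.ofReal_one, tsub_le_iff_right]
  calc (1 : ℝ≥0∞) = μ (D ∪ Dᶜ) := by rw [Set.union_compl_self, measure_univ]
    _ ≤ μ D + μ Dᶜ := measure_union_le _ _
    _ ≤ μ D + ENNReal.ofReal ε := by gcongr

end Lifetime

/-! ### Nonlinearities along two paths of bounded norm -/

section Localized

variable {E V Y : Type*} [NormedAddCommGroup E] [NormedSpace ℝ E]
  [NormedAddCommGroup V] [NormedSpace ℝ V] [NormedAddCommGroup Y] [NormedSpace ℝ Y]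
  {j : E →L[ℝ] V} {P : E → Y} {D B : Set ℝ≥0} {v : ℝ≥0 → V} {K : ℝ≥0}

lemma setLIntegral_subNorm_sq_le (hB : BddAbove B) (hg : ∀ s ∈ B, pathGauge j s v ≤ K) :
    ∫⁻ s in B, subNorm j (v s) ^ 2 ∂timeLeb ≤ ((K ^ 2 : ℝ≥0) : ℝ≥0∞) := by
  refine setLIntegral_le_of_forall_Iic hB fun s hs => ?_
  refine (pathEnergy_le_pathGauge_sq (j := j) (v := v)).trans ?_
  push_cast
  gcongr
  exact hg s hs

variable [CompleteSpace E] [SecondCountableTopology E]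

lemma ae_restrict_subNorm_lt_top (hj : Function.Injective j) (hB : BddAbove B)
    (hv : AEStronglyMeasurable v (timeLeb.restrict B)) (hg : ∀ s ∈ B, pathGauge j s v ≤ K) :
    ∀ᵐ s ∂(timeLeb.restrict B), subNorm j (v s) < ∞ := by
  have h := (setLIntegral_subNorm_sq_le hB hg).trans_lt ENNReal.coe_lt_top
  filter_upwards [ae_lt_top' ((aemeasurable_subNorm_comp hj hv).pow_const 2) h.ne] with s hs
  by_contra h1
  rw [not_lt, top_le_iff] at h1
  simp [h1] at hs

omit [NormedSpace ℝ Y] in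
open Classical in
/-- The difference of the nonlinearities along two paths whose difference vanishes up to time `a`,
restricted to the times where the norms of the paths are bounded. -/
lemma IsPolyLipschitz.lintegral_localized_sub_le (hP : IsPolyLipschitz j P)
    (hj : Function.Injective j) (K : ℝ≥0) (hK : 1 ≤ K) {η : ℝ≥0} (hη : 0 < η) :
    ∃ c : ℝ≥0, ∀ (w₁ w₂ z : ℝ≥0 → V) (D : Set ℝ≥0) (a b : ℝ≥0), (∀ s ∈ D, ∀ r ≤ s, r ∈ D) →
      AEStronglyMeasurable w₁ (timeLeb.restrict (Set.Iic b)) →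
      AEStronglyMeasurable w₂ (timeLeb.restrict (Set.Iic b)) →
      (∀ s ∈ D, pathGauge j s w₁ ≤ K) → (∀ s ∈ D, pathGauge j s w₂ ≤ K) →
      (∀ s ∈ D, s ≤ b → w₁ s - w₂ s = z s) →
      (∀ᵐ s ∂(timeLeb.restrict (Set.Iic a)), z s = 0) →
      ∫⁻ s in Set.Iic b, ‖(if s ∈ D then Function.extend j P 0 (w₁ s) else 0) -
        (if s ∈ D then Function.extend j P 0 (w₂ s) else 0)‖ₑ ^ 2 ∂timeLeb ≤
        (η + c * ((b - a : ℝ≥0) : ℝ≥0∞)) * xNormSq j b z := by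
  obtain ⟨c, hc⟩ := hP.lintegral_sub_le hj (K ^ 2) hη
  refine ⟨c, fun w₁ w₂ z D a b hD hm₁ hm₂ hg₁ hg₂ hz ha => ?_⟩
  -- Up to time `a` the paths agree almost everywhere on `D`, so only later times count and the
  -- large constant meets the factor `b - a`. The bound is expressed by `z`, which is controlled on
  -- all of `[0, b]`, whereas the paths are controlled on `D` only.
  set B := D ∩ Set.Ioc a b with hB
  have hDm : MeasurableSet D :=
    Set.OrdConnected.measurableSet ⟨fun x _ y hy s hs => hD y hy s hs.2⟩
  have hBm : MeasurableSet B := hDm.inter measurableSet_Ioc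
  have hBb : B ⊆ Set.Iic b := fun s hs => hs.2.2
  have hBdd : BddAbove B := bddAbove_Iic.mono hBb
  have hgB₁ : ∀ s ∈ B, pathGauge j s w₁ ≤ K := fun s hs => hg₁ s hs.1
  have hgB₂ : ∀ s ∈ B, pathGauge j s w₂ ≤ K := fun s hs => hg₂ s hs.1
  have hm₁' := hm₁.mono_measure (Measure.restrict_mono_set timeLeb hBb)
  have hm₂' := hm₂.mono_measure (Measure.restrict_mono_set timeLeb hBb)
  have h1 : ∫⁻ s in Set.Iic b, ‖(if s ∈ D then Function.extend j P 0 (w₁ s) else 0) -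
        (if s ∈ D then Function.extend j P 0 (w₂ s) else 0)‖ₑ ^ 2 ∂timeLeb ≤
      ∫⁻ s in B, ‖Function.extend j P 0 (w₁ s) - Function.extend j P 0 (w₂ s)‖ₑ ^ 2 ∂timeLeb := by
    rw [← lintegral_indicator measurableSet_Iic, ← lintegral_indicator hBm]
    refine lintegral_mono_ae ?_
    filter_upwards [(ae_restrict_iff' measurableSet_Iic).1 ha] with s hs
    by_cases hsb : s ∈ Set.Iic b
    · rw [Set.indicator_of_mem hsb]
      by_cases hsD : s ∈ D
      · rw [if_pos hsD, if_pos hsD]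
        by_cases hsa : s ∈ Set.Iic a
        · have h2 := hz s hsD hsb
          rw [hs hsa] at h2
          rw [sub_eq_zero.1 h2]
          simp
        · rw [Set.indicator_of_mem (Set.mem_inter hsD (Set.mem_Ioc.2 ⟨not_le.1 hsa, hsb⟩))]
      · simp [hsD]
    · rw [Set.indicator_of_notMem hsb]; exact zero_le
  refine h1.trans ((hc (timeLeb.restrict B) w₁ w₂ (xNormSq j b z)
    (aemeasurable_subNorm_comp hj hm₁') ?_ (setLIntegral_subNorm_sq_le hBdd hgB₁) ?_).trans ?_)
  · have hKK : (K : ℝ≥0∞) ≤ ((K ^ 2 : ℝ≥0) : ℝ≥0∞) := by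
      exact_mod_cast le_self_pow₀ hK (by norm_num)
    filter_upwards [ae_restrict_mem hBm, ae_restrict_subNorm_lt_top hj hBdd hm₁' hgB₁,
      ae_restrict_subNorm_lt_top hj hBdd hm₂' hgB₂] with s h2 h3 h4
    refine ⟨((enorm_le_pathGauge (j := j) s).trans (hgB₁ s h2)).trans hKK,
      ((enorm_le_pathGauge (j := j) s).trans (hgB₂ s h2)).trans hKK, h3, h4, ?_⟩
    rw [hz s h2.1 h2.2.2]
    exact enorm_sq_le_xNormSq h2.2.2
  · calc _ = ∫⁻ s in B, subNorm j (z s) ^ 2 ∂timeLeb :=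
          setLIntegral_congr_fun hBm fun s hs => by simp only [hz s hs.1 hs.2.2]
      _ ≤ ∫⁻ s in Set.Iic b, subNorm j (z s) ^ 2 ∂timeLeb := lintegral_mono_set hBb
      _ ≤ _ := pathEnergy_le_xNormSq
  · gcongr
    rw [Measure.restrict_apply_univ, ← timeLeb_Ioc]
    exact measure_mono Set.inter_subset_right

omit [NormedSpace ℝ Y] in
open Classical in
-- On the set of times where the gauge is at most `K`, the energy of the nonlinearity has a
-- deterministic bound; no moments of `w` are needed.
lemma memM2_localized [SecondCountableTopology Y] {Ω : Type*} {mΩ : MeasurableSpace Ω}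
    {μ : Measure Ω} [IsProbabilityMeasure μ] {𝓕 : Filtration ℝ≥0 mΩ} (hP : IsPolyLipschitz j P)
    (hj : Function.Injective j) {w : ℝ≥0 → Ω → V} (hw : IsStronglyProgressive 𝓕 w)
    {D : Ω → Set ℝ≥0} (hD : ∀ ω, ∀ s ∈ D ω, ∀ r ≤ s, r ∈ D ω)
    (hDm : ∀ t, MeasurableSet[Subtype.instMeasurableSpace.prod (𝓕 t)]
      {p : Set.Iic t × Ω | (p.1 : ℝ≥0) ∈ D p.2})
    (hK : 1 ≤ K) (hg : ∀ ω, ∀ s ∈ D ω, pathGauge j s (fun r => w r ω) ≤ K) (T : ℝ≥0) :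
    MemM2 μ 𝓕 T fun s ω => if s ∈ D ω then Function.extend j P 0 (w s ω) else 0 := by
  obtain ⟨c, hc⟩ := hP.lintegral_extend_le hj K hK one_pos
  refine ⟨fun t => ?_, ?_⟩
  · exact StronglyMeasurable.ite (hDm t) (stronglyMeasurable_extend_comp hj hP (hw t))
      stronglyMeasurable_const
  · refine (lintegral_mono (g := fun _ => (1 : ℝ≥0) + c * (T : ℝ≥0∞)) fun ω => ?_).trans_lt
      (by simp [ENNReal.mul_lt_top])
    have hDo : MeasurableSet (D ω) :=
      Set.OrdConnected.measurableSet ⟨fun x _ y hy s hs => hD ω y hy s hs.2⟩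
    have hsub : D ω ∩ Set.Iic T ⊆ Set.Iic T := Set.inter_subset_right
    have hBdd : BddAbove (D ω ∩ Set.Iic T) := bddAbove_Iic.mono hsub
    have hm : AEStronglyMeasurable (fun s => w s ω) (timeLeb.restrict (D ω ∩ Set.Iic T)) :=
      (hw.aestronglyMeasurable_path T ω).mono_measure (Measure.restrict_mono_set timeLeb hsub)
    have hgB : ∀ s ∈ D ω ∩ Set.Iic T, pathGauge j s (fun r => w r ω) ≤ K := fun s hs => hg ω s hs.1
    have := hc (fun s => w s ω) (D ω ∩ Set.Iic T) (hDo.inter measurableSet_Iic) hBdd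
      (aemeasurable_subNorm_comp hj hm) hgB (ae_restrict_subNorm_lt_top hj hBdd hm hgB)
    calc _ ≤ ∫⁻ s in D ω ∩ Set.Iic T, ‖Function.extend j P 0 (w s ω)‖ₑ ^ 2 ∂timeLeb := by
          rw [← lintegral_indicator measurableSet_Iic,
            ← lintegral_indicator (hDo.inter measurableSet_Iic)]
          refine lintegral_mono fun s => ?_
          by_cases h1 : s ∈ Set.Iic T
          · rw [Set.indicator_of_mem h1]
            beta_reduce
            by_cases h2 : s ∈ D ω
            · rw [if_pos h2, Set.indicator_of_mem (Set.mem_inter h2 h1)]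
            · simp [h2]
          · rw [Set.indicator_of_notMem h1]; exact zero_le
      _ ≤ _ := this
      _ ≤ _ := add_le_add le_rfl
        (mul_le_mul_right ((measure_mono hsub).trans (timeLeb_Iic T).le) _)

end Localized

/-! ### Uniqueness of local mild solutions -/

section Uniqueness

variable {Ω E V H : Type*} {mΩ : MeasurableSpace Ω}
  [NormedAddCommGroup E] [NormedSpace ℝ E] [NormedAddCommGroup V] [NormedSpace ℝ V]
  [NormedAddCommGroup H] [NormedSpace ℝ H]

/-- A process solves the mild equation up to (but not at) the random time `lam`. -/
structure IsStoppedSolution (μ : Measure Ω) (𝓕 : Filtration ℝ≥0 mΩ) (W : ℝ≥0 → Ω → ℝ)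
    (j : E →L[ℝ] V) (i : V →L[ℝ] H) (S : ℝ≥0 → H →L[ℝ] H) (F : E → H) (G : E → V)
    (u₀ : Ω → V) (w : ℝ≥0 → Ω → V) (lam : Ω → ℝ≥0) : Prop where
  prog : IsStronglyProgressive 𝓕 w
  rightCont : ∀ ω s, ContinuousWithinAt (fun t => w t ω) (Set.Ici s) s
  cont : ∀ᵐ ω ∂μ, ContinuousOn (fun t => w t ω) (Set.Iio (lam ω))
  finite : ∀ t, ∀ᵐ ω ∂μ, t < lam ω → pathGauge j t (fun s => w s ω) < ∞
  mild : ∀ t, ∃ f ξ Y, IsMildConv μ 𝓕 W i S t f ξ Y ∧ ∀ᵐ ω ∂μ, t < lam ω →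
    i (w t ω) = S t (i (u₀ ω)) + Y ω ∧ ∀ s ≤ t,
      f s ω = Function.extend j F 0 (w s ω) ∧ ξ s ω = Function.extend j G 0 (w s ω)

variable {μ : Measure Ω} {𝓕 : Filtration ℝ≥0 mΩ} {W : ℝ≥0 → Ω → ℝ}
  {j : E →L[ℝ] V} {i : V →L[ℝ] H} {S : ℝ≥0 → H →L[ℝ] H} {F : E → H} {G : E → V}
  [CompleteSpace E] [SecondCountableTopology E] [CompleteSpace V]
  [SecondCountableTopology V] [CompleteSpace H] [SecondCountableTopology H]
  [IsProbabilityMeasure μ] {u₀ : Ω → V} {w w₁ w₂ : ℝ≥0 → Ω → V} {lam : Ω → ℝ≥0}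

omit [CompleteSpace V] [CompleteSpace H] [SecondCountableTopology H] [IsProbabilityMeasure μ] in
/-- Local mild solutions, stopped before a member of the announcing sequence. -/
lemma exists_isStoppedSolution (h : MildSetting μ 𝓕 W j i S) {u : ℝ≥0 → Ω → V} {τ : Ω → ℝ≥0∞}
    {σ : Ω → ℝ≥0} (hu : IsAdmissible μ 𝓕 u τ) (hσ : ∀ᵐ ω ∂μ, (σ ω : ℝ≥0∞) < τ ω)
    (hfin : ∀ t : ℝ≥0, ∫⁻ ω, xNormSq j (min t (σ ω)) (fun s => u s ω) ∂μ < ∞)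
    {J : ℝ≥0 → Ω → H}
    (hJ : ∀ t : ℝ≥0, IsItoIntegral μ 𝓕 W t
        (fun s ω => (Set.Iio (σ ω)).indicator
          (fun s' => S (t - s') (i (Function.extend j G 0 (u s' ω)))) s) (J t))
    (hmild : ∀ t : ℝ≥0, ∀ᵐ ω ∂μ,
        i (u (min t (σ ω)) ω) = S (min t (σ ω)) (i (u₀ ω))
          + (∫ s in Set.Iic (min t (σ ω)),
              S (min t (σ ω) - s) (Function.extend j F 0 (u s ω)) ∂timeLeb)
          + J (min t (σ ω)) ω)
    (hlam : ∀ t, MeasurableSet[𝓕 t] {ω | t < lam ω}) (hle : ∀ ω, lam ω ≤ σ ω) :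
    ∃ w, IsStoppedSolution μ 𝓕 W j i S F G u₀ w lam ∧
      ∀ᵐ ω ∂μ, ∀ t < lam ω, w t ω = u t ω := by
  classical
  set A : Set Ω := {ω | (σ ω : ℝ≥0∞) < τ ω ∧
    ContinuousOn (fun t => u t ω) {t : ℝ≥0 | (t : ℝ≥0∞) < τ ω}} with hA
  have hAae : ∀ᵐ ω ∂μ, ω ∈ A := by filter_upwards [hσ, hu.2] with ω h1 h2 using ⟨h1, h2⟩
  have hlt : ∀ ω ∈ A, ∀ t < lam ω, (t : ℝ≥0∞) < τ ω := fun ω hω t ht =>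
    lt_trans (ENNReal.coe_lt_coe.2 (ht.trans_le (hle ω))) hω.1
  -- The process is killed at `lam` and set to zero on a null set. It may jump at `lam` but is
  -- continuous from the right everywhere, hence progressive.
  set w : ℝ≥0 → Ω → V := fun t ω => if ω ∈ A ∧ t < lam ω then u t ω else 0 with hw
  have hwu : ∀ ω ∈ A, ∀ t < lam ω, w t ω = u t ω := fun ω hω t ht => if_pos ⟨hω, ht⟩
  have hw0 : ∀ ω, ω ∉ A → ∀ t, w t ω = 0 := fun ω hω t => if_neg fun h1 => hω h1.1
  have hca : ∀ ω ∈ A, ∀ s < lam ω, ContinuousAt (fun t => w t ω) s := by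
    intro ω hω s hs
    have h1 : ContinuousAt (fun t => u t ω) s :=
      hω.2.continuousAt ((isOpen_lt ENNReal.continuous_coe continuous_const).mem_nhds
        (hlt ω hω s hs))
    refine h1.congr ?_
    filter_upwards [isOpen_Iio.mem_nhds (Set.mem_Iio.2 hs)] with t ht
    exact (hwu ω hω t ht).symm
  have hrc : ∀ ω s, ContinuousWithinAt (fun t => w t ω) (Set.Ici s) s := by
    intro ω s
    by_cases hω : ω ∈ A
    · rcases lt_or_ge s (lam ω) with hs | hs
      · exact (hca ω hω s hs).continuousWithinAt
      · have h1 : ∀ t ∈ Set.Ici s, w t ω = 0 := fun t ht =>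
          if_neg fun h2 => absurd h2.2 (not_lt.2 (hs.trans ht))
        exact continuousWithinAt_const.congr h1 (h1 s Set.self_mem_Ici)
    · simp_rw [hw0 ω hω]
      exact continuousWithinAt_const
  have hprog : IsStronglyProgressive 𝓕 w := by
    refine isStronglyProgressive_of_rightContinuous (fun t => ?_) hrc
    have h1 := (hu.1 t).indicator ((h.usual.measurableSet_of_ae hAae t).inter (hlam t))
    convert h1 using 1
    ext ω
    by_cases h2 : ω ∈ A ∩ {ω | t < lam ω}
    · have h3 : ω ∈ {ω | (t : ℝ≥0∞) < τ ω} := hlt ω h2.1 t h2.2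
      rw [hwu ω h2.1 t h2.2, Set.indicator_of_mem h2, Set.indicator_of_mem h3]
    · rw [Set.indicator_of_notMem h2]
      exact if_neg h2
  refine ⟨w, ⟨hprog, hrc, ?_, fun t => ?_, fun t => ?_⟩, ?_⟩
  · filter_upwards [hAae] with ω hω s hs
    exact (hca ω hω s hs).continuousWithinAt
  · have hgm := ((isStronglyProgressive_pathGauge h.inj_left hprog hrc).stronglyAdapted t).mono
      (𝓕.le t)
    have hm : Measurable fun ω => if t < lam ω then pathGauge j t (fun s => w s ω) ^ 2 else 0 :=
      Measurable.ite (𝓕.le t _ (hlam t)) (hgm.measurable.pow_const 2) measurable_const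
    have hi : ∫⁻ ω, (if t < lam ω then pathGauge j t (fun s => w s ω) ^ 2 else 0) ∂μ < ∞ := by
      refine (lintegral_mono_ae (g := fun ω => 2 * xNormSq j (min t (σ ω)) fun s => u s ω)
        ?_).trans_lt ?_
      · filter_upwards [hAae] with ω hω
        split_ifs with h1
        · rw [min_eq_left (h1.le.trans (hle ω)),
            ← xNormSq_congr fun s hs => hwu ω hω s (lt_of_le_of_lt hs h1)]
          exact pathGauge_sq_le
        · exact zero_le
      · rw [lintegral_const_mul' _ _ (by simp)]
        exact ENNReal.mul_lt_top (by simp) (hfin t)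
    filter_upwards [ae_lt_top hm hi.ne] with ω h1 h2
    rw [if_pos h2] at h1
    by_contra h3
    rw [not_lt, top_le_iff] at h3
    simp [h3] at h1
  -- For `t < lam ≤ σ` the random time `min t (σ ω)` equals `t`, so the equation at stopped times
  -- becomes an equation at the deterministic time `t`.
  · refine ⟨fun s ω => Function.extend j F 0 (u s ω),
      fun s ω => (Set.Iio (σ ω)).indicator (fun s' => Function.extend j G 0 (u s' ω)) s,
      fun ω => (∫ s in Set.Iic t, S (t - s) (Function.extend j F 0 (u s ω)) ∂timeLeb) + J t ω,
      ⟨J t, ?_, ae_of_all _ fun ω => rfl⟩, ?_⟩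
    · refine (hJ t).congr (ae_of_all _ fun ω => ae_of_all _ fun s => ?_) (ae_of_all _ fun ω => rfl)
      dsimp only
      by_cases hs : s ∈ Set.Iio (σ ω)
      · rw [Set.indicator_of_mem hs, Set.indicator_of_mem hs]
      · rw [Set.indicator_of_notMem hs, Set.indicator_of_notMem hs, map_zero, map_zero]
    · filter_upwards [hAae, hmild t] with ω hω h1 h2
      rw [min_eq_left (h2.le.trans (hle ω))] at h1
      refine ⟨by rw [hwu ω hω t h2, h1, add_assoc], fun s hs => ?_⟩
      have h3 : s < lam ω := lt_of_le_of_lt hs h2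
      rw [hwu ω hω s h3, Set.indicator_of_mem (Set.mem_Iio.2 (h3.trans_le (hle ω)))]
      exact ⟨rfl, rfl⟩
  · filter_upwards [hAae] with ω hω t ht
    exact hwu ω hω t ht

open Classical in
/-- On a set of times where the norm is bounded, a stopped solution is given by a mild convolution
with square integrable data. -/
lemma IsStoppedSolution.exists_conv (h : MildSetting μ 𝓕 W j i S) (hF : IsPolyLipschitz j F)
    (hG : IsPolyLipschitz j G) (hw : IsStoppedSolution μ 𝓕 W j i S F G u₀ w lam) {K T : ℝ≥0}
    (hT : 0 < T) {D : Ω → Set ℝ≥0} (hD : ∀ ω, ∀ s ∈ D ω, ∀ r ≤ s, r ∈ D ω)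
    (hDm : ∀ t, MeasurableSet[Subtype.instMeasurableSpace.prod (𝓕 t)]
      {p : Set.Iic t × Ω | (p.1 : ℝ≥0) ∈ D p.2})
    (hDl : ∀ ω, ∀ s ∈ D ω, s < lam ω)
    (hK : 1 ≤ K) (hg : ∀ ω, ∀ s ∈ D ω, pathGauge j s (fun r => w r ω) ≤ K) :
    ∃ y : ℝ≥0 → Ω → V, IsRegularProcess μ 𝓕 j T y ∧
      (∀ t ≤ T, IsMildConv μ 𝓕 W i S t
        (fun s ω => if s ∈ D ω then Function.extend j F 0 (w s ω) else 0)
        (fun s ω => if s ∈ D ω then Function.extend j G 0 (w s ω) else 0) fun ω => i (y t ω)) ∧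
      ∀ t ≤ T, ∀ᵐ ω ∂μ, t ∈ D ω → i (w t ω) = S t (i (u₀ ω)) + i (y t ω) := by
  obtain ⟨C, hC⟩ := h.exists_mildConv
  obtain ⟨y, hy, hyc, -⟩ := hC T hT _ _
    (memM2_localized (μ := μ) hF h.inj_left hw.prog hD hDm hK hg T)
    (memM2_localized (μ := μ) hG h.inj_left hw.prog hD hDm hK hg T)
  refine ⟨y, hy, hyc, fun t ht => ?_⟩
  obtain ⟨f, ξ, Y, hY, hmild⟩ := hw.mild t
  have := (hyc t ht).ae_eq_on h.wiener hY (A := {ω | t ∈ D ω}) (by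
    filter_upwards [hmild] with ω h1 h2
    filter_upwards [ae_restrict_mem measurableSet_Iic] with s hs
    rw [if_pos (hD ω t h2 s hs), if_pos (hD ω t h2 s hs)]
    have := (h1 (hDl ω t h2)).2 s hs
    exact ⟨this.1.symm, this.2.symm⟩)
  filter_upwards [this, hmild] with ω h1 h2 h3
  rw [(h2 (hDl ω t h3)).1, h1 h3]

/-- Stopped solutions with the same initial value agree. -/
theorem IsStoppedSolution.ae_eq (h : MildSetting μ 𝓕 W j i S) (hF : IsPolyLipschitz j F)
    (hG : IsPolyLipschitz j G) (hlam : ∀ t, MeasurableSet[𝓕 t] {ω | t < lam ω})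
    (hw₁ : IsStoppedSolution μ 𝓕 W j i S F G u₀ w₁ lam)
    (hw₂ : IsStoppedSolution μ 𝓕 W j i S F G u₀ w₂ lam) {T : ℝ≥0} (hT : 0 < T) :
    ∀ᵐ ω ∂μ, T < lam ω → ∀ s ≤ T, w₁ s ω = w₂ s ω := by
  classical
  -- Random initial intervals on which both norms are bounded. They exhaust the times before `lam`,
  -- as the gauges are almost surely finite there.
  set D : ℕ → Ω → Set ℝ≥0 := fun n ω => {t | t < lam ω ∧
    pathGauge j t (fun s => w₁ s ω) ≤ ((n + 1 : ℝ≥0) : ℝ≥0∞) ∧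
    pathGauge j t (fun s => w₂ s ω) ≤ ((n + 1 : ℝ≥0) : ℝ≥0∞)} with hDdef
  have hD : ∀ n ω, ∀ s ∈ D n ω, ∀ r ≤ s, r ∈ D n ω := fun n ω s hs r hr =>
    ⟨lt_of_le_of_lt hr hs.1, (pathGauge_mono hr).trans hs.2.1, (pathGauge_mono hr).trans hs.2.2⟩
  have hlamp : IsStronglyProgressive 𝓕 fun t ω => if t < lam ω then (1 : ℝ) else 0 := by
    refine isStronglyProgressive_of_rightContinuous
      (fun t => stronglyMeasurable_const.ite (hlam t) stronglyMeasurable_const) fun ω s => ?_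
    rcases lt_or_ge s (lam ω) with hs | hs
    · refine ContinuousAt.continuousWithinAt
        ((continuousAt_const : ContinuousAt (fun _ => (1 : ℝ)) s).congr ?_)
      filter_upwards [isOpen_Iio.mem_nhds (Set.mem_Iio.2 hs)] with t ht
      exact (if_pos ht).symm
    · have h1 : ∀ t ∈ Set.Ici s, (if t < lam ω then (1 : ℝ) else 0) = 0 := fun t ht =>
        if_neg (not_lt.2 (hs.trans ht))
      exact continuousWithinAt_const.congr h1 (h1 s Set.self_mem_Ici)
  have hDm : ∀ n t, MeasurableSet[Subtype.instMeasurableSpace.prod (𝓕 t)]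
      {p : Set.Iic t × Ω | (p.1 : ℝ≥0) ∈ D n p.2} := by
    intro n t
    have h1 := (hlamp t).measurable (measurableSet_singleton (1 : ℝ))
    have h2 := (isStronglyProgressive_pathGauge h.inj_left hw₁.prog hw₁.rightCont t).measurable
      (measurableSet_Iic (a := ((n + 1 : ℝ≥0) : ℝ≥0∞)))
    have h3 := (isStronglyProgressive_pathGauge h.inj_left hw₂.prog hw₂.rightCont t).measurable
      (measurableSet_Iic (a := ((n + 1 : ℝ≥0) : ℝ≥0∞)))
    convert h1.inter (h2.inter h3) using 1
    ext p
    simp [hDdef]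
  have hDl : ∀ n ω, ∀ s ∈ D n ω, s < lam ω := fun n ω s hs => hs.1
  have hDg₁ : ∀ n ω, ∀ s ∈ D n ω,
      pathGauge j s (fun r => w₁ r ω) ≤ ((n + 1 : ℝ≥0) : ℝ≥0∞) := fun n ω s hs => hs.2.1
  have hDg₂ : ∀ n ω, ∀ s ∈ D n ω,
      pathGauge j s (fun r => w₂ r ω) ≤ ((n + 1 : ℝ≥0) : ℝ≥0∞) := fun n ω s hs => hs.2.2
  have hDmem : ∀ (n : ℕ) ω t, t < lam ω → pathGauge j t (fun s => w₁ s ω) ≤ ((n + 1 : ℝ≥0) : ℝ≥0∞) →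
      pathGauge j t (fun s => w₂ s ω) ≤ ((n + 1 : ℝ≥0) : ℝ≥0∞) → t ∈ D n ω :=
    fun n ω t h1 h2 h3 => ⟨h1, h2, h3⟩
  clear_value D
  have key : ∀ n, ∀ᵐ ω ∂μ, ∀ s ∈ D n ω, s ≤ T → w₁ s ω = w₂ s ω := by
    intro n
    have hK : (1 : ℝ≥0) ≤ n + 1 := le_add_self
    have hg₁ := hDg₁ n
    have hg₂ := hDg₂ n
    -- Cutting off the integrands outside `D n` yields processes that are regular on all of `[0, T]`
    -- and equal the solutions, up to the common orbit of the initial value, on `D n`.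
    obtain ⟨y₁, hy₁, hc₁, hi₁⟩ := hw₁.exists_conv h hF hG hT (hD n) (hDm n) (hDl n) hK hg₁
    obtain ⟨y₂, hy₂, hc₂, hi₂⟩ := hw₂.exists_conv h hF hG hT (hD n) (hDm n) (hDl n) hK hg₂
    have hdiff : ∀ᵐ ω ∂μ, ∀ s ∈ D n ω ∩ Set.Iic T, w₁ s ω - w₂ s ω = y₁ s ω - y₂ s ω := by
      refine ae_eq_path_of_forall_ae_eq (u := fun s ω => w₁ s ω - w₂ s ω)
        (v := fun s ω => y₁ s ω - y₂ s ω) (A := fun ω => D n ω ∩ Set.Iic T)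
        (ae_of_all _ fun ω s hs r hr => Set.mem_inter (hD n ω s hs.1 r hr)
          (Set.mem_Iic.2 (hr.trans hs.2))) ?_
        (ae_of_all _ fun ω s _ => ((hy₁.cont ω).sub (hy₂.cont ω)).continuousOn) fun t => ?_
      · filter_upwards [hw₁.cont, hw₂.cont] with ω h1 h2 s hs
        have hsub : Set.Iic s ⊆ Set.Iio (lam ω) := fun r hr =>
          Set.mem_Iio.2 (lt_of_le_of_lt (Set.mem_Iic.1 hr) (hDl n ω s hs.1))
        exact (h1.mono hsub).sub (h2.mono hsub)
      · by_cases ht : t ≤ T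
        · filter_upwards [hi₁ t ht, hi₂ t ht] with ω h1 h2 h3
          refine h.inj_right ?_
          rw [map_sub, map_sub, h1 h3.1, h2 h3.1]
          abel
        · exact ae_of_all _ fun ω hω => absurd hω.2 ht
    obtain ⟨C, hC⟩ := h.exists_estimate
    -- With this value `C * (4 * η) ≤ 1 / 2`: both nonlinearities contribute `2 * η`, once from the
    -- energy and once from the length of the interval.
    set η : ℝ≥0 := 1 / (8 * (C + 1)) with hη
    have hη0 : 0 < η := by positivity
    obtain ⟨cF, hcF⟩ := hF.lintegral_localized_sub_le h.inj_left (n + 1) hK hη0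
    obtain ⟨cG, hcG⟩ := hG.lintegral_localized_sub_le h.inj_left (n + 1) hK hη0
    obtain ⟨δ, hδ0, -, hδ⟩ := exists_pos_mul_le (cF + cG) hη0
    have hzr := hy₁.sub h.inj_left hy₂
    have hMF₁ := memM2_localized (μ := μ) hF h.inj_left hw₁.prog (hD n) (hDm n) hK hg₁ T
    have hMF₂ := memM2_localized (μ := μ) hF h.inj_left hw₂.prog (hD n) (hDm n) hK hg₂ T
    have hMG₁ := memM2_localized (μ := μ) hG h.inj_left hw₁.prog (hD n) (hDm n) hK hg₁ T
    have hMG₂ := memM2_localized (μ := μ) hG h.inj_left hw₂.prog (hD n) (hDm n) hK hg₂ T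
    -- If the difference vanishes up to `a`, then on an interval longer by at most `δ` its norm
    -- satisfies `X ≤ X / 2` with `X < ∞`.
    have step : ∀ a b : ℝ≥0, 0 < b → b ≤ T → b ≤ a + δ →
        (∀ᵐ ω ∂μ, ∀ᵐ s ∂(timeLeb.restrict (Set.Iic a)), y₁ s ω - y₂ s ω = 0) →
        ∫⁻ ω, xNormSq j b (fun s => y₁ s ω - y₂ s ω) ∂μ = 0 := by
      intro a b hb0 hbT hba ha
      set X := ∫⁻ ω, xNormSq j b (fun s => y₁ s ω - y₂ s ω) ∂μ with hX
      have hXfin : X < ∞ := (lintegral_mono fun ω => xNormSq_mono hbT).trans_lt hzr.sqInt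
      have hsmall : ∀ c : ℝ≥0, c ≤ cF + cG →
          (η : ℝ≥0∞) + c * ((b - a : ℝ≥0) : ℝ≥0∞) ≤ η + η := by
        intro c hc
        gcongr
        refine le_trans ?_ (hδ (b - a) (tsub_le_iff_left.2 hba))
        gcongr
      have hlocal : ∀ (c : ℝ≥0) (φ : Ω → ℝ≥0∞), c ≤ cF + cG → (∀ᵐ ω ∂μ, φ ω ≤
          (η + c * ((b - a : ℝ≥0) : ℝ≥0∞)) * xNormSq j b fun s => y₁ s ω - y₂ s ω) →
          ∫⁻ ω, φ ω ∂μ ≤ (η + η) * X := by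
        intro c φ hc hφ
        refine (lintegral_mono_ae hφ).trans ?_
        rw [lintegral_const_mul' _ _
          (ENNReal.add_ne_top.2 ⟨ENNReal.coe_ne_top, ENNReal.mul_ne_top ENNReal.coe_ne_top
            ENNReal.coe_ne_top⟩)]
        exact mul_le_mul_left (hsmall c hc) _
      have hle := hC b hb0 _ _ (fun s ω => y₁ s ω - y₂ s ω) ((hMF₁.sub hMF₂).mono hbT)
        ((hMG₁.sub hMG₂).mono hbT)
        (ae_of_all _ fun ω => ((hy₁.cont ω).sub (hy₂.cont ω)).continuousOn) (fun t ht => by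
          simp only [map_sub]
          exact (hc₁ t (ht.trans hbT)).sub h.semigroup (hc₂ t (ht.trans hbT))
            (hMF₁.mono (ht.trans hbT)).ae_memLp (hMF₂.mono (ht.trans hbT)).ae_memLp)
      have eF := hlocal cF (fun ω => ∫⁻ s in Set.Iic b,
        ‖(if s ∈ D n ω then Function.extend j F 0 (w₁ s ω) else 0) -
          (if s ∈ D n ω then Function.extend j F 0 (w₂ s ω) else 0)‖ₑ ^ 2 ∂timeLeb) le_self_add (by
          filter_upwards [hdiff, ha] with ω h1 h2
          exact hcF (fun s => w₁ s ω) (fun s => w₂ s ω) (fun s => y₁ s ω - y₂ s ω) (D n ω) a b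
            (hD n ω) (hw₁.prog.aestronglyMeasurable_path b ω)
            (hw₂.prog.aestronglyMeasurable_path b ω) (hg₁ ω) (hg₂ ω)
            (fun s hs hsb => h1 s (Set.mem_inter hs (Set.mem_Iic.2 (hsb.trans hbT)))) h2)
      have eG := hlocal cG (fun ω => ∫⁻ s in Set.Iic b,
        ‖(if s ∈ D n ω then Function.extend j G 0 (w₁ s ω) else 0) -
          (if s ∈ D n ω then Function.extend j G 0 (w₂ s ω) else 0)‖ₑ ^ 2 ∂timeLeb) le_add_self (by
          filter_upwards [hdiff, ha] with ω h1 h2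
          exact hcG (fun s => w₁ s ω) (fun s => w₂ s ω) (fun s => y₁ s ω - y₂ s ω) (D n ω) a b
            (hD n ω) (hw₁.prog.aestronglyMeasurable_path b ω)
            (hw₂.prog.aestronglyMeasurable_path b ω) (hg₁ ω) (hg₂ ω)
            (fun s hs hsb => h1 s (Set.mem_inter hs (Set.mem_Iic.2 (hsb.trans hbT)))) h2)
      have e3 : C * (4 * η) ≤ 1 / 2 := by
        calc C * (4 * η) ≤ (C + 1) * (4 * η) := by gcongr; exact le_self_add
          _ = 1 / 2 := by rw [hη]; field_simp; norm_num
      have e4 : (C : ℝ≥0∞) * (4 * η) ≤ 1 / 2 := by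
        have : ((C * (4 * η) : ℝ≥0) : ℝ≥0∞) ≤ ((1 / 2 : ℝ≥0) : ℝ≥0∞) := by exact_mod_cast e3
        refine (le_of_eq (by push_cast; rfl)).trans (this.trans (le_of_eq ?_))
        rw [ENNReal.coe_div (by norm_num)]; simp
      have hhalf : X ≤ X / 2 := by
        calc X ≤ _ := hle
          _ ≤ (C : ℝ≥0∞) * ((η + η) * X + (η + η) * X) := by
            gcongr
            · exact eF
            · exact eG
          _ = (C : ℝ≥0∞) * (4 * η) * X := by ring
          _ ≤ 1 / 2 * X := by gcongr
          _ = X / 2 := by rw [one_div, ENNReal.div_eq_inv_mul]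
      by_contra hX0
      exact absurd (ENNReal.half_lt_self hX0 hXfin.ne) (not_lt.2 hhalf)
    have hzero : ∀ b, ∫⁻ ω, xNormSq j b (fun s => y₁ s ω - y₂ s ω) ∂μ = 0 →
        ∀ᵐ ω ∂μ, ∀ s ≤ b, y₁ s ω - y₂ s ω = 0 := by
      intro b hb
      rw [lintegral_eq_zero_iff (hzr.measurable h.inj_left b)] at hb
      filter_upwards [hb] with ω hω
      exact eq_zero_of_xNormSq_eq_zero hω
    -- The step length `δ` depends only on the level `n`, so finitely many steps reach `T`.
    have hind : ∀ k : ℕ, ∀ᵐ ω ∂μ, ∀ᵐ s ∂(timeLeb.restrict (Set.Iic (min (k * δ) T))),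
        y₁ s ω - y₂ s ω = 0 := by
      intro k
      induction k with
      | zero =>
        refine ae_of_all _ fun ω => ?_
        have : timeLeb.restrict (Set.Iic (min (((0 : ℕ) : ℝ≥0) * δ) T)) = 0 := by
          rw [Measure.restrict_eq_zero, timeLeb_Iic]; simp
        rw [this]
        simp
      | succ k ih =>
        have h1 := step _ (min ((k + 1 : ℕ) * δ) T) (lt_min (by positivity) hT) (min_le_right _ _)
          (by
            rcases le_total (k * δ) T with hk | hk
            · rw [min_eq_left hk]
              refine (min_le_left _ _).trans (le_of_eq ?_)
              push_cast; ring
            · rw [min_eq_right hk]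
              exact (min_le_right _ _).trans le_self_add) ih
        filter_upwards [hzero _ h1] with ω hω
        filter_upwards [ae_restrict_mem measurableSet_Iic] with s hs
        exact hω s hs
    obtain ⟨k, hk⟩ := exists_nat_ge (T / δ)
    have hkT : min (k * δ) T = T := min_eq_right ((div_le_iff₀ hδ0).1 hk)
    have hfinal := hind k
    rw [hkT] at hfinal
    filter_upwards [hdiff, hzero T (step T T hT le_rfl le_self_add hfinal)] with ω h1 h2 s hs hsT
    rw [← sub_eq_zero, h1 s (Set.mem_inter hs (Set.mem_Iic.2 hsT)), h2 s hsT]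
  filter_upwards [ae_all_iff.2 key, hw₁.finite T, hw₂.finite T] with ω h1 h2 h3 hTl s hs
  obtain ⟨n, hn⟩ := ENNReal.exists_nat_gt (max_lt (h2 hTl) (h3 hTl)).ne
  have hn' : (n : ℝ≥0∞) ≤ ((n + 1 : ℝ≥0) : ℝ≥0∞) := by exact_mod_cast (Nat.le_succ n)
  refine h1 n s (hD n ω T (hDmem n ω T hTl ?_ ?_) s hs) hs
  · exact ((le_max_left _ _).trans hn.le).trans hn'
  · exact ((le_max_right _ _).trans hn.le).trans hn'

/-- Local mild solutions with the same initial value agree up to the minimum of the life times. -/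
theorem MildSetting.localEquiv (h : MildSetting μ 𝓕 W j i S) (hF : IsPolyLipschitz j F)
    (hG : IsPolyLipschitz j G) {u v : ℝ≥0 → Ω → V} {τ σ : Ω → ℝ≥0∞}
    (hu : IsLocalMildSolution μ 𝓕 W j i S F G u₀ u τ)
    (hv : IsLocalMildSolution μ 𝓕 W j i S F G u₀ v σ) :
    LocalEquiv μ u (fun ω => min (τ ω) (σ ω)) v (fun ω => min (τ ω) (σ ω)) := by
  refine ⟨Filter.EventuallyEq.rfl, fun t ht => ?_⟩
  obtain ⟨τm, hτ, hmτ⟩ := hu.mild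
  obtain ⟨σm, hσ, hmσ⟩ := hv.mild
  -- The comparison runs up to the smaller of the `m`-th announcing times, which stays below both
  -- life times; as `m` grows these minima exhaust the common interval.
  have key : ∀ m, ∀ᵐ ω ∂μ, t < min (τm m ω) (σm m ω) → ∀ s ≤ t, u s ω = v s ω := by
    intro m
    have hlam : ∀ t, MeasurableSet[𝓕 t] {ω | t < min (τm m ω) (σm m ω)} := by
      intro t
      have h1 := ((hτ.1 m) t).compl.inter ((hσ.1 m) t).compl
      convert h1 using 1
      ext ω
      simp only [Set.mem_ofPred_eq, Set.mem_inter_iff, Set.mem_compl_iff]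
      rw [WithTop.coe_le_coe, WithTop.coe_le_coe, not_le, not_le, lt_min_iff]
    obtain ⟨hfin, J, -, hJ, hm⟩ := hmτ m
    obtain ⟨hfin', J', -, hJ', hm'⟩ := hmσ m
    obtain ⟨w₁, hw₁, hwu⟩ := exists_isStoppedSolution h hu.admissible
      (hτ.2.mono fun ω hω => hω.2.1 m) hfin hJ hm hlam fun ω => min_le_left _ _
    obtain ⟨w₂, hw₂, hwv⟩ := exists_isStoppedSolution h hv.admissible
      (hσ.2.mono fun ω hω => hω.2.1 m) hfin' hJ' hm' hlam fun ω => min_le_right _ _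
    filter_upwards [hw₁.ae_eq h hF hG hlam hw₂ ht, hwu, hwv] with ω h1 h2 h3 h4 s hs
    have h5 := lt_of_le_of_lt hs h4
    rw [← h2 s h5, ← h3 s h5, h1 h4 s hs]
  filter_upwards [ae_all_iff.2 key, hτ.2, hσ.2] with ω h1 h2 h3 h4 _
  obtain ⟨h5, h6⟩ := lt_min_iff.1 h4
  obtain ⟨m, hm1, hm2⟩ := ((h2.2.2.eventually_const_lt h5).and
    (h3.2.2.eventually_const_lt h6)).exists
  exact h1 m (lt_min (ENNReal.coe_lt_coe.1 hm1) (ENNReal.coe_lt_coe.1 hm2))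

end Uniqueness

theorem theorem3p1
    {E V H Ω : Type*}
    [NormedAddCommGroup E] [NormedSpace ℝ E] [CompleteSpace E] [TopologicalSpace.SeparableSpace E]
    [NormedAddCommGroup V] [NormedSpace ℝ V] [CompleteSpace V] [TopologicalSpace.SeparableSpace V]
    [NormedAddCommGroup H] [NormedSpace ℝ H] [CompleteSpace H] [TopologicalSpace.SeparableSpace H]
    {mΩ : MeasurableSpace Ω} (μ : Measure Ω) [IsProbabilityMeasure μ]
    (𝓕 : Filtration ℝ≥0 mΩ) (h𝓕 : UsualConditions μ 𝓕)
    (W : ℝ≥0 → Ω → ℝ) (hW : IsWiener μ 𝓕 W)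
    -- the continuous embeddings `E ⊂ V ⊂ H`
    (j : E →L[ℝ] V) (hj : Function.Injective j)
    (i : V →L[ℝ] H) (hi : Function.Injective i)
    (S : ℝ≥0 → H →L[ℝ] H) (hS : IsC0Semigroup S)
    (F : E → H) (hF : IsPolyLipschitz j F)
    (G : E → V) (hG : IsPolyLipschitz j G)
    (hreg : MaximalRegularity μ 𝓕 W j i S) :
    ∃ tau : ℝ → ℝ → ℝ,
      (∀ ε R : ℝ, 0 < ε → 0 < R → 0 < tau ε R) ∧
      ∀ u₀ : Ω → V, StronglyMeasurable[𝓕 0] u₀ → MemLp u₀ 2 μ →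
        ∃ (u : ℝ≥0 → Ω → V) (T₁ : Ω → ℝ≥0∞),
          IsUniqueLocalMildSolution μ 𝓕 W j i S F G u₀ u T₁ ∧
          ∀ ε R : ℝ, 0 < ε → 0 < R → ∫ ω, ‖u₀ ω‖ ^ 2 ∂μ ≤ R ^ 2 →
            ENNReal.ofReal (1 - ε) ≤ μ {ω | ENNReal.ofReal (tau ε R) ≤ T₁ ω} := by 
  have : SecondCountableTopology E := UniformSpace.secondCountable_of_separable E
  have : SecondCountableTopology V := UniformSpace.secondCountable_of_separable V
  have : SecondCountableTopology H := UniformSpace.secondCountable_of_separable H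
  have h : MildSetting μ 𝓕 W j i S := ⟨h𝓕, hW, hj, hi, hS, hreg⟩
  obtain ⟨tau, htau, hex⟩ := h.exists_localMildSolution hF hG
  refine ⟨tau, htau, fun u₀ hu₀ hu₀L => ?_⟩
  obtain ⟨u, T₁, hu, hT₁⟩ := hex u₀ hu₀ hu₀L
  exact ⟨u, T₁, ⟨hu, fun v σ hv => h.localEquiv hF hG hu hv⟩, hT₁⟩
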